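/- Let $\Omega\subset\mathbb R^2$ be a bounded domain with Lipschitz boundary, $\mathbf V=(H^1_0(\Omega))^2$, $Q=L^2_0(\Omega)$, and $$a(\mathbf u,\mathbf v)=\int_\Omega\nabla\mathbf u:\nabla\mathbf v,\qquad b(\mathbf v,p)=\int_\Omega p\,\nabla\!\cdot\mathbf v,\qquad r(\mathbf u,\mathbf v)=\int_\Omega\mathbf u\cdot\mathbf v .$$ Let $\|\cdot\|_1$ be the $H^1$ norm, $\|\cdot\|_0$ the $L^2$ norm, and $\|\mathbf f\|_{-1}=\sup\{r(\mathbf f,\mathbf v):\mathbf v\in\mathbf V,\ \|\mathbf v\|_1\le1\}$. Let $\lambda\in\mathbb R$. *Exact eigenpair.* Let $(\mathbf u,p)\in\mathbf V\times Q$ satisfy $r(\mathbf u,\mathbf u)=1$, $a(\mathbf u,\mathbf v)-b(\mathbf v,p)=\lambda r(\mathbf u,\mathbf v)$ for all $\mathbf v\in\mathbf V$, and $b(\mathbf u,q)=0$ for all $q\in Q$. *Stabilization.* Given a decomposition $\mathcal T_h$ of $\overline\Omega$ into finitely many closed cells $K$ with Lipschitz boundary and disjoint interiors, finite dimensional spaces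 $D_h(K)\subset L^2(K)$ containing the polynomials of degree $\le s$ for some fixed $s\ge-1$ (no condition if $s=-1$), and parameters $\alpha_K\ge0$, put $S_h(p,q)=\sum_{K}\alpha_K(\kappa_h\nabla p,\kappa_h\nabla q)_{L^2(K)}$ for $p,q\in H^1(\Omega)$, where $\kappa_h=\mathrm{id}-\pi_h$ and $\pi_h$ is, on each $K$ and componentwise, the $L^2(K)$-orthogonal projection onto $D_h(K)$. *Discrete eigenpair.* Let $V_h$ be a finite dimensional space of continuous functions on $\overline\Omega$ that are polynomial on each cell of $\mathcal T_h$, $\mathbf V_h=V_h^2\cap\mathbf V$, $Q_h=V_h\cap Q$, and let $(\mathbf u_h,p_h,\lambda_h)\in\mathbf V_h\times Q_h\times\mathbb R$ satisfy $r(\mathbf u_h,\mathbf u_h)=1$, $a(\mathbf u_h,\mathbf v)-b(\mathbf v,p_h)=\lambda_hr(\mathbf u_h,\mathbf v)$ for all $\mathbf v\in\mathbf V_h$, and $b(\mathbf u_h,q)+S_h(p_h,q)=0$ for all $q\in Q_h$. *Auxiliary source problem.* Let $(\tilde{\mathbf u},\tilde p)\in\mathbf V\times Q$ satisfy $a(\tilde{\mathbf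 u},\mathbf v)-b(\mathbf v,\tilde p)=\lambda_hr(\mathbf u_h,\mathbf v)$ for all $\mathbf v\in\mathbf V$ and $b(\tilde{\mathbf u},q)=0$ for all $q\in Q$. *Discrete source problem.* Let $\tilde{\mathbf V}_h\times\tilde Q_h$ be an enriched space, $\mathbf V_h\times Q_h\subset\tilde{\mathbf V}_h\times\tilde Q_h\subset\mathbf V\times(Q\cap H^1(\Omega))$, let $\tilde S_h$ be the stabilization form used with it (of the above kind, on the same or on another mesh), and let $(\tilde{\mathbf u}_h,\tilde p_h)\in\tilde{\mathbf V}_h\times\tilde Q_h$ satisfy $a(\tilde{\mathbf u}_h,\mathbf v)-b(\mathbf v,\tilde p_h)=\lambda_hr(\mathbf u_h,\mathbf v)$ for all $\mathbf v\in\tilde{\mathbf V}_h$ and $b(\tilde{\mathbf u}_h,q)+\tilde S_h(\tilde p_h,q)=0$ for all $q\in\tilde Q_h$. Put $\tilde\lambda_h=a(\tilde{\mathbf u}_h,\tilde{\mathbf u}_h)/r(\tilde{\mathbf u}_h,\tilde{\mathbf u}_h)$ and $$\varepsilon=\|\mathbf u-\mathbf u_h\|_{-1}+|\lambda-\lambda_h|+\|\tilde{\mathbf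 u}-\tilde{\mathbf u}_h\|_1+\|\tilde p-\tilde p_h\|_0 .$$ Then there is $\delta>0$ depending only on $\Omega$ and $\lambda$, and for every $c_0>0$ there is $C>0$ depending only on $\Omega$, $\lambda$ and $c_0$ (and not on the meshes, the discrete spaces or the stabilizations), such that $$\|\tilde{\mathbf u}_h-\mathbf u\|_1+\|\tilde p_h-p\|_0\le C\varepsilon$$ and, whenever $\varepsilon\le\delta$ or $r(\tilde{\mathbf u}_h,\tilde{\mathbf u}_h)\ge c_0$, $$|\tilde\lambda_h-\lambda|\le C\varepsilon^2+C\,\tilde S_h(\tilde p_h,\tilde p_h).$$ -/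

import Mathlib

open MeasureTheory Filter Topology
open scoped ContDiff NNReal

noncomputable section

namespace StokesLPS

/-- The plane, with its Euclidean norm and Lebesgue measure. -/
abbrev Plane := EuclideanSpace ℝ (Fin 2)

/-- The boundary of `Ω` is, near each of its points and in suitable orthonormal coordinates, the
graph of a Lipschitz function, with `Ω` locally on one side (strictly above the graph). -/
def HasLipschitzBoundary (Ω : Set Plane) : Prop :=
  ∀ x ∈ frontier Ω, ∃ (e : Plane ≃ₗᵢ[ℝ] Plane) (γ : ℝ → ℝ) (L : ℝ≥0), LipschitzWith L γ ∧
    ∀ᶠ y in 𝓝 x, (y ∈ Ω ↔ γ (e y 0) < e y 1)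

/-- A bounded domain (non-empty connected open set) with Lipschitz boundary. -/
structure IsBoundedLipschitzDomain (Ω : Set Plane) : Prop where
  isOpen : IsOpen Ω
  isConnected : IsConnected Ω
  isBounded : Bornology.IsBounded Ω
  lipschitzBoundary : HasLipschitzBoundary Ω

/-! ### Function spaces -/

/-- `L²(Ω)`. -/
abbrev L2 (Ω : Set Plane) := Lp ℝ 2 (volume.restrict Ω)

/-- Pairs `(w, g)` of a function in `L²(Ω)` and a field in `L²(Ω)²`; the Sobolev spaces below
consist of the pairs in which `g` is the weak gradient of `w` (and so is determined by `w`). -/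
abbrev Jet (Ω : Set Plane) := L2 Ω × (Fin 2 → L2 Ω)

/-- The pairs `(φ, ∇φ)` for `φ ∈ C_c^∞(Ω)`. -/
def testJets (Ω : Set Plane) : Set (Jet Ω) :=
  {j | ∃ φ : Plane → ℝ, ContDiff ℝ ∞ φ ∧ HasCompactSupport φ ∧ tsupport φ ⊆ Ω ∧
    j.1 =ᵐ[volume.restrict Ω] φ ∧
    ∀ i, j.2 i =ᵐ[volume.restrict Ω] fun x => fderiv ℝ φ x (EuclideanSpace.single i 1)}

/-- `H¹(Ω)`: the pairs `(w, g)` with `∫ w ∂ᵢφ = - ∫ gᵢ φ` for all `φ ∈ C_c^∞(Ω)`. -/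
def H1 (Ω : Set Plane) : Submodule ℝ (Jet Ω) where
  carrier := {j | ∀ t ∈ testJets Ω, ∀ i, inner ℝ j.1 (t.2 i) = - inner ℝ (j.2 i) t.1}
  zero_mem' := by intro t _ i; simp
  add_mem' := by
    intro j k hj hk t ht i
    simp only [Prod.fst_add, Prod.snd_add, Pi.add_apply, inner_add_left, hj t ht i, hk t ht i]
    ring
  smul_mem' := by
    intro c j hj t ht i
    simp only [Prod.smul_fst, Prod.smul_snd, Pi.smul_apply, real_inner_smul_left, hj t ht i]
    ring

/-- `H¹₀(Ω)`: the closure of `C_c^∞(Ω)` in the topology of the `H¹` norm. -/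
def H10 (Ω : Set Plane) : Submodule ℝ (Jet Ω) :=
  (Submodule.span ℝ (testJets Ω)).topologicalClosure

/-- The velocity space `V = H¹₀(Ω)²`. -/
abbrev Velocity (Ω : Set Plane) := Fin 2 → H10 Ω

/-- The underlying element of `L²(Ω)²`. -/
def Velocity.val {Ω : Set Plane} (v : Velocity Ω) : Fin 2 → L2 Ω := fun i => (v i).1.1

/-- `v.grad i j = ∂ⱼ vᵢ`. -/
def Velocity.grad {Ω : Set Plane} (v : Velocity Ω) : Fin 2 → Fin 2 → L2 Ω :=
  fun i j => (v i).1.2 j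

/-- The divergence. -/
def Velocity.div {Ω : Set Plane} (v : Velocity Ω) : L2 Ω := ∑ i, v.grad i i

/-- `p` has mean value zero; the pressure space `Q = L²₀(Ω)` consists of these `p`. -/
def MeanZero {Ω : Set Plane} (p : L2 Ω) : Prop := ∫ x in Ω, p x = 0

/-! ### Forms and norms -/

/-- `a(u, v) = ∫ ∇u : ∇v`. -/
def aForm {Ω : Set Plane} (u v : Velocity Ω) : ℝ := ∑ i, ∑ j, inner ℝ (u.grad i j) (v.grad i j)

/-- `b(v, p) = ∫ (div v) p`. -/
def bForm {Ω : Set Plane} (v : Velocity Ω) (p : L2 Ω) : ℝ := inner ℝ v.div p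

/-- `r(f, g) = ∫ f · g`. -/
def rForm {Ω : Set Plane} (f g : Fin 2 → L2 Ω) : ℝ := ∑ i, inner ℝ (f i) (g i)

/-- `‖v‖₁`, the full `H¹(Ω)²` norm. -/
def norm1 {Ω : Set Plane} (v : Velocity Ω) : ℝ :=
  Real.sqrt (rForm v.val v.val + aForm v v)

/-- `‖f‖₋₁`, the norm of `f ∈ L²(Ω)²` as a functional on `(H¹₀(Ω)², ‖·‖₁)`. -/
def normNeg1 {Ω : Set Plane} (f : Fin 2 → L2 Ω) : ℝ :=
  sSup {t | ∃ v : Velocity Ω, norm1 v ≤ 1 ∧ t = rForm f v.val}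

/-! ### Meshes, finite element spaces and the stabilization term -/

/-- A decomposition of `closure Ω` into finitely many closed cells, each the closure of its
non-empty interior, with Lipschitz boundaries and pairwise disjoint interiors. -/
structure Mesh (Ω : Set Plane) where
  cells : Finset (Set Plane)
  closure_interior : ∀ K ∈ cells, closure (interior K) = K
  nonempty : ∀ K ∈ cells, (interior K).Nonempty
  lipschitz : ∀ K ∈ cells, HasLipschitzBoundary (interior K)
  disjoint : ∀ K ∈ cells, ∀ K' ∈ cells, K ≠ K' → Disjoint (interior K) (interior K')
  cover : (⋃ K ∈ cells, K) = closure Ω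

/-- The polynomial function on the plane given by `P`. -/
def polyFun (P : MvPolynomial (Fin 2) ℝ) (x : Plane) : ℝ := MvPolynomial.eval (fun i => x i) P

/-- A scalar finite element space `V_h` over a mesh: a finite dimensional space of continuous
functions on `closure Ω` whose restriction to each cell is a polynomial. -/
structure ScalarFE {Ω : Set Plane} (T : Mesh Ω) where
  space : Submodule ℝ C(closure Ω, ℝ)
  finiteDim : FiniteDimensional ℝ space
  piecewisePoly : ∀ w ∈ space, ∀ K ∈ T.cells, ∃ P : MvPolynomial (Fin 2) ℝ,
    ∀ x : closure Ω, (x : Plane) ∈ K → w x = polyFun P x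

/-- The class `f ∈ L²(Ω)` is represented by a function of the finite element space. -/
def ScalarFE.Contains {Ω : Set Plane} {T : Mesh Ω} (W : ScalarFE T) (f : L2 Ω) : Prop :=
  ∃ w ∈ W.space, ∀ᵐ x ∂(volume.restrict Ω), ∀ hx : x ∈ closure Ω, f x = w ⟨x, hx⟩

/-- The discrete velocity space `V_h² ∩ V`. -/
def ScalarFE.velocities {Ω : Set Plane} {T : Mesh Ω} (W : ScalarFE T) : Set (Velocity Ω) :=
  {v | ∀ i, W.Contains (v.val i)}

/-- The discrete pressure space `V_h ∩ Q`. Its elements are carried with their weak gradient. -/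
def ScalarFE.pressures {Ω : Set Plane} {T : Mesh Ω} (W : ScalarFE T) : Set (H1 Ω) :=
  {p | W.Contains p.1.1 ∧ MeanZero p.1.1}

/-- `L²(K)` for a cell `K ⊆ closure Ω` (the boundary of `Ω` is a null set). -/
abbrev L2Cell (Ω K : Set Plane) := Lp ℝ 2 ((volume.restrict Ω).restrict K)

/-- The data of a local projection stabilization: on every cell a finite dimensional projection
space `D_h(K) ⊆ L²(K)` containing the polynomials of degree `< m` (so `m = s + 1`, and `m = 0`
stands for `s = -1`), and a parameter `α_K ≥ 0`. -/
structure Stabilization (Ω : Set Plane) where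
  mesh : Mesh Ω
  m : ℕ
  D : ∀ K : mesh.cells, Submodule ℝ (L2Cell Ω K)
  finiteDim : ∀ K : mesh.cells, FiniteDimensional ℝ (D K)
  poly_mem : ∀ K : mesh.cells, ∀ P : MvPolynomial (Fin 2) ℝ, P.totalDegree < m →
    ∀ f : L2Cell Ω K, f =ᵐ[(volume.restrict Ω).restrict (K : Set Plane)] polyFun P → f ∈ D K
  α : mesh.cells → ℝ
  α_nonneg : ∀ K, 0 ≤ α K

attribute [instance] Stabilization.finiteDim

/-- The fluctuation operator on the cell `K`: `w ↦ w|_K - π_K (w|_K)` with `π_K` the orthogonal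
projection of `L²(K)` onto `D_h(K)`. -/
def Stabilization.κ {Ω : Set Plane} (S : Stabilization Ω) (K : S.mesh.cells) (w : L2 Ω) :
    L2Cell Ω K :=
  LpToLpRestrictCLM Plane ℝ ℝ (volume.restrict Ω) 2 K w -
    (S.D K).starProjection (LpToLpRestrictCLM Plane ℝ ℝ (volume.restrict Ω) 2 K w)

/-- `S_h(p, q) = ∑_K α_K (κ_h ∇p, κ_h ∇q)_K`. -/
def Stabilization.form {Ω : Set Plane} (S : Stabilization Ω) (p q : H1 Ω) : ℝ :=
  ∑ K : S.mesh.cells, S.α K * ∑ i, inner ℝ (S.κ K (p.1.2 i)) (S.κ K (q.1.2 i))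

/-! ### The four problems -/

/-- `(u, p, lam)` solves the weak Stokes eigenvalue problem, with `r(u, u) = 1`. -/
structure IsStokesEigen {Ω : Set Plane} (u : Velocity Ω) (p : L2 Ω) (lam : ℝ) : Prop where
  meanZero : MeanZero p
  normalized : rForm u.val u.val = 1
  momentum : ∀ v : Velocity Ω, aForm u v - bForm v p = lam * rForm u.val v.val
  incompressible : ∀ q : L2 Ω, MeanZero q → bForm u q = 0

/-- `(u, p)` solves the weak Stokes source problem with load `f`. -/
structure IsStokesSource {Ω : Set Plane} (f : Fin 2 → L2 Ω) (u : Velocity Ω) (p : L2 Ω) :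
    Prop where
  meanZero : MeanZero p
  momentum : ∀ v : Velocity Ω, aForm u v - bForm v p = rForm f v.val
  incompressible : ∀ q : L2 Ω, MeanZero q → bForm u q = 0

/-- `(u, p) ∈ V × Q` solves the stabilized discrete Stokes source problem with load `f` in the
discrete spaces `V`, `Q`. -/
structure IsDiscreteSource {Ω : Set Plane} (V : Set (Velocity Ω)) (Q : Set (H1 Ω))
    (S : Stabilization Ω) (f : Fin 2 → L2 Ω) (u : Velocity Ω) (p : H1 Ω) : Prop where
  mem_velocity : u ∈ V
  mem_pressure : p ∈ Q
  momentum : ∀ v ∈ V, aForm u v - bForm v p.1.1 = rForm f v.val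
  stabilized : ∀ q ∈ Q, bForm u q.1.1 + S.form p q = 0

/-- `(u, p, lam) ∈ V × Q × ℝ` solves the stabilized discrete Stokes eigenvalue problem in the
discrete spaces `V`, `Q`, with `r(u, u) = 1`. -/
structure IsDiscreteEigen {Ω : Set Plane} (V : Set (Velocity Ω)) (Q : Set (H1 Ω))
    (S : Stabilization Ω) (u : Velocity Ω) (p : H1 Ω) (lam : ℝ) : Prop where
  mem_velocity : u ∈ V
  mem_pressure : p ∈ Q
  normalized : rForm u.val u.val = 1
  momentum : ∀ v ∈ V, aForm u v - bForm v p.1.1 = lam * rForm u.val v.val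
  stabilized : ∀ q ∈ Q, bForm u q.1.1 + S.form p q = 0

/-- The Rayleigh quotient `a(w, w) / r(w, w)`. -/
def rayleigh {Ω : Set Plane} (w : Velocity Ω) : ℝ := aForm w w / rForm w.val w.val

end StokesLPS

end

open StokesLPS

open MeasureTheory Filter Topology
open scoped ContDiff NNReal
noncomputable section
namespace StokesLPS

/-! ### Partial derivatives and test functions -/

/-! The pair (ũ - u, p̃ - p) solves a Stokes problem with load -λ(u - u_h) - (λ - λ_h)u_h, so
stability of the continuous Stokes problem bounds it by ‖u - u_h‖₋₁ + |λ - λ_h|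
(`exists_stokes_stability`), and the triangle inequality through (ũ, p̃) gives the first estimate.

For the eigenvalue put w = ũ_h, q = p̃_h, d = w - u. The exact equations, and b(w, q) = -S̃_h(q, q),
which is the discrete continuity equation tested with q, give the identity a(w,w) - λ r(w,w) =
a(d,d) - λ r(d,d) - 2 b(d, q - p) - 2 S̃_h(q,q). No term linear in the error survives
(`rayleigh_defect_le`). Division by r(w,w) is harmless if r(w,w) ≥ c₀, or if w is so close to the
normalized u that r(w,w) ≥ 1/4.

The analytic weight lies in stability, that is in the Poincaré inequality (`exists_poincare`) and
the inf-sup condition on a bounded Lipschitz domain (`exists_infSup`): the L² distance of p to the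
constants is controlled by the H⁻¹ norm M of ∇p. This is built up from balls.

On one ball, a test function of mean zero is the divergence of a test field on the fourfold ball
with a scale-free bound (`exists_div_eq_ball`). The field is a cut-off gradient of a resolvent of
the Laplacian; the cut-off error is smoother by one derivative and is removed by explicit line
integrals. For a family of balls of overlap N, testing ∇p with the sum of the local fields bounds
the sum of all local oscillations of p by C N M² (`exists_sum_oscillation_le`).

At the boundary, Whitney balls are laid above the Lipschitz graph so that each point and its image
under a slight dilation Ψ of the height share a ball. Hence p - p∘Ψ is small in L². Since Ψ spreads
volume by 1 + σ, the integral of (p∘Ψ - c)² over the patch is at most (1 + σ)⁻¹ times that of (p -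
c)² over the patch and one top ball, and the patch term can be absorbed (`oscControlled_patch`).
Compactness and connectedness glue the pieces together (`OscControlled.of_local`). -/

/-- The `i`-th partial derivative. -/
def pd (i : Fin 2) (φ : Plane → ℝ) : Plane → ℝ :=
  fun x => fderiv ℝ φ x (EuclideanSpace.single i 1)

/-- `φ ∈ C_c^∞(U)`. -/
structure IsTest (U : Set Plane) (φ : Plane → ℝ) : Prop where
  contDiff : ContDiff ℝ ∞ φ
  compact : HasCompactSupport φ
  subset : tsupport φ ⊆ U

lemma contDiff_pd {φ : Plane → ℝ} (h : ContDiff ℝ ∞ φ) (i : Fin 2) : ContDiff ℝ ∞ (pd i φ) :=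
  (h.fderiv_right (m := ∞) (by simp)).clm_apply contDiff_const

lemma _root_.ContDiff.diffAt {φ : Plane → ℝ} (h : ContDiff ℝ ∞ φ) (x : Plane) :
    DifferentiableAt ℝ φ x :=
  h.differentiable (by simp) x

lemma pd_add {φ ψ : Plane → ℝ} (hφ : ContDiff ℝ ∞ φ) (hψ : ContDiff ℝ ∞ ψ) (i : Fin 2)
    (x : Plane) : pd i (fun y => φ y + ψ y) x = pd i φ x + pd i ψ x := by
  simp [pd, fderiv_fun_add (hφ.diffAt x) (hψ.diffAt x)]

lemma pd_sub {φ ψ : Plane → ℝ} (hφ : ContDiff ℝ ∞ φ) (hψ : ContDiff ℝ ∞ ψ) (i : Fin 2)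
    (x : Plane) : pd i (fun y => φ y - ψ y) x = pd i φ x - pd i ψ x := by
  simp [pd, fderiv_fun_sub (hφ.diffAt x) (hψ.diffAt x)]

lemma pd_mul {φ ψ : Plane → ℝ} (hφ : ContDiff ℝ ∞ φ) (hψ : ContDiff ℝ ∞ ψ) (i : Fin 2)
    (x : Plane) : pd i (fun y => φ y * ψ y) x = φ x * pd i ψ x + pd i φ x * ψ x := by
  simp [pd, fderiv_fun_mul (hφ.diffAt x) (hψ.diffAt x)]
  ring

lemma pd_const_mul {φ : Plane → ℝ} (hφ : ContDiff ℝ ∞ φ) (c : ℝ) (i : Fin 2)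
    (x : Plane) : pd i (fun y => c * φ y) x = c * pd i φ x := by
  simp [pd, fderiv_const_mul (hφ.diffAt x)]

lemma pd_sum {ι : Type*} (s : Finset ι) {φ : ι → Plane → ℝ} (hφ : ∀ k ∈ s, ContDiff ℝ ∞ (φ k))
    (i : Fin 2) (x : Plane) : pd i (fun y => ∑ k ∈ s, φ k y) x = ∑ k ∈ s, pd i (φ k) x := by
  simp only [pd]
  rw [fderiv_fun_sum fun k hk => (hφ k hk).diffAt x]
  simp

lemma pd_eq_zero_of_notMem {φ : Plane → ℝ} {x : Plane} (hx : x ∉ tsupport φ) (i : Fin 2) :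
    pd i φ x = 0 := by
  simp [pd, fderiv_of_notMem_tsupport ℝ hx]

lemma tsupport_pd_subset (φ : Plane → ℝ) (i : Fin 2) : tsupport (pd i φ) ⊆ tsupport φ := by
  refine closure_minimal (fun x hx => ?_) (isClosed_tsupport φ)
  by_contra h
  exact hx (pd_eq_zero_of_notMem h i)

lemma pd_pd_comm {φ : Plane → ℝ} (h : ContDiff ℝ ∞ φ) (i j : Fin 2) (x : Plane) :
    pd i (pd j φ) x = pd j (pd i φ) x := by
  have hs : IsSymmSndFDerivAt ℝ φ x := h.contDiffAt.isSymmSndFDerivAt (by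
    simpa using (WithTop.coe_le_coe.2 le_top : ((2 : ℕ∞) : WithTop ℕ∞) ≤ ∞))
  have key : ∀ a b : Fin 2, pd a (pd b φ) x =
      fderiv ℝ (fderiv ℝ φ) x (EuclideanSpace.single a 1) (EuclideanSpace.single b 1) := by
    intro a b
    have hd : DifferentiableAt ℝ (fderiv ℝ φ) x :=
      (h.fderiv_right (m := ∞) (by simp)).differentiable (by simp) x
    have he : pd b φ = fun y => fderiv ℝ φ y (EuclideanSpace.single b 1) := rfl
    rw [pd, he, fderiv_clm_apply hd (differentiableAt_const _)]
    simp
  rw [key, key, hs.eq]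

namespace IsTest

variable {U : Set Plane} {φ ψ : Plane → ℝ}

lemma mono {V : Set Plane} (h : IsTest U φ) (hUV : U ⊆ V) : IsTest V φ :=
  ⟨h.contDiff, h.compact, h.subset.trans hUV⟩

lemma of_eq_zero {K : Set Plane} (h : ContDiff ℝ ∞ φ) (hK : IsCompact K)
    (h0 : ∀ x ∉ K, φ x = 0) (hKU : K ⊆ U) : IsTest U φ := by
  have hs : tsupport φ ⊆ K := by
    refine closure_minimal (fun x hx => ?_) hK.isClosed
    by_contra hxK
    exact hx (h0 x hxK)
  exact ⟨h, HasCompactSupport.of_support_subset_isCompact hK (subset_closure.trans hs),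
    hs.trans hKU⟩

lemma of_imp (h : IsTest U φ) (hψ : ContDiff ℝ ∞ ψ) (h0 : ∀ x, φ x = 0 → ψ x = 0) :
    IsTest U ψ :=
  of_eq_zero hψ h.compact (fun x hx => h0 x (image_eq_zero_of_notMem_tsupport hx)) h.subset

lemma add (hφ : IsTest U φ) (hψ : IsTest U ψ) : IsTest U (fun x => φ x + ψ x) :=
  of_eq_zero (hφ.contDiff.add hψ.contDiff) (hφ.compact.isCompact.union hψ.compact.isCompact)
    (fun x hx => by
      rw [Set.mem_union, not_or] at hx
      simp [image_eq_zero_of_notMem_tsupport hx.1, image_eq_zero_of_notMem_tsupport hx.2])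
    (Set.union_subset hφ.subset hψ.subset)

lemma const_mul (hφ : IsTest U φ) (c : ℝ) : IsTest U (fun x => c * φ x) :=
  hφ.of_imp (contDiff_const.mul hφ.contDiff) (fun x h => by simp [h])

lemma sub (hφ : IsTest U φ) (hψ : IsTest U ψ) : IsTest U (fun x => φ x - ψ x) := by
  simpa [sub_eq_add_neg] using hφ.add (hψ.const_mul (-1))

lemma mul_left (hφ : IsTest U φ) (hψ : ContDiff ℝ ∞ ψ) : IsTest U (fun x => ψ x * φ x) :=
  hφ.of_imp (hψ.mul hφ.contDiff) (fun x h => by simp [h])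

lemma mul_right (hφ : IsTest U φ) (hψ : ContDiff ℝ ∞ ψ) : IsTest U (fun x => φ x * ψ x) :=
  hφ.of_imp (hφ.contDiff.mul hψ) (fun x h => by simp [h])

lemma zero : IsTest U (fun _ => 0) :=
  of_eq_zero contDiff_const isCompact_empty (fun _ _ => rfl) (Set.empty_subset _)

lemma sum {ι : Type*} (s : Finset ι) {φ : ι → Plane → ℝ} (h : ∀ k ∈ s, IsTest U (φ k)) :
    IsTest U (fun x => ∑ k ∈ s, φ k x) := by
  classical
  induction s using Finset.induction_on with
  | empty => simpa using zero
  | insert a s ha ih =>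
    simp only [Finset.sum_insert ha]
    exact (h a (by simp)).add (ih fun k hk => h k (by simp [hk]))

lemma pd (hφ : IsTest U φ) (i : Fin 2) : IsTest U (pd i φ) :=
  ⟨contDiff_pd hφ.contDiff i, hφ.compact.mono' (subset_closure.trans (tsupport_pd_subset φ i)),
    (tsupport_pd_subset φ i).trans hφ.subset⟩

lemma eq_zero (hφ : IsTest U φ) {x : Plane} (hx : x ∉ U) : φ x = 0 :=
  image_eq_zero_of_notMem_tsupport fun h => hx (hφ.subset h)

lemma integrable (hφ : IsTest U φ) : Integrable φ :=
  hφ.contDiff.continuous.integrable_of_hasCompactSupport hφ.compact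

lemma memLp (hφ : IsTest U φ) : MemLp φ 2 :=
  hφ.contDiff.continuous.memLp_of_hasCompactSupport hφ.compact

lemma integral_pd_eq_zero (hφ : IsTest U φ) (i : Fin 2) : ∫ x, StokesLPS.pd i φ x = 0 := by
  have := integral_mul_fderiv_eq_neg_fderiv_mul_of_integrable (μ := (volume : Measure Plane))
    (f := fun _ => (1 : ℝ)) (g := φ) (v := EuclideanSpace.single i 1) (by simp)
    (by simp only [one_mul]; exact (hφ.pd i).integrable) (by simpa using hφ.integrable) (by simp)
    (fun x _ => hφ.contDiff.diffAt x)
  simpa [StokesLPS.pd] using this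

end IsTest

/-! ### The resolvent of the Laplacian -/

-- With c = (2π)⁻², the operator 1 - cΔ is the Fourier multiplier 1 + |ξ|², whose inverse has
-- temperate growth and so preserves Schwartz functions. Keeping the zeroth order term, rather than
-- inverting Δ, gives a solution that decays at infinity.
open SchwartzMap LineDeriv in
lemma exists_resolvent {f : Plane → ℝ} {U : Set Plane} (hf : IsTest U f) :
    ∃ g : SchwartzMap Plane ℝ, ∀ x,
      g x - ((2 * Real.pi) ^ 2)⁻¹ * ∑ i, pd i (pd i g) x = f x := by
  have hF : ContDiff ℝ ∞ (fun x => (f x : ℂ)) := Complex.ofRealCLM.contDiff.comp hf.contDiff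
  have hFc : HasCompactSupport (fun x => (f x : ℂ)) :=
    hf.compact.comp_left (g := fun t : ℝ => (t : ℂ)) (by simp)
  let F : SchwartzMap Plane ℂ := hFc.toSchwartzMap hF
  let m : Plane → ℝ := fun x => (1 + ‖x‖ ^ 2) ^ (-1 : ℝ)
  have hm : m.HasTemperateGrowth := Function.hasTemperateGrowth_one_add_norm_sq_rpow Plane (-1)
  have hn : (fun x : Plane => ‖x‖ ^ 2).HasTemperateGrowth :=
    Function.hasTemperateGrowth_norm_sq Plane
  let G : SchwartzMap Plane ℂ := fourierMultiplierCLM ℂ m F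
  have hG : G - ((2 * Real.pi) ^ 2)⁻¹ • Laplacian.laplacian G = F := by
    rw [laplacian_eq_fourierMultiplierCLM, smul_smul]
    have hpi : ((2 * Real.pi) ^ 2)⁻¹ * -(2 * Real.pi) ^ 2 = -1 := by
      field_simp
    rw [hpi, neg_one_smul, sub_neg_eq_add]
    have h1 : (fun x : Plane => ‖x‖ ^ 2 : Plane → ℝ) * m + m = fun _ => (1 : ℝ) := by
      ext x
      simp only [Pi.add_apply, Pi.mul_apply, m, Real.rpow_neg_one]
      have : (1 + ‖x‖ ^ 2) ≠ 0 := by positivity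
      field_simp
      ring
    have h2 : fourierMultiplierCLM ℂ (fun x : Plane => ‖x‖ ^ 2 : Plane → ℝ) G =
        fourierMultiplierCLM ℂ ((fun x : Plane => ‖x‖ ^ 2 : Plane → ℝ) * m) F :=
      fourierMultiplierCLM_fourierMultiplierCLM_apply hn hm F
    have h3 : fourierMultiplierCLM ℂ (fun _ : Plane => (1 : ℝ)) F = F := by simp
    have h4 : G + fourierMultiplierCLM ℂ (fun x : Plane => ‖x‖ ^ 2 : Plane → ℝ) G = F := by
      rw [h2]
      refine Eq.trans ?_ h3
      rw [← h1]
      simp only [G, fourierMultiplierCLM_apply]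
      rw [← FourierTransform.fourierInv_add]
      congr 1
      ext x
      rw [_root_.add_apply, smulLeftCLM_apply_apply hm, smulLeftCLM_apply_apply (hn.mul hm),
        smulLeftCLM_apply_apply ((hn.mul hm).add hm)]
      simp only [Pi.add_apply, add_smul]
      ring
    exact h4
  -- The operator has real coefficients and `f` is real, so the real part of the complex solution is
  -- again a solution.
  have hre : ∀ H : SchwartzMap Plane ℂ, ∀ i : Fin 2, ∀ x,
      pd i (fun y => (H y).re) x = ((∂_{EuclideanSpace.single i (1 : ℝ)} H) x).re := by
    intro H i x
    rw [lineDerivOp_apply_eq_fderiv]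
    have := (Complex.reCLM.hasFDerivAt.comp x (H.hasFDerivAt x)).fderiv
    simp only [pd]
    erw [this]
    rfl
  refine ⟨G.postcompCLM Complex.reCLM, fun x => ?_⟩
  have hg : (G.postcompCLM Complex.reCLM : Plane → ℝ) = fun y => (G y).re := by
    ext y; simp [postcompCLM_apply]
  have hpp : ∀ i, pd i (pd i (fun y => (G y).re)) x =
      ((∂_{EuclideanSpace.single i (1 : ℝ)} (∂_{EuclideanSpace.single i (1 : ℝ)} G)) x).re := by
    intro i
    rw [funext (hre G i), hre]
  rw [hg]
  simp only [hpp]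
  have := congrArg (fun H : SchwartzMap Plane ℂ => (H x).re) hG
  rw [laplacian_eq_sum (EuclideanSpace.basisFun (Fin 2) ℝ)] at this
  generalize ((2 * Real.pi) ^ 2)⁻¹ = c at this
  simpa [F, mul_add] using this

-- Integration by parts gives ∫ g ∂ᵢᵢg = -∫ (∂ᵢg)² and ∫ ∂₀₀g ∂₁₁g = ∫ (∂₀₁g)². For c > 0 every term
-- on the right is nonnegative, so the L² norm of the load controls the full H² norm of `g`.
open SchwartzMap LineDeriv in
lemma integral_resolvent_sq (g : SchwartzMap Plane ℝ) (c : ℝ) :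
    ∫ x, (g x - c * ∑ i, pd i (pd i g) x) ^ 2 = (∫ x, g x ^ 2) + 2 * c * (∑ i, ∫ x, pd i g x ^ 2)
      + c ^ 2 * ∑ i, ∑ j, ∫ x, pd i (pd j g) x ^ 2 := by
  let e : Fin 2 → Plane := fun i => EuclideanSpace.single i (1 : ℝ)
  have h1 : ∀ (k : SchwartzMap Plane ℝ) i, pd i k = (∂_{e i} k : SchwartzMap Plane ℝ) := by
    intro k i
    ext x
    rw [lineDerivOp_apply_eq_fderiv]
    rfl
  have hint : ∀ k l : SchwartzMap Plane ℝ, Integrable (fun x => k x * l x) := fun k l =>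
    (k.memLp 2).integrable_mul (l.memLp 2)
  have hsym : ∀ (k : SchwartzMap Plane ℝ) i j, ∂_{e i} (∂_{e j} k) = ∂_{e j} (∂_{e i} k) := by
    intro k i j
    ext x
    have := pd_pd_comm (k.smooth ⊤) i j x
    rwa [h1 k, h1 k, h1, h1] at this
  have hg : ∀ i, ∫ x, g x * (∂_{e i} (∂_{e i} g)) x = - ∫ x, (∂_{e i} g) x ^ 2 := by
    intro i
    rw [integral_mul_lineDerivOp_right_eq_neg_left]
    simp only [pow_two]
  have hx : ∫ x, (∂_{e 0} (∂_{e 0} g)) x * (∂_{e 1} (∂_{e 1} g)) x =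
      ∫ x, (∂_{e 0} (∂_{e 1} g)) x ^ 2 := by
    rw [integral_mul_lineDerivOp_right_eq_neg_left, hsym, hsym g 1 0]
    have := integral_mul_lineDerivOp_right_eq_neg_left (μ := volume) (∂_{e 1} g)
      (∂_{e 0} (∂_{e 1} g)) (e 0)
    simp only [mul_comm ((∂_{e 1} g) _)] at this
    rw [this, neg_neg]
    simp only [pow_two]
  have hexp : ∀ x, (g x - c * ∑ i, pd i (pd i g) x) ^ 2 =
      g x * g x - 2 * c * (g x * (∂_{e 0} (∂_{e 0} g)) x) - 2 * c * (g x * (∂_{e 1} (∂_{e 1} g)) x)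
      + c ^ 2 * ((∂_{e 0} (∂_{e 0} g)) x * (∂_{e 0} (∂_{e 0} g)) x)
      + c ^ 2 * ((∂_{e 1} (∂_{e 1} g)) x * (∂_{e 1} (∂_{e 1} g)) x)
      + 2 * c ^ 2 * ((∂_{e 0} (∂_{e 0} g)) x * (∂_{e 1} (∂_{e 1} g)) x) := by
    intro x
    simp only [Fin.sum_univ_two, h1]
    ring
  simp only [hexp]
  rw [integral_add, integral_add, integral_add, integral_sub, integral_sub]
  · simp only [integral_const_mul, hg, hx, Fin.sum_univ_two, h1, hsym g 1 0]
    simp only [pow_two]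
    ring
  all_goals
    first
    | exact (hint _ _).const_mul _
    | exact hint _ _
    | skip
  · exact (hint _ _).sub ((hint _ _).const_mul _)
  · exact ((hint _ _).sub ((hint _ _).const_mul _)).sub ((hint _ _).const_mul _)
  · exact (((hint _ _).sub ((hint _ _).const_mul _)).sub ((hint _ _).const_mul _)).add
      ((hint _ _).const_mul _)
  · exact ((((hint _ _).sub ((hint _ _).const_mul _)).sub ((hint _ _).const_mul _)).add
      ((hint _ _).const_mul _)).add ((hint _ _).const_mul _)

/-! ### Integrals along coordinate lines -/

/-- The `i`-th standard basis vector of the plane. -/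
abbrev unit (i : Fin 2) : Plane := EuclideanSpace.single i (1 : ℝ)

/-- `z ↦ ∫_S k (z - s eᵢ) ds`. -/
def lineInt (i : Fin 2) (S : Set ℝ) (k : Plane → ℝ) (z : Plane) : ℝ :=
  ∫ s in S, k (z - s • unit i)

/-- The image of the Lebesgue measure on `S` under `s ↦ s eᵢ`. -/
def lineMeasure (i : Fin 2) (S : Set ℝ) : Measure Plane :=
  (volume.restrict S).map (fun s : ℝ => s • unit i)

lemma norm_smul_unit (i : Fin 2) (s : ℝ) : ‖s • unit i‖ = |s| := by
  simp [norm_smul]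

/-- Constants thereby become locally integrable for this measure, as the convolution argument in
`contDiff_lineInt` requires. -/
instance (i : Fin 2) (S : Set ℝ) : IsFiniteMeasureOnCompacts (lineMeasure i S) where
  lt_top_of_isCompact := by
    intro K hK
    obtain ⟨R, hR⟩ := hK.isBounded.subset_closedBall (0 : Plane)
    have hm : Measurable (fun s : ℝ => s • unit i) := by fun_prop
    refine (measure_mono hR).trans_lt ?_
    rw [lineMeasure, Measure.map_apply hm measurableSet_closedBall]
    refine (Measure.restrict_apply_le _ _).trans_lt ?_
    refine (measure_mono (t := Set.Icc (-R) R) fun s hs => ?_).trans_lt measure_Icc_lt_top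
    simpa [norm_smul, abs_le] using hs

/-- In this form the smoothness of `k` passes to its line integrals. -/
lemma lineInt_eq_convolution (i : Fin 2) (S : Set ℝ) {k : Plane → ℝ} (hk : Continuous k) :
    lineInt i S k =
      convolution (fun _ => (1 : ℝ)) k (ContinuousLinearMap.lsmul ℝ ℝ) (lineMeasure i S) := by
  ext z
  rw [convolution, lineMeasure, integral_map (by fun_prop) (by fun_prop)]
  simp [lineInt]

lemma contDiff_lineInt (i : Fin 2) (S : Set ℝ) {k : Plane → ℝ} {U : Set Plane}
    (hk : IsTest U k) : ContDiff ℝ ∞ (lineInt i S k) := by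
  rw [lineInt_eq_convolution i S hk.contDiff.continuous]
  exact hk.compact.contDiff_convolution_right (n := ⊤) _ (locallyIntegrable_const _) hk.contDiff

lemma line_compact (i : Fin 2) {k : Plane → ℝ} {U : Set Plane} (hk : IsTest U k) (z : Plane) :
    HasCompactSupport (fun s : ℝ => k (z - s • unit i)) := by
  obtain ⟨R, hR⟩ := hk.compact.isCompact.isBounded.subset_closedBall z
  refine HasCompactSupport.of_support_subset_isCompact (isCompact_Icc (a := -R) (b := R)) ?_
  intro s hs
  have := hR (subset_closure (show (z - s • unit i) ∈ Function.support k from hs))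
  simpa [norm_smul, abs_le, dist_eq_norm] using this

lemma integrable_line (i : Fin 2) {k : Plane → ℝ} {U : Set Plane} (hk : IsTest U k) (z : Plane) :
    Integrable (fun s : ℝ => k (z - s • unit i)) :=
  Continuous.integrable_of_hasCompactSupport (hk.contDiff.continuous.comp (by fun_prop))
    (line_compact i hk z)

lemma pd_lineInt (i j : Fin 2) (S : Set ℝ) {k : Plane → ℝ} {U : Set Plane}
    (hk : IsTest U k) : pd j (lineInt i S k) = lineInt i S (pd j k) := by
  ext z
  obtain ⟨C, hC⟩ : ∃ C, ∀ x, ‖fderiv ℝ k x‖ ≤ C :=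
    (hk.contDiff.continuous_fderiv (by simp)).bounded_above_of_compact_support
      (hk.compact.fderiv ℝ)
  obtain ⟨R, hR⟩ := hk.compact.isCompact.isBounded.subset_closedBall z
  have hfd : Continuous (fderiv ℝ k) := hk.contDiff.continuous_fderiv (by simp)
  have key : HasFDerivAt (fun x => ∫ s in S, k (x - s • unit i))
      (∫ s in S, fderiv ℝ k (z - s • unit i)) z := by
    -- For `x` within distance 1 of `z` the integrand vanishes once |s| > R + 1, because the support
    -- of `k` lies within distance `R` of `z`.
    refine hasFDerivAt_integral_of_dominated_of_fderiv_le (𝕜 := ℝ) (s := Metric.ball z 1)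
      (F' := fun x s => fderiv ℝ k (x - s • unit i))
      (bound := (Set.Icc (-(R + 1)) (R + 1)).indicator fun _ => C) (Metric.ball_mem_nhds z one_pos)
      ?_ ?_ ?_ ?_ ?_ ?_
    · exact Eventually.of_forall fun x =>
        (hk.contDiff.continuous.comp (by fun_prop)).aestronglyMeasurable
    · exact (integrable_line i hk z).restrict
    · exact (hfd.comp (by fun_prop)).aestronglyMeasurable
    · refine Eventually.of_forall fun s x hx => ?_
      by_cases hs : s ∈ Set.Icc (-(R + 1)) (R + 1)
      · rw [Set.indicator_of_mem hs]
        exact hC _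
      · rw [Set.indicator_of_notMem hs, fderiv_of_notMem_tsupport ℝ, norm_zero]
        intro hmem
        have h1 := hR hmem
        rw [Metric.mem_closedBall, dist_eq_norm] at h1
        rw [Metric.mem_ball, dist_eq_norm] at hx
        apply hs
        rw [Set.mem_Icc, ← abs_le, ← norm_smul_unit i s]
        calc ‖s • unit i‖ = ‖(x - z) - (x - s • unit i - z)‖ := by congr 1; abel
          _ ≤ ‖x - z‖ + ‖x - s • unit i - z‖ := norm_sub_le _ _
          _ ≤ R + 1 := by linarith
    · exact (integrable_indicator_iff measurableSet_Icc).2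
        (integrableOn_const (by rw [Measure.restrict_apply measurableSet_Icc]
                                exact ((measure_mono Set.inter_subset_left).trans_lt
                                  measure_Icc_lt_top).ne))
    · refine Eventually.of_forall fun s x _ => ?_
      have := (hk.contDiff.diffAt (x - s • unit i)).hasFDerivAt.comp x
        ((hasFDerivAt_id x).sub_const (s • unit i))
      simpa [Function.comp_def] using this
  have h2 := key.fderiv
  change fderiv ℝ (fun x => ∫ s in S, k (x - s • unit i)) z (unit j) = _
  rw [h2, ContinuousLinearMap.integral_apply]
  · rfl
  · refine Integrable.restrict ?_
    refine Continuous.integrable_of_hasCompactSupport (hfd.comp (by fun_prop)) ?_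
    refine HasCompactSupport.of_support_subset_isCompact (isCompact_Icc (a := -R) (b := R)) ?_
    intro s hs
    have := hR ((tsupport_fderiv_subset ℝ) (subset_closure
      (show (z - s • unit i) ∈ Function.support (fderiv ℝ k) from hs)))
    simpa [norm_smul, abs_le, dist_eq_norm] using this

lemma hasDerivAt_line (i : Fin 2) {k : Plane → ℝ} (hk : ContDiff ℝ ∞ k) (z : Plane) (s : ℝ) :
    HasDerivAt (fun s : ℝ => k (z - s • unit i)) (-pd i k (z - s • unit i)) s := by
  have h1 : HasDerivAt (fun s : ℝ => z - s • unit i) (-unit i) s := by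
    simpa using ((hasDerivAt_id s).smul_const (unit i)).const_sub z
  have := (hk.diffAt (z - s • unit i)).hasFDerivAt.comp_hasDerivAt s h1
  simpa [pd, Function.comp_def] using this

/-- Fundamental theorem of calculus along the ray running from `z` in the direction -eᵢ. Thus
`lineInt i (Set.Ioi 0)` is the primitive in direction eᵢ that vanishes far out on the negative side.
-/
lemma lineInt_Ioi_pd (i : Fin 2) {k : Plane → ℝ} {U : Set Plane} (hk : IsTest U k) (z : Plane) :
    lineInt i (Set.Ioi 0) (pd i k) z = k z := by
  have hc : ContDiff ℝ 1 (fun s : ℝ => k (z - s • unit i)) :=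
    (hk.contDiff.of_le (by simp)).comp (by fun_prop)
  have := (line_compact i hk z).integral_Ioi_deriv_eq hc 0
  simp only [fun s => (hasDerivAt_line i hk.contDiff z s).deriv, integral_neg, zero_smul,
    sub_zero, neg_inj] at this
  exact this

lemma lineInt_univ_shift (i : Fin 2) (k : Plane → ℝ) (z : Plane) (t : ℝ) :
    lineInt i Set.univ k (z - t • unit i) = lineInt i Set.univ k z := by
  simp only [lineInt, Measure.restrict_univ, sub_sub, ← add_smul]
  exact integral_add_left_eq_self (fun s => k (z - s • unit i)) t

lemma pd_lineInt_univ_self (i : Fin 2) {k : Plane → ℝ} {U : Set Plane}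
    (hk : IsTest U k) (z : Plane) : pd i (lineInt i Set.univ k) z = 0 := by
  have h := hasDerivAt_line i (contDiff_lineInt i Set.univ hk) z 0
  simp only [lineInt_univ_shift, zero_smul, sub_zero] at h
  have := h.unique (hasDerivAt_const 0 _)
  linarith

/-! ### Line integrals of functions supported in a square -/

/-- The square `[-2, 2]²`. -/
def box : Set Plane := {z | ∀ i, |z i| ≤ 2}

lemma isCompact_box : IsCompact box := by
  refine Metric.isCompact_of_isClosed_isBounded ?_ ?_
  · simp only [box, Set.ofPred_forall]
    exact isClosed_iInter fun i => isClosed_le (by fun_prop) continuous_const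
  · refine (Metric.isBounded_closedBall (x := (0 : Plane)) (r := 3)).subset fun z hz => ?_
    rw [mem_closedBall_zero_iff, EuclideanSpace.norm_eq, Real.sqrt_le_left (by norm_num)]
    simp only [Fin.sum_univ_two, Real.norm_eq_abs]
    have h0 := hz 0
    have h1 := hz 1
    nlinarith [abs_nonneg (z 0), abs_nonneg (z 1)]

lemma box_subset_ball : box ⊆ Metric.ball 0 4 := by
  intro z hz
  rw [mem_ball_zero_iff, EuclideanSpace.norm_eq, Real.sqrt_lt' (by norm_num)]
  simp only [Fin.sum_univ_two, Real.norm_eq_abs]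
  have h0 := hz 0
  have h1 := hz 1
  nlinarith [abs_nonneg (z 0), abs_nonneg (z 1)]

lemma ball_subset_box : Metric.ball (0 : Plane) 2 ⊆ box := fun z hz i =>
  (PiLp.norm_apply_le z i).trans (mem_ball_zero_iff.1 hz).le

lemma isTest_box {φ : Plane → ℝ} (h : ContDiff ℝ ∞ φ) (h0 : ∀ z i, 2 < |z i| → φ z = 0) :
    IsTest box φ :=
  IsTest.of_eq_zero h isCompact_box (fun x hx => by
    simp only [box, Set.mem_ofPred_eq, not_forall, not_le] at hx
    obtain ⟨i, hi⟩ := hx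
    exact h0 x i hi) le_rfl

lemma IsTest.box_eq_zero {φ : Plane → ℝ} (h : IsTest box φ) {z : Plane} {i : Fin 2}
    (hz : 2 < |z i|) : φ z = 0 :=
  h.eq_zero fun hb => absurd (hb i) (not_le.2 hz)

lemma sub_smul_unit_self (i : Fin 2) (z : Plane) (s : ℝ) : (z - s • unit i) i = z i - s := by
  simp

lemma sub_smul_unit_ne {i j : Fin 2} (h : j ≠ i) (z : Plane) (s : ℝ) :
    (z - s • unit i) j = z j := by
  simp [h]

/-- From |z i| ≤ 2 and |z i - s| ≤ 2 follows |s| ≤ 4, so only these `s` meet the square. -/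
lemma abs_lineInt_le {i : Fin 2} {S : Set ℝ} {k : Plane → ℝ} (hk : IsTest box k)
    {z : Plane} (hz : |z i| ≤ 2) :
    |lineInt i S k z| ≤ ∫ s in Set.Icc (-4 : ℝ) 4, |k (z - s • unit i)| := by
  have hint := (integrable_line i hk z).abs
  calc |lineInt i S k z| ≤ ∫ s in S, |k (z - s • unit i)| := abs_integral_le_integral_abs
    _ ≤ ∫ s, |k (z - s • unit i)| :=
        setIntegral_le_integral hint (Eventually.of_forall fun _ => abs_nonneg _)
    _ = ∫ s in Set.Icc (-4 : ℝ) 4, |k (z - s • unit i)| := by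
        refine (setIntegral_eq_integral_of_forall_compl_eq_zero fun s hs => ?_).symm
        rw [hk.box_eq_zero (i := i), abs_zero]
        rw [sub_smul_unit_self]
        by_contra! hcon
        apply hs
        rw [abs_le] at hcon hz
        constructor <;> linarith [hcon.1, hcon.2, hz.1, hz.2]

/-- Cauchy–Schwarz on an interval of length 8, then Fubini and translation invariance, which give a
second factor 8. This is the L² boundedness of all the line integral operators used below. -/
lemma integral_sq_le_of_lineInt {i : Fin 2} {S : Set ℝ} {k F : Plane → ℝ} {C : ℝ}
    (hk : IsTest box k) (hF0 : ∀ z, 2 < |z i| → F z = 0)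
    (hFk : ∀ z, |F z| ≤ C * |lineInt i S k z|) (hC : 0 ≤ C) :
    ∫ z, F z ^ 2 ≤ 64 * C ^ 2 * ∫ z, k z ^ 2 := by
  have hkc := hk.contDiff.continuous
  have hk2 : Integrable (fun z => k z ^ 2) := hk.memLp.integrable_sq
  have hptw : ∀ z, F z ^ 2 ≤ C ^ 2 * 8 * ∫ s in Set.Icc (-4 : ℝ) 4, k (z - s • unit i) ^ 2 := by
    intro z
    by_cases hz : 2 < |z i|
    · rw [hF0 z hz]
      have : 0 ≤ ∫ s in Set.Icc (-4 : ℝ) 4, k (z - s • unit i) ^ 2 :=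
        integral_nonneg fun _ => sq_nonneg _
      nlinarith [mul_nonneg (sq_nonneg C) this]
    · push Not at hz
      have h1 := abs_lineInt_le (S := S) hk hz
      set I := ∫ s in Set.Icc (-4 : ℝ) 4, |k (z - s • unit i)|
      set J := ∫ s in Set.Icc (-4 : ℝ) 4, k (z - s • unit i) ^ 2
      have hI : I ^ 2 ≤ 8 * J := by
        have hi1 : IntegrableOn (fun s : ℝ => |k (z - s • unit i)|) (Set.Icc (-4) 4) :=
          (integrable_line i hk z).abs.integrableOn
        have hi2 : IntegrableOn (fun s : ℝ => k (z - s • unit i) ^ 2) (Set.Icc (-4) 4) := by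
          have : Continuous (fun s : ℝ => k (z - s • unit i) ^ 2) := by
            exact (hkc.comp (by fun_prop)).pow 2
          exact this.continuousOn.integrableOn_Icc
        -- Cauchy–Schwarz, obtained by expanding the variance about the mean I / 8.
        have h2 : 0 ≤ ∫ s in Set.Icc (-4 : ℝ) 4, (|k (z - s • unit i)| - I / 8) ^ 2 :=
          integral_nonneg fun _ => sq_nonneg _
        have h3 : ∫ s in Set.Icc (-4 : ℝ) 4, (|k (z - s • unit i)| - I / 8) ^ 2 =
            J - I / 4 * I + (I / 8) ^ 2 * 8 := by
          have : ∀ s : ℝ, (|k (z - s • unit i)| - I / 8) ^ 2 =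
              k (z - s • unit i) ^ 2 - I / 4 * |k (z - s • unit i)| + (I / 8) ^ 2 := by
            intro s; rw [← sq_abs (k _)]; ring
          simp only [this]
          have hi3 : IntegrableOn (fun s : ℝ => k (z - s • unit i) ^ 2 -
              I / 4 * |k (z - s • unit i)|) (Set.Icc (-4) 4) := hi2.sub (hi1.const_mul _)
          rw [integral_add hi3 (integrableOn_const (by simp)),
            integral_sub hi2 (hi1.const_mul _), integral_const_mul]
          simp [J, I, measureReal_def]
          norm_num
          ring
        rw [h3] at h2
        nlinarith
      have h4 : |F z| ≤ C * I := (hFk z).trans (by gcongr)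
      calc F z ^ 2 = |F z| ^ 2 := (sq_abs _).symm
        _ ≤ (C * I) ^ 2 := by gcongr
        _ = C ^ 2 * I ^ 2 := by ring
        _ ≤ C ^ 2 * (8 * J) := by gcongr
        _ = _ := by ring
  have hshift : ∀ s : ℝ, ∫ z, k (z - s • unit i) ^ 2 = ∫ z, k z ^ 2 := fun s =>
    integral_sub_right_eq_self (fun z => k z ^ 2) (s • unit i)
  have hprod : Integrable (fun q : ℝ × Plane => k (q.2 - q.1 • unit i) ^ 2)
      ((volume.restrict (Set.Icc (-4 : ℝ) 4)).prod volume) := by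
    rw [integrable_prod_iff]
    · refine ⟨Eventually.of_forall fun s => hk2.comp_sub_right (s • unit i), ?_⟩
      simp only [norm_pow, Real.norm_eq_abs, sq_abs, hshift]
      exact integrableOn_const (by simp)
    · exact ((hkc.comp (by fun_prop)).pow 2).aestronglyMeasurable
  calc ∫ z, F z ^ 2
      ≤ ∫ z, C ^ 2 * 8 * ∫ s in Set.Icc (-4 : ℝ) 4, k (z - s • unit i) ^ 2 := by
        refine integral_mono_of_nonneg (Eventually.of_forall fun _ => sq_nonneg _) ?_
          (Eventually.of_forall hptw)
        exact hprod.integral_prod_right.const_mul _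
    _ = C ^ 2 * 8 * ∫ s in Set.Icc (-4 : ℝ) 4, ∫ z, k (z - s • unit i) ^ 2 := by
        rw [integral_const_mul, integral_integral_swap]
        exact hprod.swap
    _ = 64 * C ^ 2 * ∫ z, k z ^ 2 := by
        simp only [hshift]
        simp [measureReal_def]
        norm_num
        ring

/-- Beyond the positive side of the square the ray sees the whole line, whose integral is zero;
beyond the negative side it misses the square. -/
lemma lineInt_Ioi_eq_zero {i : Fin 2} {k : Plane → ℝ} (hk : IsTest box k) {z : Plane}
    (h0 : lineInt i Set.univ k z = 0) (hz : 2 < |z i|) : lineInt i (Set.Ioi 0) k z = 0 := by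
  rcases lt_abs.1 hz with h | h
  · refine Eq.trans ?_ h0
    rw [lineInt, lineInt, setIntegral_univ]
    refine setIntegral_eq_integral_of_forall_compl_eq_zero fun s hs => ?_
    refine hk.box_eq_zero (i := i) ?_
    rw [sub_smul_unit_self, lt_abs]
    left
    simp at hs
    linarith
  · rw [lineInt]
    refine setIntegral_eq_zero_of_forall_eq_zero fun s hs => ?_
    refine hk.box_eq_zero (i := i) ?_
    rw [sub_smul_unit_self, lt_abs]
    right
    simp at hs
    linarith

lemma lineInt_eq_zero_of_ne {i j : Fin 2} (hij : j ≠ i) {S : Set ℝ} {k : Plane → ℝ}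
    (hk : IsTest box k) {z : Plane} (hz : 2 < |z j|) : lineInt i S k z = 0 := by
  rw [lineInt]
  refine integral_eq_zero_of_ae (Eventually.of_forall fun s => ?_)
  refine hk.box_eq_zero (i := j) ?_
  rwa [sub_smul_unit_ne hij]

/-- A primitive in direction `eᵢ` of a function with vanishing integrals along the lines in this
direction. -/
lemma isTest_lineInt_Ioi {i : Fin 2} {k : Plane → ℝ} (hk : IsTest box k)
    (h0 : ∀ z, lineInt i Set.univ k z = 0) : IsTest box (lineInt i (Set.Ioi 0) k) := by
  refine isTest_box (contDiff_lineInt i _ hk) fun z j hz => ?_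
  by_cases hij : j = i
  · subst hij
    exact lineInt_Ioi_eq_zero hk (h0 z) hz
  · exact lineInt_eq_zero_of_ne hij hk hz

/-- The coordinates identify the plane with `ℝ × ℝ`, with its Lebesgue measure. -/
lemma measurePreserving_coords :
    MeasurePreserving (fun z : Plane => (z 0, z 1)) volume volume := by
  have h1 := PiLp.volume_preserving_ofLp (Fin 2)
  have h2 := volume_preserving_finTwoArrow ℝ
  exact h2.comp h1

/-- Fubini in the coordinates, after the reflection x ↦ z - x. -/
lemma lineInt_lineInt_univ {k : Plane → ℝ} (hk : IsTest box k) (z : Plane) :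
    lineInt 1 Set.univ (lineInt 0 Set.univ k) z = ∫ x, k x := by
  rw [← integral_sub_left_eq_self k volume z]
  have hemb : MeasurableEmbedding (fun z : Plane => (z 0, z 1)) :=
    (MeasurableEquiv.finTwoArrow.measurableEmbedding).comp
      (MeasurableEquiv.toLp 2 (Fin 2 → ℝ)).symm.measurableEmbedding
  have h1 : ∀ x : Plane, k (z - x) =
      (fun q : ℝ × ℝ => k (z - q.2 • unit 1 - q.1 • unit 0)) (x 0, x 1) := by
    intro x
    simp only
    congr 1
    ext i
    fin_cases i <;> simp
  simp only [h1]
  rw [measurePreserving_coords.integral_comp hemb (fun q : ℝ × ℝ => k (z - q.2 • unit 1 - q.1 • unit 0))]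
  have hint : Integrable (fun q : ℝ × ℝ => k (z - q.2 • unit 1 - q.1 • unit 0)) volume := by
    rw [← measurePreserving_coords.integrable_comp_emb hemb]
    have : ((fun q : ℝ × ℝ => k (z - q.2 • unit 1 - q.1 • unit 0)) ∘ fun z : Plane => (z 0, z 1)) =
        fun x => k (z - x) := by
      ext x
      exact (h1 x).symm
    rw [this]
    exact hk.integrable.comp_sub_left z
  rw [Measure.volume_eq_prod, integral_prod_symm _ hint]
  simp [lineInt]

/-! ### Solving the divergence equation in a square and in the unit ball -/

/-- `∫ |∇w|²` for a smooth vector field `w` on the plane. -/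
def energy (w : Fin 2 → Plane → ℝ) : ℝ := ∑ i, ∑ j, ∫ x, pd j (w i) x ^ 2

lemma integral_sub_sq_le {f g : Plane → ℝ} (hf : MemLp f 2) (hg : MemLp g 2) :
    ∫ x, (f x - g x) ^ 2 ≤ 2 * (∫ x, f x ^ 2) + 2 * ∫ x, g x ^ 2 := by
  rw [← integral_const_mul, ← integral_const_mul, ← integral_add (hf.integrable_sq.const_mul 2)
    (hg.integrable_sq.const_mul 2)]
  refine integral_mono (hf.sub hg).integrable_sq
    ((hf.integrable_sq.const_mul 2).add (hg.integrable_sq.const_mul 2)) fun x => ?_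
  nlinarith [sq_nonneg (f x + g x)]

/-- A normalized bump of the first coordinate alone. It serves to replace a function by one with the
same integral on every horizontal line but a prescribed profile. -/
lemma exists_line_bump : ∃ (r : Plane → ℝ) (C : ℝ), 0 ≤ C ∧ ContDiff ℝ ∞ r ∧
    (∀ z, 2 < |z 0| → r z = 0) ∧ (∀ z, |r z| ≤ C) ∧ (∀ z, |pd 0 r z| ≤ C) ∧
    (∀ z, pd 1 r z = 0) ∧ (∀ z (s : ℝ), r (z - s • unit 1) = r z) ∧
    ∀ z, ∫ s : ℝ, r (z - s • unit 0) = 1 := by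
  let b : ContDiffBump (0 : ℝ) := ⟨1 / 2, 1, by norm_num, by norm_num⟩
  let ρ : ℝ → ℝ := b.normed volume
  have hρ : ContDiff ℝ ∞ ρ := b.contDiff_normed
  have hρc : HasCompactSupport ρ := b.hasCompactSupport_normed
  obtain ⟨C₁, hC₁⟩ := hρ.continuous.bounded_above_of_compact_support hρc
  obtain ⟨C₂, hC₂⟩ := (hρ.continuous_deriv (by simp)).bounded_above_of_compact_support hρc.deriv
  have hcoord : ContDiff ℝ ∞ (fun z : Plane => z 0) := by fun_prop
  have hd : ∀ i (z : Plane), pd i (fun z : Plane => ρ (z 0)) z =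
      deriv ρ (z 0) * (unit i : Plane) 0 := by
    intro i z
    have h1 : HasFDerivAt (fun z : Plane => z 0) (EuclideanSpace.proj (0 : Fin 2) : Plane →L[ℝ] ℝ) z :=
      (EuclideanSpace.proj (0 : Fin 2) : Plane →L[ℝ] ℝ).hasFDerivAt
    have h2 : HasDerivAt ρ (deriv ρ (z 0)) (z 0) :=
      (hρ.differentiable (by simp) (z 0)).hasDerivAt
    have := (h2.hasFDerivAt.comp z h1).fderiv
    simp only [Function.comp_def] at this
    rw [pd, this]
    simp [mul_comm]
  refine ⟨fun z => ρ (z 0), max C₁ C₂, ?_, hρ.comp hcoord, ?_, ?_, ?_, ?_, ?_, ?_⟩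
  · exact (norm_nonneg _).trans ((hC₁ 0).trans (le_max_left _ _))
  · intro z hz
    have : z 0 ∉ Function.support ρ := by
      rw [b.support_normed_eq]
      simp only [Metric.mem_ball, dist_zero_right, Real.norm_eq_abs, not_lt, b]
      linarith
    simpa using this
  · exact fun z => (hC₁ _).trans (le_max_left _ _)
  · intro z
    rw [hd]
    simpa using Or.inr (hC₂ (z 0))
  · intro z
    rw [hd]
    simp
  · intro z s
    simp
  · intro z
    simp only [sub_smul_unit_self]
    rw [integral_sub_left_eq_self ρ volume (z 0)]
    exact b.integral_normed

/-- A function of mean value zero, supported in the square, is the divergence of a field supported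
in the square. -/
lemma exists_div_eq_of_box : ∃ C : ℝ, 0 ≤ C ∧ ∀ h : Plane → ℝ, IsTest box h → ∫ x, h x = 0 →
    ∃ W : Fin 2 → Plane → ℝ, (∀ i, IsTest box (W i)) ∧ (∀ x, ∑ i, pd i (W i) x = h x) ∧
      energy W ≤ C * ((∫ x, h x ^ 2) + ∫ x, pd 1 h x ^ 2) := by
  obtain ⟨r, C, hC, hr, hr0, hrC, hrC', hr1, hrs, hri⟩ := exists_line_bump
  -- The summands bound the L² norms of ∂₀W₀, ∂₁W₀, ∂₀W₁ and ∂₁W₁, in this order.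
  refine ⟨(2 + 128 * C ^ 2 + 64 * (2 + 128 * C ^ 2) + 64 * (64 * C ^ 2) + 64 * C ^ 2), by positivity,
    fun h hh hmean => ?_⟩
  -- Split h = k + K with K = rH. The part `k` has integral zero on horizontal lines, because `K`
  -- has the same integrals there as `h`; `K` has integral zero on vertical lines, because ∫ h = 0.
  -- Hence the primitives of `k` along e₀ and of `K` along e₁ are again supported in the square, and
  -- they are the components of the field.
  let H := lineInt 0 Set.univ h
  have hH : ContDiff ℝ ∞ H := contDiff_lineInt 0 _ hh
  let K : Plane → ℝ := fun z => r z * H z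
  have hK : IsTest box K := by
    refine isTest_box (hr.mul hH) fun z i hz => ?_
    fin_cases i
    · simp [K, hr0 z hz]
    · simp only [K, H]
      rw [lineInt_eq_zero_of_ne (j := 1) (by decide) hh hz, mul_zero]
  let k : Plane → ℝ := fun z => h z - K z
  have hk : IsTest box k := hh.sub hK
  have hk0 : ∀ z, lineInt 0 Set.univ k z = 0 := by
    intro z
    have h1 : lineInt 0 Set.univ k z = H z - ∫ s : ℝ, K (z - s • unit 0) := by
      simp only [lineInt, k, H, setIntegral_univ]
      exact integral_sub (integrable_line 0 hh z) (integrable_line 0 hK z)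
    rw [h1]
    simp only [K, H, lineInt_univ_shift]
    rw [integral_mul_const, hri, one_mul, sub_self]
  have hK0 : ∀ z, lineInt 1 Set.univ K z = 0 := by
    intro z
    have := lineInt_lineInt_univ hh z
    simp only [lineInt, K, hrs, setIntegral_univ] at this ⊢
    rw [integral_const_mul]
    simp only [H, lineInt, setIntegral_univ]
    rw [this, hmean, mul_zero]
  have hW0 := isTest_lineInt_Ioi hk hk0
  have hW1 := isTest_lineInt_Ioi hK hK0
  have e00 : ∀ z, pd 0 (lineInt 0 (Set.Ioi 0) k) z = k z := fun z => by
    rw [pd_lineInt 0 0 _ hk, lineInt_Ioi_pd 0 hk]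
  have e11 : ∀ z, pd 1 (lineInt 1 (Set.Ioi 0) K) z = K z := fun z => by
    rw [pd_lineInt 1 1 _ hK, lineInt_Ioi_pd 1 hK]
  have n00 : ∫ z, K z ^ 2 ≤ 64 * C ^ 2 * ∫ z, h z ^ 2 :=
    integral_sq_le_of_lineInt (i := 0) (S := Set.univ) hh (fun z hz => hK.box_eq_zero hz)
      (fun z => by
        simp only [K, abs_mul]
        gcongr
        exact hrC z) hC
  -- The transversal derivative of the first primitive is where a derivative of `h` is lost. As ∂₁r
  -- = 0, only ∂₁h appears.
  have hpk : ∀ z, pd 1 k z = pd 1 h z - r z * lineInt 0 Set.univ (pd 1 h) z := by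
    intro z
    simp only [k, K]
    rw [pd_sub hh.contDiff hK.contDiff, pd_mul hr hH, hr1 z, pd_lineInt 0 1 _ hh]
    ring
  have hrL : IsTest box (fun z => r z * lineInt 0 Set.univ (pd 1 h) z) := by
    refine isTest_box (hr.mul (contDiff_lineInt 0 _ (hh.pd 1))) fun z i hz => ?_
    fin_cases i
    · simp [hr0 z hz]
    · rw [lineInt_eq_zero_of_ne (j := 1) (by decide) (hh.pd 1) hz, mul_zero]
  have n1 : ∫ z, (r z * lineInt 0 Set.univ (pd 1 h) z) ^ 2 ≤ 64 * C ^ 2 * ∫ z, pd 1 h z ^ 2 :=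
    integral_sq_le_of_lineInt (i := 0) (S := Set.univ) (hh.pd 1) (fun z hz => hrL.box_eq_zero hz)
      (fun z => by
        simp only [abs_mul]
        gcongr
        exact hrC z) hC
  have n2 : ∫ z, pd 1 k z ^ 2 ≤ (2 + 128 * C ^ 2) * ∫ z, pd 1 h z ^ 2 := by
    simp only [hpk]
    have := integral_sub_sq_le (hh.pd 1).memLp hrL.memLp
    linarith
  have n01 : ∫ z, pd 1 (lineInt 0 (Set.Ioi 0) k) z ^ 2 ≤ 64 * 1 ^ 2 * ∫ z, pd 1 k z ^ 2 :=
    integral_sq_le_of_lineInt (i := 0) (S := Set.Ioi 0) (hk.pd 1)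
      (fun z hz => (hW0.pd 1).box_eq_zero hz)
      (fun z => by rw [pd_lineInt 0 1 _ hk, one_mul]) zero_le_one
  -- `H` is constant in the direction e₀, so the derivative falls on `r` and costs none of `h`.
  have n3 : ∫ z, pd 0 K z ^ 2 ≤ 64 * C ^ 2 * ∫ z, h z ^ 2 :=
    integral_sq_le_of_lineInt (i := 0) (S := Set.univ) hh
      (fun z hz => (hK.pd 0).box_eq_zero hz)
      (fun z => by
        simp only [K]
        rw [pd_mul hr hH, pd_lineInt_univ_self 0 hh, mul_zero, zero_add, abs_mul]
        gcongr
        exact hrC' z) hC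
  have n10 : ∫ z, pd 0 (lineInt 1 (Set.Ioi 0) K) z ^ 2 ≤ 64 * 1 ^ 2 * ∫ z, pd 0 K z ^ 2 :=
    integral_sq_le_of_lineInt (i := 1) (S := Set.Ioi 0) (hK.pd 0)
      (fun z hz => (hW1.pd 0).box_eq_zero hz)
      (fun z => by rw [pd_lineInt 1 0 _ hK, one_mul]) zero_le_one
  have n4 : ∫ z, k z ^ 2 ≤ (2 + 128 * C ^ 2) * ∫ z, h z ^ 2 := by
    have := integral_sub_sq_le hh.memLp hK.memLp
    simp only [k]
    linarith
  refine ⟨![lineInt 0 (Set.Ioi 0) k, lineInt 1 (Set.Ioi 0) K], ?_, ?_, ?_⟩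
  · intro i
    fin_cases i
    · exact hW0
    · exact hW1
  · intro x
    simp only [Fin.sum_univ_two, Matrix.cons_val_zero, Matrix.cons_val_one, e00, e11, k]
    ring
  · simp only [energy, Fin.sum_univ_two, Matrix.cons_val_zero, Matrix.cons_val_one, e00, e11]
    have p1 : 0 ≤ ∫ z, h z ^ 2 := integral_nonneg fun _ => sq_nonneg _
    have p2 : 0 ≤ ∫ z, pd 1 h z ^ 2 := integral_nonneg fun _ => sq_nonneg _
    generalize ∫ z, h z ^ 2 = A at *
    generalize ∫ z, pd 1 h z ^ 2 = B at *
    have q1 : 0 ≤ C ^ 2 * A := by positivity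
    have q2 : 0 ≤ C ^ 2 * B := by positivity
    linarith

/-- The interior estimate on the unit scale. -/
lemma exists_div_eq_unit : ∃ C : ℝ, 0 ≤ C ∧ ∀ f : Plane → ℝ, IsTest (Metric.ball 0 1) f →
    ∫ x, f x = 0 → ∃ w : Fin 2 → Plane → ℝ, (∀ i, IsTest (Metric.ball 0 4) (w i)) ∧
      (∀ x, ∑ i, pd i (w i) x = f x) ∧ energy w ≤ C * ∫ x, f x ^ 2 := by
  obtain ⟨C, hC, hdiv⟩ := exists_div_eq_of_box
  let b : ContDiffBump (0 : Plane) := ⟨1, 3 / 2, by norm_num, by norm_num⟩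
  let χ : Plane → ℝ := b
  have hχ : IsTest (Metric.ball 0 2) χ :=
    ⟨b.contDiff, b.hasCompactSupport, by
      rw [b.tsupport_eq]; exact Metric.closedBall_subset_ball (by norm_num [b])⟩
  have hχ1 : ∀ x ∈ Metric.ball (0 : Plane) 1, χ x = 1 := fun x hx =>
    b.one_of_mem_closedBall (Metric.ball_subset_closedBall hx)
  obtain ⟨B, hB0, hB, hB1, hB2⟩ : ∃ B : ℝ, 0 ≤ B ∧ (∀ x, |χ x| ≤ B) ∧ (∀ i x, |pd i χ x| ≤ B) ∧
      ∀ i j x, |pd i (pd j χ) x| ≤ B := by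
    have bd : ∀ φ : Plane → ℝ, IsTest (Metric.ball 0 2) φ → ∃ B, ∀ x, |φ x| ≤ B := fun φ h =>
      h.contDiff.continuous.bounded_above_of_compact_support h.compact
    obtain ⟨B₀, h0⟩ := bd χ hχ
    choose B₁ h1 using fun i => bd _ (hχ.pd i)
    choose B₂ h2 using fun i j => bd _ ((hχ.pd j).pd i)
    have p0 : 0 ≤ B₀ := (abs_nonneg _).trans (h0 0)
    have p1 : ∀ i, 0 ≤ B₁ i := fun i => (abs_nonneg _).trans (h1 i 0)
    have p2 : ∀ i j, 0 ≤ B₂ i j := fun i j => (abs_nonneg _).trans (h2 i j 0)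
    have s1 : ∀ i, B₁ i ≤ ∑ i, B₁ i := fun i =>
      Finset.single_le_sum (fun i _ => p1 i) (Finset.mem_univ i)
    have s2 : ∀ i j, B₂ i j ≤ ∑ i, ∑ j, B₂ i j := fun i j =>
      (Finset.single_le_sum (fun j _ => p2 i j) (Finset.mem_univ j)).trans
        (Finset.single_le_sum (f := fun i => ∑ j, B₂ i j)
          (fun i _ => Finset.sum_nonneg fun j _ => p2 i j) (Finset.mem_univ i))
    have t1 : 0 ≤ ∑ i, B₁ i := Finset.sum_nonneg fun i _ => p1 i
    have t2 : 0 ≤ ∑ i, ∑ j, B₂ i j := Finset.sum_nonneg fun i _ => Finset.sum_nonneg fun j _ => p2 i j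
    refine ⟨B₀ + (∑ i, B₁ i) + ∑ i, ∑ j, B₂ i j, by positivity, fun x => ?_, fun i x => ?_,
      fun i j x => ?_⟩
    · linarith [h0 x]
    · linarith [h1 i x, s1 i]
    · linarith [h2 i j x, s2 i j]
  set c : ℝ := ((2 * Real.pi) ^ 2)⁻¹ with hc
  have hc0 : 0 < c := by positivity
  have hc1 : c ≤ 1 := by
    refine inv_le_one_of_one_le₀ ?_
    have := Real.pi_gt_three
    nlinarith
  refine ⟨2 * (4 * (2 * B) ^ 2) * (c ^ 2)⁻¹ + 2 * C * ((3 * B) ^ 2 + (6 * B) ^ 2) * (c ^ 2)⁻¹,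
    by positivity, fun f hf hmean => ?_⟩
  obtain ⟨g, hg⟩ := exists_resolvent hf
  rw [← hc] at hg
  have hgs : ContDiff ℝ ∞ g := g.smooth ⊤
  have hS : ∀ (k : SchwartzMap Plane ℝ) i, ∃ l : SchwartzMap Plane ℝ, pd i k = l := fun k i =>
    ⟨LineDeriv.lineDerivOp (unit i) k, by
      ext x; rw [SchwartzMap.lineDerivOp_apply_eq_fderiv]; rfl⟩
  have m0 : MemLp g 2 := g.memLp 2
  have m1 : ∀ i, MemLp (pd i g) 2 := fun i => by
    obtain ⟨l, hl⟩ := hS g i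
    rw [hl]; exact l.memLp 2
  have m2 : ∀ i j, MemLp (pd i (pd j g)) 2 := fun i j => by
    obtain ⟨l, hl⟩ := hS g j
    obtain ⟨l', hl'⟩ := hS l i
    rw [hl, hl']; exact l'.memLp 2
  -- The density of the squared H² norm of `g`; every later bound in this proof is pointwise against
  -- √E.
  let E : Plane → ℝ := fun x => g x ^ 2 + (∑ i, pd i g x ^ 2) + ∑ i, ∑ j, pd i (pd j g) x ^ 2
  have i1 : Integrable (fun x => ∑ i, pd i g x ^ 2) :=
    integrable_finsetSum _ fun i _ => (m1 i).integrable_sq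
  have i2 : Integrable (fun x => ∑ i, ∑ j, pd i (pd j g) x ^ 2) :=
    integrable_finsetSum _ fun i _ => integrable_finsetSum _ fun j _ => (m2 i j).integrable_sq
  have hEi : Integrable E := (m0.integrable_sq.add i1).add i2
  have hE : ∫ x, E x ≤ (c ^ 2)⁻¹ * ∫ x, f x ^ 2 := by
    have i0 : Integrable (fun x => g x ^ 2 + ∑ i, pd i g x ^ 2) := m0.integrable_sq.add i1
    have hf2 : ∫ x, f x ^ 2 = _ := (integral_congr_ae (Eventually.of_forall fun x => by
      simp only [← hg x])).trans (integral_resolvent_sq g c)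
    have hEe : ∫ x, E x = (∫ x, g x ^ 2) + (∑ i, ∫ x, pd i g x ^ 2)
        + ∑ i, ∑ j, ∫ x, pd i (pd j g) x ^ 2 := by
      simp only [E]
      rw [integral_add i0 i2, integral_add m0.integrable_sq i1,
        integral_finsetSum _ fun i _ => (m1 i).integrable_sq,
        integral_finsetSum _ fun i _ => integrable_finsetSum _ fun j _ => (m2 i j).integrable_sq]
      simp only [integral_finsetSum _ fun j _ => (m2 _ j).integrable_sq]
    rw [hf2, hEe, ← div_eq_inv_mul, le_div_iff₀ (by positivity)]
    have a0 : 0 ≤ ∫ x, g x ^ 2 := integral_nonneg fun _ => sq_nonneg _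
    have a1 : 0 ≤ ∑ i, ∫ x, pd i g x ^ 2 :=
      Finset.sum_nonneg fun i _ => integral_nonneg fun _ => sq_nonneg _
    generalize ∫ x, g x ^ 2 = A at *
    generalize ∑ i, ∫ x, pd i g x ^ 2 = A' at *
    generalize ∑ i, ∑ j, ∫ x, pd i (pd j g) x ^ 2 = A'' at *
    -- Since c ≤ 1, the smallest of the coefficients 1, 2c, c² in `integral_resolvent_sq` is c².
    have hcc : c ^ 2 ≤ 1 := by nlinarith
    have hcc' : c ^ 2 ≤ 2 * c := by nlinarith
    nlinarith [mul_le_mul_of_nonneg_left hcc a0, mul_le_mul_of_nonneg_left hcc' a1]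
  have hEg : ∀ x, |g x| ≤ √(E x) := fun x => Real.abs_le_sqrt (by
    simp only [E, Fin.sum_univ_two]; nlinarith [sq_nonneg (pd 0 g x), sq_nonneg (pd 1 g x),
      sq_nonneg (pd 0 (pd 0 g) x), sq_nonneg (pd 0 (pd 1 g) x), sq_nonneg (pd 1 (pd 0 g) x),
      sq_nonneg (pd 1 (pd 1 g) x)])
  have hEg1 : ∀ i x, |pd i g x| ≤ √(E x) := fun i x => Real.abs_le_sqrt (by
    have h1 := Finset.single_le_sum (f := fun i => pd i g x ^ 2) (fun i _ => sq_nonneg _)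
      (Finset.mem_univ i)
    have h2 : 0 ≤ ∑ i, ∑ j, pd i (pd j g) x ^ 2 :=
      Finset.sum_nonneg fun i _ => Finset.sum_nonneg fun j _ => sq_nonneg _
    simp only [E]; linarith [sq_nonneg (g x)])
  have hEg2 : ∀ i j x, |pd i (pd j g) x| ≤ √(E x) := fun i j x => Real.abs_le_sqrt (by
    have h1 := (Finset.single_le_sum (f := fun j => pd i (pd j g) x ^ 2) (fun i _ => sq_nonneg _)
      (Finset.mem_univ j)).trans (Finset.single_le_sum (f := fun i => ∑ j, pd i (pd j g) x ^ 2)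
        (fun i _ => Finset.sum_nonneg fun j _ => sq_nonneg _) (Finset.mem_univ i))
    have h2 : 0 ≤ ∑ i, pd i g x ^ 2 := Finset.sum_nonneg fun i _ => sq_nonneg _
    simp only [E]; linarith [sq_nonneg (g x)])
  have hE0 : ∀ x, 0 ≤ E x := fun x => by simp only [E]; positivity
  have hmul : ∀ (a d x : _) (y : Plane), |a| ≤ B → |d| ≤ √(E y) → x = a * d →
      |x| ≤ B * √(E y) := by
    rintro a d x y ha hd rfl
    rw [abs_mul]
    exact mul_le_mul ha hd (abs_nonneg _) hB0
  -- Here `n` counts products of a cut-off factor and a derivative of `g`: three in `h`, six in ∂₁h,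
  -- two in each ∂ⱼVᵢ.
  have hint : ∀ (F : Plane → ℝ) (n : ℝ), (∀ x, |F x| ≤ n * (B * √(E x))) →
      ∫ x, F x ^ 2 ≤ (n * B) ^ 2 * ∫ x, E x := by
    intro F n hF
    rw [← integral_const_mul]
    refine integral_mono_of_nonneg (Eventually.of_forall fun _ => sq_nonneg _)
      (hEi.const_mul _) (Eventually.of_forall fun x => ?_)
    calc F x ^ 2 = |F x| ^ 2 := (sq_abs _).symm
      _ ≤ (n * (B * √(E x))) ^ 2 := by gcongr; exact hF x
      _ = (n * B) ^ 2 * (√(E x)) ^ 2 := by ring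
      _ = _ := by rw [Real.sq_sqrt (hE0 x)]
  have hv : ∀ i, ContDiff ℝ ∞ (fun x => -c * pd i g x) := fun i =>
    contDiff_const.mul (contDiff_pd hgs i)
  -- The field V = -cχ∇g has divergence χ(f - g) - c∇χ·∇g = f - h, since χ = 1 on the support of
  -- `f`. The remainder `h` contains only first derivatives of `g`, so the H² bound pays for the
  -- derivative lost in `exists_div_eq_of_box`.
  let V : Fin 2 → Plane → ℝ := fun i x => χ x * (-c * pd i g x)
  have hV : ∀ i, IsTest (Metric.ball 0 2) (V i) := fun i => hχ.mul_right (hv i)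
  have hpV : ∀ i j x, pd j (V i) x = χ x * (-c * pd j (pd i g) x) + pd j χ x * (-c * pd i g x) := by
    intro i j x
    simp only [V]
    rw [pd_mul hχ.contDiff (hv i), pd_const_mul (contDiff_pd hgs i)]
  let h : Plane → ℝ := fun x => χ x * g x + c * ∑ i, pd i χ x * pd i g x
  have hχf : ∀ x, χ x * f x = f x := by
    intro x
    by_cases hx : x ∈ Metric.ball (0 : Plane) 1
    · rw [hχ1 x hx, one_mul]
    · rw [hf.eq_zero hx, mul_zero]
  have hdivV : ∀ x, ∑ i, pd i (V i) x = f x - h x := by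
    intro x
    have h1 := hg x
    have h2 := hχf x
    simp only [hpV, h, Fin.sum_univ_two] at h1 ⊢
    rw [← h2, ← h1]
    ring
  have hh : IsTest (Metric.ball 0 2) h := by
    refine (hχ.mul_right hgs).add ((IsTest.sum Finset.univ fun i _ => ?_).const_mul c)
    exact (hχ.pd i).mul_right (contDiff_pd hgs i)
  have hhm : ∫ x, h x = 0 := by
    have h1 : ∀ x, h x = f x - ∑ i, pd i (V i) x := fun x => by rw [hdivV]; ring
    simp only [h1]
    rw [integral_sub hf.integrable (integrable_finsetSum _ fun i _ => ((hV i).pd i).integrable),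
      hmean, integral_finsetSum _ fun i _ => ((hV i).pd i).integrable]
    simp [fun i => (hV i).integral_pd_eq_zero i]
  obtain ⟨W, hW, hWdiv, hWE⟩ := hdiv h (hh.mono ball_subset_box) hhm
  have hcB : ∀ a : ℝ, |a| ≤ B → |c * a| ≤ B := fun a ha => by
    rw [abs_mul, abs_of_pos hc0]
    nlinarith [abs_nonneg a]
  have hcB' : ∀ a : ℝ, |a| ≤ B → |-c * a| ≤ B := fun a ha => by
    rw [neg_mul, abs_neg]; exact hcB a ha
  have nh : ∫ x, h x ^ 2 ≤ (3 * B) ^ 2 * ∫ x, E x := by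
    refine hint h 3 fun x => ?_
    have e1 := hmul _ _ _ x (hB x) (hEg x) rfl
    have e2 := fun i => hmul _ _ _ x (hcB _ (hB1 i x)) (hEg1 i x) rfl
    have : h x = χ x * g x + c * pd 0 χ x * pd 0 g x + c * pd 1 χ x * pd 1 g x := by
      simp only [h, Fin.sum_univ_two]; ring
    rw [this]
    refine (abs_add_three _ _ _).trans ?_
    linarith [e2 0, e2 1]
  have nh1 : ∫ x, pd 1 h x ^ 2 ≤ (6 * B) ^ 2 * ∫ x, E x := by
    refine hint _ 6 fun x => ?_
    have hp : pd 1 h x = (χ x * pd 1 g x + pd 1 χ x * g x + c * pd 0 χ x * pd 1 (pd 0 g) x) +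
        (c * pd 1 (pd 0 χ) x * pd 0 g x + c * pd 1 χ x * pd 1 (pd 1 g) x
          + c * pd 1 (pd 1 χ) x * pd 1 g x) := by
      have hsm : ∀ i ∈ Finset.univ, ContDiff ℝ ∞ (fun x => pd i χ x * pd i g x) := fun i _ =>
        (hχ.pd i).contDiff.mul (contDiff_pd hgs i)
      simp only [h]
      rw [pd_add (hχ.contDiff.mul hgs) (contDiff_const.mul (ContDiff.sum hsm)),
        pd_mul hχ.contDiff hgs, pd_const_mul (ContDiff.sum hsm), pd_sum _ hsm]
      simp only [Fin.sum_univ_two, pd_mul (hχ.pd _).contDiff (contDiff_pd hgs _)]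
      ring
    have e1 := hmul _ _ _ x (hB x) (hEg1 1 x) rfl
    have e2 := hmul _ _ _ x (hB1 1 x) (hEg x) rfl
    have e3 := fun i => hmul _ _ _ x (hcB _ (hB1 i x)) (hEg2 1 i x) rfl
    have e4 := fun i => hmul _ _ _ x (hcB _ (hB2 1 i x)) (hEg1 i x) rfl
    rw [hp]
    refine (abs_add_le _ _).trans ?_
    have t1 := abs_add_three (χ x * pd 1 g x) (pd 1 χ x * g x) (c * pd 0 χ x * pd 1 (pd 0 g) x)
    have t2 := abs_add_three (c * pd 1 (pd 0 χ) x * pd 0 g x) (c * pd 1 χ x * pd 1 (pd 1 g) x)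
      (c * pd 1 (pd 1 χ) x * pd 1 g x)
    linarith [e3 0, e3 1, e4 0, e4 1]
  have nV : ∀ i j, ∫ x, pd j (V i) x ^ 2 ≤ (2 * B) ^ 2 * ∫ x, E x := by
    intro i j
    refine hint _ 2 fun x => ?_
    have e1 := hmul _ _ _ x (hcB' _ (hB x)) (hEg2 j i x) rfl
    have e2 := hmul _ _ _ x (hcB' _ (hB1 j x)) (hEg1 i x) rfl
    have : pd j (V i) x = -c * χ x * pd j (pd i g) x + -c * pd j χ x * pd i g x := by
      rw [hpV]; ring
    rw [this]
    refine (abs_add_le _ _).trans ?_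
    linarith
  have hsub : Metric.ball (0 : Plane) 2 ⊆ Metric.ball 0 4 := Metric.ball_subset_ball (by norm_num)
  refine ⟨fun i x => V i x + W i x,
    fun i => ((hV i).mono hsub).add ((hW i).mono box_subset_ball), fun x => ?_, ?_⟩
  · simp only [fun i => pd_add (hV i).contDiff (hW i).contDiff i x, Finset.sum_add_distrib,
      hdivV, hWdiv]
    ring
  · have hij : ∀ i j, ∫ x, pd j (fun x => V i x + W i x) x ^ 2 ≤
        2 * ((2 * B) ^ 2 * ∫ x, E x) + 2 * ∫ x, pd j (W i) x ^ 2 := by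
      intro i j
      have hn : MemLp (fun x => -pd j (W i) x) 2 := ((hW i).pd j).memLp.neg
      have := integral_sub_sq_le ((hV i).pd j).memLp hn
      simp only [sub_neg_eq_add, neg_sq] at this
      simp only [fun x => pd_add (hV i).contDiff (hW i).contDiff j x]
      linarith [nV i j]
    calc energy (fun i x => V i x + W i x)
        ≤ ∑ i : Fin 2, ∑ j : Fin 2, (2 * ((2 * B) ^ 2 * ∫ x, E x) + 2 * ∫ x, pd j (W i) x ^ 2) :=
          Finset.sum_le_sum fun i _ => Finset.sum_le_sum fun j _ => hij i j
      _ = 2 * (4 * (2 * B) ^ 2) * (∫ x, E x) + 2 * energy W := by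
          simp only [energy, Fin.sum_univ_two]; ring
      _ ≤ 2 * (4 * (2 * B) ^ 2) * (∫ x, E x) +
            2 * (C * ((3 * B) ^ 2 * (∫ x, E x) + (6 * B) ^ 2 * ∫ x, E x)) := by
          gcongr
          refine hWE.trans ?_
          gcongr
      _ = (2 * (4 * (2 * B) ^ 2) + 2 * C * ((3 * B) ^ 2 + (6 * B) ^ 2)) * ∫ x, E x := by ring
      _ ≤ (2 * (4 * (2 * B) ^ 2) + 2 * C * ((3 * B) ^ 2 + (6 * B) ^ 2)) *
            ((c ^ 2)⁻¹ * ∫ x, f x ^ 2) := by gcongr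
      _ = _ := by ring

/-! ### The interior estimate on balls -/

lemma integral_comp_affine (F : Plane → ℝ) (z : Plane) {r : ℝ} (hr : 0 < r) :
    ∫ x, F (r⁻¹ • (x - z)) = r ^ 2 * ∫ x, F x := by
  rw [integral_sub_right_eq_self (fun x => F (r⁻¹ • x)) z, Measure.integral_comp_smul]
  simp [abs_of_pos hr]

lemma pd_comp_affine {φ : Plane → ℝ} (hφ : ContDiff ℝ ∞ φ) (z : Plane) (a : ℝ) (j : Fin 2)
    (x : Plane) : pd j (fun x => φ (a • (x - z))) x = a * pd j φ (a • (x - z)) := by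
  have h1 : HasFDerivAt (fun x : Plane => a • (x - z)) (a • ContinuousLinearMap.id ℝ Plane) x :=
    ((hasFDerivAt_id x).sub_const z).const_smul a
  have := ((hφ.diffAt (a • (x - z))).hasFDerivAt.comp x h1).fderiv
  simp only [Function.comp_def] at this
  rw [pd, this]
  simp [pd]

lemma IsTest.comp_affine {φ : Plane → ℝ} {z : Plane} {ρ a b : ℝ} (hφ : IsTest (Metric.ball 0 ρ) φ)
    (ha : 0 < a) (hb : b * a = ρ) :
    IsTest (Metric.ball z b) (fun x => φ (a • (x - z))) := by
  have hK : IsCompact ((fun y : Plane => a⁻¹ • y + z) '' tsupport φ) :=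
    hφ.compact.isCompact.image (by fun_prop)
  refine IsTest.of_eq_zero (hφ.contDiff.comp (by fun_prop)) hK (fun x hx => ?_) ?_
  · refine image_eq_zero_of_notMem_tsupport fun hmem => hx ⟨_, hmem, ?_⟩
    simp [smul_smul, ha.ne']
  · rintro _ ⟨y, hy, rfl⟩
    have := mem_ball_zero_iff.1 (hφ.subset hy)
    rw [Metric.mem_ball, dist_eq_norm, add_sub_cancel_right, norm_smul, Real.norm_eq_abs,
      abs_of_pos (inv_pos.2 ha), inv_mul_lt_iff₀ ha]
    linarith

lemma IsTest.comp_affine' {φ : Plane → ℝ} {z : Plane} {r : ℝ} (hφ : IsTest (Metric.ball z r) φ)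
    (hr : 0 < r) : IsTest (Metric.ball 0 1) (fun y => φ (r • y + z)) := by
  have hK : IsCompact ((fun y : Plane => r⁻¹ • (y - z)) '' tsupport φ) :=
    hφ.compact.isCompact.image (by fun_prop)
  refine IsTest.of_eq_zero (hφ.contDiff.comp (by fun_prop)) hK (fun x hx => ?_) ?_
  · refine image_eq_zero_of_notMem_tsupport fun hmem => hx ⟨_, hmem, ?_⟩
    simp [smul_smul, hr.ne']
  · rintro _ ⟨y, hy, rfl⟩
    have := Metric.mem_ball.1 (hφ.subset hy)
    rw [dist_eq_norm] at this
    rw [mem_ball_zero_iff, norm_smul, Real.norm_eq_abs, abs_of_pos (inv_pos.2 hr),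
      inv_mul_lt_iff₀ hr]
    linarith

/-- Rescaling x ↦ r w((x - z)/r) leaves the values of the gradient unchanged, so in the plane both
sides scale like r². The constant is therefore the same for all balls, which the Whitney covering
depends on. -/
lemma exists_div_eq_ball : ∃ C : ℝ, 0 ≤ C ∧ ∀ (z : Plane) (r : ℝ), 0 < r → ∀ f : Plane → ℝ,
    IsTest (Metric.ball z r) f → ∫ x, f x = 0 →
    ∃ w : Fin 2 → Plane → ℝ, (∀ i, IsTest (Metric.ball z (4 * r)) (w i)) ∧
      (∀ x, ∑ i, pd i (w i) x = f x) ∧ energy w ≤ C * ∫ x, f x ^ 2 := by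
  obtain ⟨C, hC, H⟩ := exists_div_eq_unit
  refine ⟨C, hC, fun z r hr f hf hmean => ?_⟩
  let f₁ : Plane → ℝ := fun y => f (r • y + z)
  have hf₁ : IsTest (Metric.ball 0 1) f₁ := hf.comp_affine' hr
  have hback : ∀ x, f₁ (r⁻¹ • (x - z)) = f x := fun x => by simp [f₁, smul_smul, hr.ne']
  have hm₁ : ∫ y, f₁ y = 0 := by
    have := integral_comp_affine f₁ z hr
    simp only [hback, hmean] at this
    have hr2 : r ^ 2 ≠ 0 := by positivity
    exact (mul_eq_zero.1 this.symm).resolve_left hr2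
  obtain ⟨w, hw, hdiv, hE⟩ := H f₁ hf₁ hm₁
  have hsm : ∀ i, ContDiff ℝ ∞ (fun x => w i (r⁻¹ • (x - z))) := fun i =>
    (hw i).contDiff.comp (by fun_prop)
  have hp : ∀ i j x, pd j (fun x => r * w i (r⁻¹ • (x - z))) x = pd j (w i) (r⁻¹ • (x - z)) := by
    intro i j x
    rw [pd_const_mul (hsm i), pd_comp_affine (hw i).contDiff]
    field_simp
  refine ⟨fun i x => r * w i (r⁻¹ • (x - z)), fun i => ?_, fun x => ?_, ?_⟩
  · exact ((hw i).comp_affine (inv_pos.2 hr) (by field_simp)).const_mul r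
  · simp only [fun i => hp i i x, hdiv, hback]
  · have h1 : energy (fun i x => r * w i (r⁻¹ • (x - z))) = r ^ 2 * energy w := by
      simp only [energy, hp, Finset.mul_sum]
      refine Finset.sum_congr rfl fun i _ => Finset.sum_congr rfl fun j _ => ?_
      exact integral_comp_affine (fun x => pd j (w i) x ^ 2) z hr
    have h2 : ∫ x, f x ^ 2 = r ^ 2 * ∫ y, f₁ y ^ 2 := by
      rw [← integral_comp_affine (fun y => f₁ y ^ 2) z hr]
      simp only [hback]
    rw [h1, h2]
    calc r ^ 2 * energy w ≤ r ^ 2 * (C * ∫ x, f₁ x ^ 2) := by gcongr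
      _ = _ := by ring

/-! ### Density of test functions of mean value zero -/

/-- The classes in `L²(B)` of the test functions on `B` with mean value zero. -/
def meanZeroTests (B : Set Plane) : Submodule ℝ (L2 B) where
  carrier := {j | ∃ f, IsTest B f ∧ ∫ x, f x = 0 ∧ j =ᵐ[volume.restrict B] f}
  zero_mem' := ⟨fun _ => 0, IsTest.zero, by simp, Lp.coeFn_zero _ _ _⟩
  add_mem' := by
    rintro j k ⟨f, hf, hf0, hjf⟩ ⟨g, hg, hg0, hkg⟩
    refine ⟨fun x => f x + g x, hf.add hg, ?_, ?_⟩
    · rw [integral_add hf.integrable hg.integrable, hf0, hg0, add_zero]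
    · filter_upwards [Lp.coeFn_add j k, hjf, hkg] with x h1 h2 h3
      rw [h1, Pi.add_apply, h2, h3]
  smul_mem' := by
    rintro c j ⟨f, hf, hf0, hjf⟩
    refine ⟨fun x => c * f x, hf.const_mul c, ?_, ?_⟩
    · rw [integral_const_mul, hf0, mul_zero]
    · filter_upwards [Lp.coeFn_smul c j, hjf] with x h1 h2
      rw [h1, Pi.smul_apply, h2, smul_eq_mul]

lemma inner_eq_integral {B : Set Plane} (u v : L2 B) : inner ℝ u v = ∫ x in B, u x * v x := by
  rw [L2.inner_def]
  simp [mul_comm]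

lemma setIntegral_test {B : Set Plane} {f : Plane → ℝ} (hf : IsTest B f) (p : Plane → ℝ) :
    ∫ x in B, p x * f x = ∫ x, p x * f x :=
  setIntegral_eq_integral_of_forall_compl_eq_zero fun x hx => by rw [hf.eq_zero hx, mul_zero]

/-- Du Bois-Reymond: with a fixed bump ψ of integral 1, each test function φ becomes a test function
φ - (∫ φ)ψ of mean zero. Orthogonality to it says that u - ∫ uψ annihilates φ. -/
lemma ae_eq_const_of_orthogonal {B : Set Plane} (hB : IsOpen B) (hb : Bornology.IsBounded B)
    (hne : B.Nonempty) {u : L2 B} (hu : u ∈ (meanZeroTests B)ᗮ) :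
    ∃ a : ℝ, ∀ᵐ x ∂volume.restrict B, u x = a := by
  have : IsFiniteMeasure (volume.restrict B) := ⟨by simpa using hb.measure_lt_top⟩
  obtain ⟨z, hz⟩ := hne
  obtain ⟨ρ, hρ, hρB⟩ := Metric.isOpen_iff.1 hB z hz
  let b : ContDiffBump z := ⟨ρ / 4, ρ / 2, by linarith, by linarith⟩
  let ψ : Plane → ℝ := b.normed volume
  have hψ : IsTest B ψ := ⟨b.contDiff_normed, b.hasCompactSupport_normed, by
    rw [b.tsupport_normed_eq]
    exact (Metric.closedBall_subset_ball (by simp [b]; linarith)).trans hρB⟩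
  have hψ1 : ∫ x, ψ x = 1 := b.integral_normed
  have hmem : ∀ f : Plane → ℝ, IsTest B f → MemLp f 2 (volume.restrict B) := fun f hf =>
    hf.memLp.mono_measure Measure.restrict_le_self
  have hu1 : ∀ f : Plane → ℝ, IsTest B f → Integrable (fun x => u x * f x) (volume.restrict B) :=
    fun f hf => (Lp.memLp u).integrable_mul (hmem f hf)
  have hort : ∀ f : Plane → ℝ, IsTest B f → ∫ x, f x = 0 → ∫ x in B, u x * f x = 0 := by
    intro f hf hf0
    have h1 := (Submodule.mem_orthogonal' _ _).1 hu ((hmem f hf).toLp f)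
      ⟨f, hf, hf0, (hmem f hf).coeFn_toLp⟩
    rw [inner_eq_integral] at h1
    rw [← h1]
    refine integral_congr_ae ?_
    filter_upwards [(hmem f hf).coeFn_toLp] with x hx
    rw [hx]
  refine ⟨∫ x in B, u x * ψ x, ?_⟩
  set a := ∫ x in B, u x * ψ x
  have hloc : LocallyIntegrableOn (fun x => u x - a) B := by
    have h1 : Integrable u (volume.restrict B) := (Lp.memLp u).integrable (by norm_num)
    exact IntegrableOn.locallyIntegrableOn (h1.sub (integrable_const a))
  have := hB.ae_eq_zero_of_integral_contDiff_smul_eq_zero hloc fun φ h1 h2 h3 => by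
    have hφ : IsTest B φ := ⟨h1, h2, h3⟩
    have hf : IsTest B (fun x => φ x - (∫ y, φ y) * ψ x) := hφ.sub (hψ.const_mul _)
    have h4 := hort _ hf (by
      rw [integral_sub hφ.integrable (hψ.integrable.const_mul _), integral_const_mul, hψ1]
      ring)
    have h5 : ∫ x in B, u x * (φ x - (∫ y, φ y) * ψ x) =
        (∫ x in B, u x * φ x) - (∫ y, φ y) * a := by
      rw [← integral_const_mul, ← integral_sub (hu1 φ hφ) ((hu1 ψ hψ).const_mul _)]
      congr 1
      ext x
      ring
    have h6 : ∫ x, φ x • (u x - a) = ∫ x in B, (u x - a) * φ x := by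
      rw [setIntegral_test hφ]
      simp [mul_comm]
    rw [h6]
    have h7 : ∫ x in B, (u x - a) * φ x = (∫ x in B, u x * φ x) - a * ∫ x in B, φ x := by
      rw [← integral_const_mul, ← integral_sub (hu1 φ hφ) (hφ.integrable.restrict.const_mul _)]
      congr 1
      ext x
      ring
    have h8 : ∫ x in B, φ x = ∫ x, φ x :=
      setIntegral_eq_integral_of_forall_compl_eq_zero fun x hx => hφ.eq_zero hx
    rw [h7, h8]
    rw [h5] at h4
    linarith
  rw [ae_restrict_iff' hB.measurableSet]
  filter_upwards [this] with x hx hxB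
  linarith [hx hxB]

/-- The deviation q of `p` from its mean is orthogonal to constants, hence is a limit of test
functions of mean zero. An `f` within ‖q‖/2 of it has norm at most 2‖q‖ and pairs with q to at least
‖q‖²/2; since ∫ f = 0, pairing with `p` gives the same. -/
lemma exists_test_approx {B : Set Plane} (hB : IsOpen B) (hb : Bornology.IsBounded B)
    (hne : B.Nonempty) {p : Plane → ℝ} (hp : MemLp p 2 (volume.restrict B)) :
    ∃ f, IsTest B f ∧ ∫ x, f x = 0 ∧
      ∫ x, f x ^ 2 ≤ 4 * ∫ x in B, (p x - ⨍ y in B, p y) ^ 2 ∧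
      (∫ x in B, (p x - ⨍ y in B, p y) ^ 2) / 2 ≤ ∫ x, p x * f x := by
  have : IsFiniteMeasure (volume.restrict B) := ⟨by simpa using hb.measure_lt_top⟩
  have : NeZero (volume.restrict B) := ⟨by
    rw [Ne, Measure.restrict_eq_zero]; exact (hB.measure_pos _ hne).ne'⟩
  set c := ⨍ y in B, p y
  have hq : MemLp (fun x => p x - c) 2 (volume.restrict B) := hp.sub (memLp_const c)
  let q : L2 B := hq.toLp _
  have hqae := hq.coeFn_toLp
  have hqI : ‖q‖ ^ 2 = ∫ x in B, (p x - c) ^ 2 := by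
    rw [← real_inner_self_eq_norm_sq, inner_eq_integral]
    refine integral_congr_ae ?_
    filter_upwards [hqae] with x hx
    rw [hx]; ring
  -- The approximation below is to within half the norm, which must be positive.
  by_cases hq0 : q = 0
  · refine ⟨fun _ => 0, IsTest.zero, by simp, ?_, ?_⟩
    · rw [← hqI, hq0]; simp
    · rw [← hqI, hq0]; simp
  have hmemcl : q ∈ (meanZeroTests B).topologicalClosure := by
    rw [← Submodule.orthogonal_orthogonal_eq_closure, Submodule.mem_orthogonal]
    intro u hu
    obtain ⟨a, ha⟩ := ae_eq_const_of_orthogonal hB hb hne hu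
    rw [inner_eq_integral]
    have : ∫ x in B, u x * q x = ∫ x in B, a * (p x - c) := by
      refine integral_congr_ae ?_
      filter_upwards [ha, hqae] with x h1 h2
      rw [h1, h2]
    rw [this, integral_const_mul]
    have h0 := integral_sub_average (volume.restrict B) p
    simp only [c]
    rw [h0, mul_zero]
  have hpos : 0 < ‖q‖ := norm_pos_iff.2 hq0
  obtain ⟨j, ⟨f, hf, hf0, hjf⟩, hj⟩ :=
    Metric.mem_closure_iff.1 hmemcl (‖q‖ / 2) (by positivity)
  rw [dist_eq_norm] at hj
  refine ⟨f, hf, hf0, ?_, ?_⟩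
  · have h1 : ∫ x, f x ^ 2 = ‖j‖ ^ 2 := by
      rw [← real_inner_self_eq_norm_sq, inner_eq_integral]
      have : ∫ x in B, f x * f x = ∫ x, f x * f x := setIntegral_test hf f
      simp only [pow_two]
      rw [← this]
      refine integral_congr_ae ?_
      filter_upwards [hjf] with x hx
      rw [hx]
    have h2 : ‖j‖ ≤ 2 * ‖q‖ := by
      have := norm_sub_norm_le j q
      rw [norm_sub_rev] at this
      linarith
    rw [h1, ← hqI]
    nlinarith [norm_nonneg j]
  · have h1 : ∫ x, p x * f x = inner ℝ q j := by
      rw [inner_eq_integral]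
      have h2 : ∫ x in B, q x * j x = ∫ x in B, (p x * f x - c * f x) := by
        refine integral_congr_ae ?_
        filter_upwards [hqae, hjf] with x h3 h4
        rw [h3, h4]; ring
      have h5 : MemLp f 2 (volume.restrict B) := hf.memLp.mono_measure Measure.restrict_le_self
      have h6 : Integrable (fun x => p x * f x) (volume.restrict B) := hp.integrable_mul h5
      rw [h2, integral_sub h6 (hf.integrable.restrict.const_mul _),
        integral_const_mul, setIntegral_test hf,
        setIntegral_eq_integral_of_forall_compl_eq_zero fun x hx => hf.eq_zero hx, hf0]
      ring
    have h2 : inner ℝ q j = ‖q‖ ^ 2 - inner ℝ q (q - j) := by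
      rw [inner_sub_right, real_inner_self_eq_norm_sq]; ring
    have h3 := real_inner_le_norm q (q - j)
    rw [h1, h2, ← hqI]
    nlinarith

/-! ### From the gradient in H⁻¹ to local oscillations -/

/-- The distributional gradient of `p` has norm at most `M` in `H⁻¹(Ω)²`. -/
def GradBound (Ω : Set Plane) (p : Plane → ℝ) (M : ℝ) : Prop :=
  ∀ w : Fin 2 → Plane → ℝ, (∀ i, IsTest Ω (w i)) →
    |∫ x in Ω, p x * ∑ i, pd i (w i) x| ≤ M * √(energy w)

/-- At every point at most `N` of the fields are active, so Cauchy–Schwarz for the sum costs only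
the factor `N`. -/
lemma energy_sum_le {ι : Type*} (s : Finset ι) {A : ι → Set Plane} {w : ι → Fin 2 → Plane → ℝ}
    (hw : ∀ k ∈ s, ∀ i, IsTest (A k) (w k i)) {N : ℕ}
    (hN : ∀ x, ∀ t ⊆ s, (∀ k ∈ t, x ∈ A k) → t.card ≤ N) :
    energy (fun i x => ∑ k ∈ s, w k i x) ≤ N * ∑ k ∈ s, energy (w k) := by
  classical
  have h2 : ∀ k ∈ s, ∀ i j, Integrable (fun x => pd j (w k i) x ^ 2) := fun k hk i j =>
    ((hw k hk i).pd j).memLp.integrable_sq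
  have key : ∀ i j, ∫ x, pd j (fun x => ∑ k ∈ s, w k i x) x ^ 2 ≤
      N * ∑ k ∈ s, ∫ x, pd j (w k i) x ^ 2 := by
    intro i j
    rw [← integral_finsetSum _ fun k hk => h2 k hk i j, ← integral_const_mul]
    refine integral_mono_of_nonneg (Eventually.of_forall fun _ => sq_nonneg _)
      ((integrable_finsetSum _ fun k hk => h2 k hk i j).const_mul _)
      (Eventually.of_forall fun x => ?_)
    simp only
    rw [pd_sum s fun k hk => (hw k hk i).contDiff]
    have hz : ∀ k ∈ s, x ∉ A k → pd j (w k i) x = 0 := fun k hk hx =>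
      ((hw k hk i).pd j).eq_zero hx
    have e1 : ∑ k ∈ s, pd j (w k i) x = ∑ k ∈ s with x ∈ A k, pd j (w k i) x := by
      rw [Finset.sum_filter]
      refine Finset.sum_congr rfl fun k hk => ?_
      split_ifs with h
      · rfl
      · exact hz k hk h
    rw [e1]
    refine sq_sum_le_card_mul_sum_sq.trans ?_
    have hcard : ((s.filter fun k => x ∈ A k).card : ℝ) ≤ N := by
      exact_mod_cast hN x _ (Finset.filter_subset _ _) fun k hk => (Finset.mem_filter.1 hk).2
    refine mul_le_mul hcard ?_ (Finset.sum_nonneg fun _ _ => sq_nonneg _) (Nat.cast_nonneg _)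
    exact Finset.sum_le_sum_of_subset_of_nonneg (Finset.filter_subset _ _)
      fun _ _ _ => sq_nonneg _
  calc energy (fun i x => ∑ k ∈ s, w k i x)
      ≤ ∑ i : Fin 2, ∑ j : Fin 2, N * ∑ k ∈ s, ∫ x, pd j (w k i) x ^ 2 :=
        Finset.sum_le_sum fun i _ => Finset.sum_le_sum fun j _ => key i j
    _ = N * ∑ k ∈ s, energy (w k) := by
        simp only [energy, Fin.sum_univ_two, Finset.sum_add_distrib]
        ring

/-- The local oscillations over a family of balls of bounded overlap. -/
lemma exists_sum_oscillation_le : ∃ C : ℝ, 0 ≤ C ∧ ∀ (Ω : Set Plane) (p : Plane → ℝ) (M : ℝ),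
    MemLp p 2 (volume.restrict Ω) → GradBound Ω p M →
    ∀ {ι : Type} (s : Finset ι) (z : ι → Plane) (r : ι → ℝ) (N : ℕ), (∀ k ∈ s, 0 < r k) →
    (∀ k ∈ s, Metric.ball (z k) (4 * r k) ⊆ Ω) →
    (∀ x, ∀ t ⊆ s, (∀ k ∈ t, x ∈ Metric.ball (z k) (4 * r k)) → t.card ≤ N) →
    ∑ k ∈ s, ∫ x in Metric.ball (z k) (r k), (p x - ⨍ y in Metric.ball (z k) (r k), p y) ^ 2 ≤
      C * N * M ^ 2 := by
  obtain ⟨C, hC, H⟩ := exists_div_eq_ball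
  refine ⟨16 * C, by positivity, fun Ω p M hp hM ι s z r N hr hsub hN => ?_⟩
  have hsub' : ∀ k ∈ s, Metric.ball (z k) (r k) ⊆ Ω := fun k hk =>
    (Metric.ball_subset_ball (by linarith [hr k hk])).trans (hsub k hk)
  let I : ι → ℝ := fun k =>
    ∫ x in Metric.ball (z k) (r k), (p x - ⨍ y in Metric.ball (z k) (r k), p y) ^ 2
  have hI : ∀ k, 0 ≤ I k := fun k => integral_nonneg fun _ => sq_nonneg _
  -- On each ball, `f` is a smooth substitute for `p` minus its mean, and `w` solves div w = f.
  have hex : ∀ k, ∃ (f : Plane → ℝ) (w : Fin 2 → Plane → ℝ), k ∈ s →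
      IsTest (Metric.ball (z k) (r k)) f ∧ (∀ i, IsTest (Metric.ball (z k) (4 * r k)) (w i)) ∧
      (∀ x, ∑ i, pd i (w i) x = f x) ∧ energy w ≤ 4 * C * I k ∧ I k / 2 ≤ ∫ x, p x * f x := by
    intro k
    by_cases hk : k ∈ s
    · obtain ⟨f, hf, hf0, hf2, hfp⟩ := exists_test_approx Metric.isOpen_ball Metric.isBounded_ball
        (Metric.nonempty_ball.2 (hr k hk)) (hp.mono_measure (Measure.restrict_mono (hsub' k hk) le_rfl))
      obtain ⟨w, hw, hdiv, hE⟩ := H (z k) (r k) (hr k hk) f hf hf0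
      refine ⟨f, w, fun _ => ⟨hf, hw, hdiv, hE.trans ?_, hfp⟩⟩
      calc C * ∫ x, f x ^ 2 ≤ C * (4 * I k) := by gcongr
        _ = _ := by ring
    · exact ⟨0, 0, fun h => absurd h hk⟩
  choose f w hfw using hex
  have hwΩ : ∀ i, IsTest Ω (fun x => ∑ k ∈ s, w k i x) := fun i =>
    IsTest.sum s fun k hk => ((hfw k hk).2.1 i).mono (hsub k hk)
  -- The gradient bound is used once, on the sum of all local fields. With T the sum of the
  -- oscillations it yields T/2 ≤ M √(4CNT), hence the factor 16.
  have hmain := hM (fun i x => ∑ k ∈ s, w k i x) hwΩ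
  have hdiv : ∀ x, ∑ i, pd i (fun x => ∑ k ∈ s, w k i x) x = ∑ k ∈ s, f k x := by
    intro x
    simp only [fun i => pd_sum s (fun k hk => ((hfw k hk).2.1 i).contDiff) i x]
    rw [Finset.sum_comm]
    exact Finset.sum_congr rfl fun k hk => (hfw k hk).2.2.1 x
  have hfi : ∀ k ∈ s, Integrable (fun x => p x * f k x) (volume.restrict Ω) := fun k hk =>
    hp.integrable_mul ((hfw k hk).1.memLp.mono_measure Measure.restrict_le_self)
  have hlow : (∑ k ∈ s, I k) / 2 ≤ ∫ x in Ω, p x * ∑ i, pd i (fun x => ∑ k ∈ s, w k i x) x := by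
    simp only [hdiv, Finset.mul_sum]
    rw [integral_finsetSum _ hfi, Finset.sum_div]
    refine Finset.sum_le_sum fun k hk => ?_
    rw [setIntegral_test ((hfw k hk).1.mono (hsub' k hk))]
    exact (hfw k hk).2.2.2.2
  have hE : energy (fun i x => ∑ k ∈ s, w k i x) ≤ 4 * C * N * ∑ k ∈ s, I k := by
    refine (energy_sum_le s (fun k hk => (hfw k hk).2.1) hN).trans ?_
    calc (N : ℝ) * ∑ k ∈ s, energy (w k) ≤ N * ∑ k ∈ s, 4 * C * I k := by
          gcongr with k hk
          exact (hfw k hk).2.2.2.1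
      _ = _ := by rw [← Finset.mul_sum]; ring
  have hT : 0 ≤ ∑ k ∈ s, I k := Finset.sum_nonneg fun k _ => hI k
  have hE0 : 0 ≤ energy (fun i x => ∑ k ∈ s, w k i x) :=
    Finset.sum_nonneg fun _ _ => Finset.sum_nonneg fun _ _ => integral_nonneg fun _ => sq_nonneg _
  change ∑ k ∈ s, I k ≤ _
  set T := ∑ k ∈ s, I k
  set e := energy (fun i x => ∑ k ∈ s, w k i x)
  have h1 : T / 2 ≤ M * √e := hlow.trans ((le_abs_self _).trans hmain)
  have h2 : (T / 2) ^ 2 ≤ M ^ 2 * (4 * C * N * T) := by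
    calc (T / 2) ^ 2 ≤ (M * √e) ^ 2 := by gcongr
      _ = M ^ 2 * e := by rw [mul_pow, Real.sq_sqrt hE0]
      _ ≤ _ := by gcongr
  rcases hT.eq_or_lt with h0 | h0
  · rw [← h0]; positivity
  · have h3 : T * T ≤ (16 * C * N * M ^ 2) * T := by linarith
    exact le_of_mul_le_mul_right h3 h0

/-! ### Sets on which the oscillation is controlled -/

/-- On `U` the distance of `p` to the constants is controlled by the gradient of `p` in
`H⁻¹(Ω)²`. -/
def OscControlled (Ω U : Set Plane) : Prop :=
  ∃ C : ℝ, 0 ≤ C ∧ ∀ (p : Plane → ℝ) (M : ℝ), Measurable p → MemLp p 2 (volume.restrict Ω) →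
    GradBound Ω p M → ∃ c : ℝ, ∫ x in U, (p x - c) ^ 2 ≤ C * M ^ 2

lemma integrableOn_sub_const_sq {Ω U : Set Plane} (hb : Bornology.IsBounded Ω) (hU : U ⊆ Ω)
    {p : Plane → ℝ} (hp : MemLp p 2 (volume.restrict Ω)) (c : ℝ) :
    IntegrableOn (fun x => (p x - c) ^ 2) U := by
  have : IsFiniteMeasure (volume.restrict Ω) := ⟨by simpa using hb.measure_lt_top⟩
  exact IntegrableOn.mono_set (hp.sub (memLp_const c)).integrable_sq hU

lemma OscControlled.mono {Ω U V : Set Plane} (hb : Bornology.IsBounded Ω) (hU : U ⊆ Ω)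
    (h : OscControlled Ω U) (hVU : V ⊆ U) : OscControlled Ω V := by
  obtain ⟨C, hC, H⟩ := h
  refine ⟨C, hC, fun p M hpm hp hM => ?_⟩
  obtain ⟨c, hc⟩ := H p M hpm hp hM
  refine ⟨c, le_trans ?_ hc⟩
  exact setIntegral_mono_set (integrableOn_sub_const_sq hb hU hp c)
    (Eventually.of_forall fun _ => sq_nonneg _) (LE.le.eventuallyLE hVU)

lemma oscControlled_ball {Ω : Set Plane} {z : Plane} {r : ℝ} (hr : 0 < r)
    (h : Metric.ball z (4 * r) ⊆ Ω) : OscControlled Ω (Metric.ball z r) := by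
  obtain ⟨C, hC, H⟩ := exists_sum_oscillation_le
  refine ⟨C, hC, fun p M _ hp hM => ⟨⨍ y in Metric.ball z r, p y, ?_⟩⟩
  have := H Ω p M hp hM ({()} : Finset Unit) (fun _ => z) (fun _ => r) 1 (by simpa using hr)
    (by simpa using h) (fun x t ht _ => (Finset.card_le_card ht).trans (by simp))
  simpa using this

/-- The constants chosen on `U` and on `V` can be compared on the overlap, which is open and
non-empty and so has positive measure. The constant of `U` then serves on `V` as well. -/
lemma OscControlled.union {Ω U V : Set Plane} (hb : Bornology.IsBounded Ω) (hU : U ⊆ Ω) (hV : V ⊆ Ω)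
    (hUo : IsOpen U) (hVo : IsOpen V) (hne : (U ∩ V).Nonempty)
    (h₁ : OscControlled Ω U) (h₂ : OscControlled Ω V) : OscControlled Ω (U ∪ V) := by
  obtain ⟨C₁, hC₁, H₁⟩ := h₁
  obtain ⟨C₂, hC₂, H₂⟩ := h₂
  have hW0 : 0 < volume.real (U ∩ V) := by
    refine ENNReal.toReal_pos ((hUo.inter hVo).measure_pos _ hne).ne' ?_
    exact (hb.subset (Set.inter_subset_left.trans hU)).measure_lt_top.ne
  set m := volume.real (U ∩ V)
  have hVf : volume V ≠ ⊤ := (hb.subset hV).measure_lt_top.ne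
  have hWf : volume (U ∩ V) ≠ ⊤ := (hb.subset (Set.inter_subset_left.trans hU)).measure_lt_top.ne
  refine ⟨C₁ + (2 * C₂ + 2 * (volume.real V * ((2 * C₁ + 2 * C₂) / m))), by positivity,
    fun p M hpm hp hM => ?_⟩
  obtain ⟨c₁, hc₁⟩ := H₁ p M hpm hp hM
  obtain ⟨c₂, hc₂⟩ := H₂ p M hpm hp hM
  refine ⟨c₁, ?_⟩
  have i11 := integrableOn_sub_const_sq hb hU hp c₁
  have i12 := integrableOn_sub_const_sq hb hV hp c₁
  have i22 := integrableOn_sub_const_sq hb hV hp c₂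
  have hWU : U ∩ V ⊆ U := Set.inter_subset_left
  have hWV : U ∩ V ⊆ V := Set.inter_subset_right
  have hdiff : m * (c₁ - c₂) ^ 2 ≤ (2 * C₁ + 2 * C₂) * M ^ 2 := by
    have e1 : ∫ x in U ∩ V, (c₁ - c₂) ^ 2 = m * (c₁ - c₂) ^ 2 := by
      rw [setIntegral_const, smul_eq_mul]
    have e2 : ∫ x in U ∩ V, (c₁ - c₂) ^ 2 ≤
        ∫ x in U ∩ V, (2 * (p x - c₁) ^ 2 + 2 * (p x - c₂) ^ 2) := by
      refine setIntegral_mono (integrableOn_const hWf)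
        (((i11.mono_set hWU).const_mul 2).add ((i22.mono_set hWV).const_mul 2)) fun x => ?_
      nlinarith [sq_nonneg ((p x - c₁) + (p x - c₂))]
    rw [integral_add ((i11.mono_set hWU).const_mul 2) ((i22.mono_set hWV).const_mul 2),
      integral_const_mul, integral_const_mul, e1] at e2
    have e3 := setIntegral_mono_set i11 (Eventually.of_forall fun _ => sq_nonneg _)
      (LE.le.eventuallyLE hWU)
    have e4 := setIntegral_mono_set i22 (Eventually.of_forall fun _ => sq_nonneg _)
      (LE.le.eventuallyLE hWV)
    linarith
  have hV1 : ∫ x in V, (p x - c₁) ^ 2 ≤ 2 * (C₂ * M ^ 2) + 2 * (volume.real V * (c₁ - c₂) ^ 2) := by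
    have e2 : ∫ x in V, (p x - c₁) ^ 2 ≤ ∫ x in V, (2 * (p x - c₂) ^ 2 + 2 * (c₁ - c₂) ^ 2) := by
      refine setIntegral_mono i12 ((i22.const_mul 2).add (integrableOn_const hVf)) fun x => ?_
      nlinarith [sq_nonneg ((p x - c₂) + (c₁ - c₂))]
    rw [integral_add (i22.const_mul 2) (integrableOn_const hVf), integral_const_mul,
      setIntegral_const, smul_eq_mul] at e2
    linarith
  have hun : ∫ x in U ∪ V, (p x - c₁) ^ 2 ≤
      (∫ x in U, (p x - c₁) ^ 2) + ∫ x in V, (p x - c₁) ^ 2 := by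
    have e1 : U ∪ V = U ∪ (V \ U) := Set.union_sdiff_self.symm
    rw [e1, setIntegral_union Set.disjoint_sdiff_right (hVo.measurableSet.diff hUo.measurableSet)
      i11 (i12.mono_set Set.sdiff_subset)]
    refine add_le_add le_rfl ?_
    exact setIntegral_mono_set i12 (Eventually.of_forall fun _ => sq_nonneg _)
      (LE.le.eventuallyLE Set.sdiff_subset)
  have hd : (c₁ - c₂) ^ 2 ≤ (2 * C₁ + 2 * C₂) / m * M ^ 2 := by
    rw [div_mul_eq_mul_div, le_div_iff₀ hW0]
    linarith
  calc ∫ x in U ∪ V, (p x - c₁) ^ 2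
      ≤ C₁ * M ^ 2 + (2 * (C₂ * M ^ 2) + 2 * (volume.real V * ((2 * C₁ + 2 * C₂) / m * M ^ 2))) := by
        refine hun.trans (add_le_add hc₁ (hV1.trans ?_))
        gcongr
    _ = _ := by ring

/-- If `Ω` is connected and every point of its closure has a neighbourhood on whose intersection
with `Ω` the oscillation is controlled, then it is controlled on `Ω`. -/
lemma OscControlled.of_local {Ω : Set Plane} (hb : Bornology.IsBounded Ω) (ho : IsOpen Ω)
    (hc : IsConnected Ω)
    (hloc : ∀ x ∈ closure Ω, ∃ O, IsOpen O ∧ x ∈ O ∧ OscControlled Ω (O ∩ Ω)) :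
    OscControlled Ω Ω := by
  classical
  choose! O hO hxO hOC using hloc
  have hcomp : IsCompact (closure Ω) := hb.isCompact_closure
  obtain ⟨t, htΩ, hcov⟩ := hcomp.elim_nhds_subcover O fun x hx => (hO x hx).mem_nhds (hxO x hx)
  have hne : ∀ x ∈ t, (O x ∩ Ω).Nonempty := fun x hx =>
    mem_closure_iff.1 (htΩ x hx) (O x) (hO x (htΩ x hx)) (hxO x (htΩ x hx))
  let U : Finset Plane → Set Plane := fun s => ⋃ x ∈ s, O x ∩ Ω
  have hUo : ∀ s ⊆ t, IsOpen (U s) := fun s hs =>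
    isOpen_biUnion fun x hx => (hO x (htΩ x (hs hx))).inter ho
  have hUΩ : ∀ s, U s ⊆ Ω := fun s => Set.iUnion₂_subset fun x _ => Set.inter_subset_right
  have ht0 : t.Nonempty := by
    obtain ⟨x, hx⟩ := hc.nonempty
    obtain ⟨y, hy, -⟩ := Set.mem_iUnion₂.1 (hcov (subset_closure hx))
    exact ⟨y, hy⟩
  obtain ⟨x₀, hx₀⟩ := ht0
  let F : Finset (Finset Plane) := t.powerset.filter fun s => s.Nonempty ∧ OscControlled Ω (U s)
  have hF : F.Nonempty := ⟨{x₀}, by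
    simp only [F, Finset.mem_filter, Finset.mem_powerset, Finset.singleton_subset_iff, hx₀,
      Finset.singleton_nonempty, true_and]
    simpa [U] using hOC x₀ (htΩ x₀ hx₀)⟩
  -- A largest subfamily with controlled union is the whole cover: otherwise connectedness of `Ω`
  -- makes its union meet one of the remaining pieces, and that piece could be added.
  obtain ⟨s, hsF, hmax⟩ := Finset.exists_max_image F Finset.card hF
  simp only [F, Finset.mem_filter, Finset.mem_powerset] at hsF hmax
  obtain ⟨hst, hs0, hsC⟩ := hsF
  have hall : t ⊆ s := by
    by_contra hcon
    have hd : (t \ s).Nonempty := Finset.sdiff_nonempty.2 hcon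
    have hcovΩ : Ω ⊆ U s ∪ U (t \ s) := by
      intro x hx
      obtain ⟨y, hy, hxy⟩ := Set.mem_iUnion₂.1 (hcov (subset_closure hx))
      by_cases hys : y ∈ s
      · exact Or.inl (Set.mem_iUnion₂.2 ⟨y, hys, hxy, hx⟩)
      · exact Or.inr (Set.mem_iUnion₂.2 ⟨y, Finset.mem_sdiff.2 ⟨hy, hys⟩, hxy, hx⟩)
    have hnon : ∀ s' ⊆ t, s'.Nonempty → (Ω ∩ U s').Nonempty := by
      rintro s' hs' ⟨y, hy⟩
      obtain ⟨x, hx⟩ := hne y (hs' hy)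
      exact ⟨x, hx.2, Set.mem_iUnion₂.2 ⟨y, hy, hx⟩⟩
    obtain ⟨x, -, hx1, hx2⟩ := hc.isPreconnected (U s) (U (t \ s)) (hUo s hst)
      (hUo _ Finset.sdiff_subset) hcovΩ (hnon s hst hs0) (hnon _ Finset.sdiff_subset hd)
    obtain ⟨y, hy, hxy⟩ := Set.mem_iUnion₂.1 hx2
    rw [Finset.mem_sdiff] at hy
    have hins : OscControlled Ω (U (insert y s)) := by
      have : U (insert y s) = U s ∪ (O y ∩ Ω) := by
        simp only [U, Finset.set_biUnion_insert]
        rw [Set.union_comm]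
      rw [this]
      exact hsC.union hb (hUΩ s) Set.inter_subset_right (hUo s hst)
        ((hO y (htΩ y hy.1)).inter ho) ⟨x, hx1, hxy⟩ (hOC y (htΩ y hy.1))
    have := hmax (insert y s) ⟨Finset.insert_subset hy.1 hst, Finset.insert_nonempty _ _, hins⟩
    rw [Finset.card_insert_of_notMem hy.2] at this
    omega
  refine hsC.mono hb (hUΩ s) fun x hx => ?_
  obtain ⟨y, hy, hxy⟩ := Set.mem_iUnion₂.1 (hcov (subset_closure hx))
  exact Set.mem_iUnion₂.2 ⟨y, hall hy, hxy, hx⟩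

/-! ### Graph coordinates -/

/-- The height of `y` above the graph of `γ`, in the coordinates given by `e`. -/
def height (e : Plane ≃ₗᵢ[ℝ] Plane) (γ : ℝ → ℝ) (y : Plane) : ℝ := e y 1 - γ (e y 0)

/-- The point with abscissa `X` and height `t` above the graph of `γ`. -/
def graphPoint (e : Plane ≃ₗᵢ[ℝ] Plane) (γ : ℝ → ℝ) (X t : ℝ) : Plane :=
  e.symm (!₂[X, γ X + t] : Plane)

/-- The dilation of the height by `1 + σ`. -/
def stretch (e : Plane ≃ₗᵢ[ℝ] Plane) (γ : ℝ → ℝ) (σ : ℝ) (y : Plane) : Plane :=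
  e.symm (!₂[e y 0, e y 1 + σ * height e γ y] : Plane)

section Graph

variable {e : Plane ≃ₗᵢ[ℝ] Plane} {γ : ℝ → ℝ} {L : ℝ≥0}

@[simp] lemma graphPoint_fst (X t : ℝ) : e (graphPoint e γ X t) 0 = X := by simp [graphPoint]

@[simp] lemma graphPoint_snd (X t : ℝ) : e (graphPoint e γ X t) 1 = γ X + t := by
  simp [graphPoint]

@[simp] lemma height_graphPoint (X t : ℝ) : height e γ (graphPoint e γ X t) = t := by
  simp [height]

@[simp] lemma stretch_fst (σ : ℝ) (y : Plane) : e (stretch e γ σ y) 0 = e y 0 := by simp [stretch]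

@[simp] lemma height_stretch (σ : ℝ) (y : Plane) :
    height e γ (stretch e γ σ y) = (1 + σ) * height e γ y := by
  simp only [height, stretch, LinearIsometryEquiv.apply_symm_apply]
  simp
  ring

lemma abs_coord_sub_le (i : Fin 2) (y z : Plane) : |e y i - e z i| ≤ dist y z := by
  rw [← e.dist_map y z, dist_eq_norm]
  exact PiLp.norm_apply_le (e y - e z) i

lemma dist_le_coords (y z : Plane) : dist y z ≤ |e y 0 - e z 0| + |e y 1 - e z 1| := by
  rw [← e.dist_map y z, EuclideanSpace.dist_eq, Fin.sum_univ_two, Real.dist_eq, Real.dist_eq]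
  refine Real.sqrt_le_iff.2 ⟨by positivity, ?_⟩
  nlinarith [mul_nonneg (abs_nonneg (e y 0 - e z 0)) (abs_nonneg (e y 1 - e z 1))]

lemma abs_graph_sub_le (hγ : LipschitzWith L γ) (a b : ℝ) : |γ a - γ b| ≤ L * |a - b| := by
  simpa [Real.dist_eq] using hγ.dist_le_mul a b

lemma abs_height_sub_le (hγ : LipschitzWith L γ) (y z : Plane) :
    |height e γ y - height e γ z| ≤ (1 + L) * dist y z := by
  have h0 := abs_coord_sub_le (e := e) 0 y z
  have h1 := abs_coord_sub_le (e := e) 1 y z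
  have h2 := abs_graph_sub_le hγ (e y 0) (e z 0)
  have h3 : (L : ℝ) * |e y 0 - e z 0| ≤ L * dist y z := by gcongr
  have : height e γ y - height e γ z = (e y 1 - e z 1) - (γ (e y 0) - γ (e z 0)) := by
    simp only [height]; ring
  rw [this]
  refine (abs_sub _ _).trans ?_
  linarith

lemma dist_graphPoint_le (hγ : LipschitzWith L γ) (y : Plane) (X t : ℝ) :
    dist y (graphPoint e γ X t) ≤ (1 + L) * |e y 0 - X| + |height e γ y - t| := by
  refine (dist_le_coords (e := e) y _).trans ?_
  rw [graphPoint_fst, graphPoint_snd]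
  have h2 := abs_graph_sub_le hγ (e y 0) X
  have : e y 1 - (γ X + t) = (γ (e y 0) - γ X) + (height e γ y - t) := by simp only [height]; ring
  rw [this]
  have := abs_add_le (γ (e y 0) - γ X) (height e γ y - t)
  linarith

lemma continuous_height (hγ : LipschitzWith L γ) : Continuous (height e γ) := by
  have := hγ.continuous
  unfold height
  fun_prop

/-- The coordinates given by `e`, as a measurable equivalence with `ℝ × ℝ`. -/
def graphCoords (e : Plane ≃ₗᵢ[ℝ] Plane) : Plane ≃ᵐ ℝ × ℝ :=
  (e.toMeasurableEquiv.trans (MeasurableEquiv.toLp 2 (Fin 2 → ℝ)).symm).trans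
    MeasurableEquiv.finTwoArrow

lemma measurePreserving_graphCoords : MeasurePreserving (graphCoords e) volume volume :=
  measurePreserving_coords.comp e.measurePreserving

/-- In coordinates the map is (a, b) ↦ (a, (1 + σ)b - σγ(a)), affine of slope 1 + σ on each vertical
line. Fubini gives the factor without differentiating γ. -/
lemma measurePreserving_stretch (hγ : LipschitzWith L γ) {σ : ℝ} (hσ : 0 < σ) :
    MeasurePreserving (stretch e γ σ) volume (ENNReal.ofReal (1 + σ)⁻¹ • volume) ∧
      MeasurableEmbedding (stretch e γ σ) := by
  have hl : (0 : ℝ) < 1 + σ := by linarith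
  let T : ℝ × ℝ → ℝ × ℝ := fun q => (q.1, (1 + σ) * q.2 - σ * γ q.1)
  have hTc : Continuous T := by
    have := hγ.continuous
    fun_prop
  have hTi : Function.Injective T := by
    rintro ⟨a, b⟩ ⟨a', b'⟩ h
    simp only [T, Prod.mk.injEq] at h
    obtain ⟨rfl, h⟩ := h
    have : (1 + σ) * b = (1 + σ) * b' := by linarith
    rw [mul_left_cancel₀ hl.ne' this]
  have hT : MeasurePreserving T volume (ENNReal.ofReal (1 + σ)⁻¹ • volume) := by
    have h1 := MeasurePreserving.skew_product (μa := (volume : Measure ℝ)) (μb := volume)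
      (μc := (volume : Measure ℝ)) (μd := ENNReal.ofReal (1 + σ)⁻¹ • volume)
      (f := id) (MeasurePreserving.id volume)
      (g := fun a b => (1 + σ) * b - σ * γ a)
      (by have := hγ.continuous; exact (by fun_prop : Continuous _).measurable)
      (Eventually.of_forall fun a => by
        have h2 : (fun b => (1 + σ) * b - σ * γ a) = (fun b => b - σ * γ a) ∘ ((1 + σ) * ·) := rfl
        rw [h2, ← Measure.map_map (by fun_prop) (by fun_prop),
          Real.map_volume_mul_left hl.ne', Measure.map_smul, abs_of_pos (inv_pos.2 hl)]
        congr 1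
        exact (measurePreserving_sub_right volume (σ * γ a)).map_eq)
    rw [Measure.prod_smul_right] at h1
    exact h1
  have hΨ : stretch e γ σ = (graphCoords e).symm ∘ T ∘ graphCoords e := by
    ext1 y
    apply (graphCoords e).injective
    simp only [Function.comp, MeasurableEquiv.apply_symm_apply]
    change ((e (stretch e γ σ y)) 0, (e (stretch e γ σ y)) 1) = T (e y 0, e y 1)
    simp only [stretch, LinearIsometryEquiv.apply_symm_apply, T, height]
    simp
    ring
  rw [hΨ]
  have hc := measurePreserving_graphCoords (e := e)
  refine ⟨((hc.symm _).smul_measure _).comp (hT.comp hc), ?_⟩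
  exact (graphCoords e).symm.measurableEmbedding.comp
    ((hTc.measurableEmbedding hTi).comp (graphCoords e).measurableEmbedding)

/-- That the factor is below 1 is what allows the absorption in `oscControlled_patch`. -/
lemma setLIntegral_stretch (hγ : LipschitzWith L γ) {σ : ℝ} (hσ : 0 < σ) (F : Plane → ENNReal)
    (A : Set Plane) :
    ∫⁻ y in stretch e γ σ ⁻¹' A, F (stretch e γ σ y) =
      ENNReal.ofReal (1 + σ)⁻¹ * ∫⁻ y in A, F y := by
  obtain ⟨h1, h2⟩ := measurePreserving_stretch (e := e) hγ hσ
  rw [h1.setLIntegral_comp_preimage_emb h2, Measure.restrict_smul, lintegral_smul_measure,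
    smul_eq_mul]

end Graph

/-! ### Whitney balls above a Lipschitz graph -/

section Patch

variable {e : Plane ≃ₗᵢ[ℝ] Plane} {γ : ℝ → ℝ} {L : ℝ≥0}

/-- The relative mesh width of the Whitney balls below the height `h`. -/
def whitneyWidth (L : ℝ≥0) : ℝ := (8 * (3 + (L : ℝ)) ^ 2)⁻¹

lemma whitneyWidth_pos : 0 < whitneyWidth L := by
  unfold whitneyWidth; positivity

lemma mul_whitneyWidth_eq : 8 * (3 + (L : ℝ)) ^ 2 * whitneyWidth L = 1 := by
  unfold whitneyWidth
  have : (3 + (L : ℝ)) ≠ 0 := by positivity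
  field_simp

lemma whitneyWidth_le : whitneyWidth L ≤ 1 / 72 := by
  have h := mul_whitneyWidth_eq (L := L)
  have hL : (0 : ℝ) ≤ L := L.2
  nlinarith [whitneyWidth_pos (L := L), mul_nonneg hL (whitneyWidth_pos (L := L)).le,
    mul_nonneg (mul_nonneg hL hL) (whitneyWidth_pos (L := L)).le]

/-- The height of the Whitney balls in the `k`-th layer. -/
def layer (L : ℝ≥0) (h : ℝ) (k : ℕ) : ℝ := h * ((1 + whitneyWidth L)⁻¹) ^ k

/-- The centres of the Whitney balls. -/
def whitneyCenter (e : Plane ≃ₗᵢ[ℝ] Plane) (γ : ℝ → ℝ) (L : ℝ≥0) (a h : ℝ) (i : ℕ × ℤ) : Plane :=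
  graphPoint e γ (a + i.2 * (whitneyWidth L * layer L h i.1)) (layer L h i.1)

/-- The radii of the Whitney balls. -/
def whitneyRadius (L : ℝ≥0) (h : ℝ) (i : ℕ × ℤ) : ℝ :=
  (3 + (L : ℝ)) * (whitneyWidth L * layer L h i.1)

lemma layer_pos {h : ℝ} (hh : 0 < h) (k : ℕ) : 0 < layer L h k := by
  have := whitneyWidth_pos (L := L)
  unfold layer; positivity

lemma layer_le {h : ℝ} (hh : 0 < h) (k : ℕ) : layer L h k ≤ h := by
  have := whitneyWidth_pos (L := L)
  unfold layer
  refine mul_le_of_le_one_right hh.le (pow_le_one₀ (by positivity) ?_)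
  exact inv_le_one_of_one_le₀ (by linarith)

lemma layer_succ (h : ℝ) (k : ℕ) : (1 + whitneyWidth L) * layer L h (k + 1) = layer L h k := by
  have := whitneyWidth_pos (L := L)
  have h1 : 1 + whitneyWidth L ≠ 0 := by positivity
  unfold layer
  rw [pow_succ]
  field_simp

lemma layer_add (h : ℝ) (k m : ℕ) : (1 + whitneyWidth L) ^ m * layer L h (k + m) = layer L h k := by
  induction m with
  | zero => simp
  | succ m ih => rw [← ih, ← layer_succ h (k + m), pow_succ]; ring_nf

lemma whitneyRadius_pos {h : ℝ} (hh : 0 < h) (i : ℕ × ℤ) : 0 < whitneyRadius L h i := by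
  have := whitneyWidth_pos (L := L)
  have := layer_pos (L := L) hh i.1
  unfold whitneyRadius; positivity

/-- The value of `whitneyWidth` is chosen for this. As the height is (1 + L)-Lipschitz, on a
fourfold ball it differs from the layer height by at most half of it, so the ball stays above the
graph. -/
lemma whitneyRadius_mul_le {h : ℝ} (hh : 0 < h) (i : ℕ × ℤ) :
    (1 + (L : ℝ)) * (4 * whitneyRadius L h i) ≤ layer L h i.1 / 2 := by
  have h1 := mul_whitneyWidth_eq (L := L)
  have h2 := whitneyWidth_pos (L := L)
  have h3 := layer_pos (L := L) hh i.1
  have hL : (0 : ℝ) ≤ L := L.2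
  have h4 : (1 + (L : ℝ)) * (4 * ((3 + (L : ℝ)) * whitneyWidth L)) ≤ 1 / 2 := by
    nlinarith [mul_nonneg hL h2.le]
  unfold whitneyRadius
  calc (1 + (L : ℝ)) * (4 * ((3 + (L : ℝ)) * (whitneyWidth L * layer L h i.1)))
      = (1 + (L : ℝ)) * (4 * ((3 + (L : ℝ)) * whitneyWidth L)) * layer L h i.1 := by ring
    _ ≤ 1 / 2 * layer L h i.1 := by gcongr
    _ = _ := by ring

/-- Deviations δ in abscissa and height amount to a distance of at most (2 + L)δ; the radius (3 +
L)δ makes membership strict. -/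
lemma mem_whitneyBall (hγ : LipschitzWith L γ) {a h : ℝ} (hh : 0 < h) (i : ℕ × ℤ) {y : Plane}
    (h0 : |e y 0 - (a + i.2 * (whitneyWidth L * layer L h i.1))| ≤ whitneyWidth L * layer L h i.1)
    (h1 : |height e γ y - layer L h i.1| ≤ whitneyWidth L * layer L h i.1) :
    y ∈ Metric.ball (whitneyCenter e γ L a h i) (whitneyRadius L h i) := by
  have hpos : 0 < whitneyWidth L * layer L h i.1 := mul_pos whitneyWidth_pos (layer_pos hh _)
  rw [Metric.mem_ball]
  refine (dist_graphPoint_le hγ y _ _).trans_lt ?_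
  unfold whitneyRadius
  have : (1 + (L : ℝ)) * |e y 0 - (a + i.2 * (whitneyWidth L * layer L h i.1))| ≤
      (1 + L) * (whitneyWidth L * layer L h i.1) := by gcongr
  linarith

lemma height_of_mem (hγ : LipschitzWith L γ) {a h : ℝ} (hh : 0 < h) (i : ℕ × ℤ) {y : Plane}
    (hy : y ∈ Metric.ball (whitneyCenter e γ L a h i) (4 * whitneyRadius L h i)) :
    layer L h i.1 / 2 ≤ height e γ y ∧ height e γ y ≤ 3 * (layer L h i.1 / 2) := by
  have h1 := abs_height_sub_le (e := e) hγ y (whitneyCenter e γ L a h i)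
  rw [whitneyCenter, height_graphPoint] at h1
  have h2 : (1 + (L : ℝ)) * dist y (whitneyCenter e γ L a h i) ≤
      (1 + L) * (4 * whitneyRadius L h i) := by
    gcongr; exact (Metric.mem_ball.1 hy).le
  have h3 := h1.trans (h2.trans (whitneyRadius_mul_le hh i))
  rw [abs_le] at h3
  constructor <;> linarith [h3.1, h3.2]

/-- The overlap of the Whitney balls. -/
lemma exists_overlap (L : ℝ≥0) : ∃ N : ℕ, ∀ (e : Plane ≃ₗᵢ[ℝ] Plane) (γ : ℝ → ℝ),
    LipschitzWith L γ → ∀ (a h : ℝ), 0 < h → ∀ (x : Plane) (t : Finset (ℕ × ℤ)),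
    (∀ i ∈ t, x ∈ Metric.ball (whitneyCenter e γ L a h i) (4 * whitneyRadius L h i)) →
    t.card ≤ N := by
  have hσ := whitneyWidth_pos (L := L)
  -- Two layers seen from one point have heights within a factor 3, and (1 + σ)^d ≥ 1 + dσ, so their
  -- indices differ by at most 2/σ. Within a layer the columns are within 4(3 + L) mesh widths; the
  -- floor adds 1.
  obtain ⟨m, hm⟩ := exists_nat_gt (2 / whitneyWidth L)
  obtain ⟨q, hq⟩ := exists_nat_gt (4 * (3 + (L : ℝ)) + 1)
  refine ⟨((Finset.range (m + 1)) ×ˢ (Finset.Icc (-(q : ℤ)) q)).card,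
    fun e γ hγ a h hh x t ht => ?_⟩
  rcases t.eq_empty_or_nonempty with rfl | hne
  · simp
  obtain ⟨i₀, hi₀, hmin⟩ := Finset.exists_min_image t Prod.fst hne
  let c : ℕ → ℤ := fun k => ⌊(e x 0 - a) / (whitneyWidth L * layer L h k)⌋
  -- Indices are taken relative to the smallest layer index, so natural subtraction is exact, and to
  -- the column below `x`. They then lie in a box independent of the point.
  refine Finset.card_le_card_of_injOn (fun i => (i.1 - i₀.1, i.2 - c i.1)) ?_ ?_
  · intro i hi
    have hi' : i ∈ t := hi
    rw [Finset.mem_coe, Finset.mem_product, Finset.mem_range, Finset.mem_Icc]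
    constructor
    · obtain ⟨d, hd⟩ := Nat.exists_eq_add_of_le (hmin i hi')
      have h1 := (height_of_mem hγ hh i₀ (ht i₀ hi₀)).1
      have h2 := (height_of_mem hγ hh i (ht i hi')).2
      rw [hd] at h2
      have h3 := layer_add (L := L) h i₀.1 d
      have h4 := layer_pos (L := L) hh (i₀.1 + d)
      have h5 : (1 + whitneyWidth L) ^ d ≤ 3 := by
        refine le_of_mul_le_mul_right ?_ h4
        rw [h3]; linarith
      have h6 := one_add_mul_le_pow (by linarith : (-2 : ℝ) ≤ whitneyWidth L) d
      have h7 : (d : ℝ) ≤ 2 / whitneyWidth L := by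
        rw [le_div_iff₀ hσ]; linarith
      have h8 : d < m := by exact_mod_cast h7.trans_lt hm
      simp only
      omega
    · have hpos : 0 < whitneyWidth L * layer L h i.1 := mul_pos hσ (layer_pos hh _)
      have h1 := (abs_coord_sub_le (e := e) 0 x (whitneyCenter e γ L a h i)).trans
        (Metric.mem_ball.1 (ht i hi')).le
      rw [whitneyCenter, graphPoint_fst, whitneyRadius] at h1
      set δ := whitneyWidth L * layer L h i.1
      have h2 : |(e x 0 - a) / δ - i.2| ≤ 4 * (3 + L) := by
        have : (e x 0 - a) / δ - i.2 = (e x 0 - (a + i.2 * δ)) / δ := by field_simp; ring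
        rw [this, abs_div, abs_of_pos hpos, div_le_iff₀ hpos]
        linarith
      have h3 := Int.floor_le ((e x 0 - a) / δ)
      have h4 := Int.lt_floor_add_one ((e x 0 - a) / δ)
      rw [abs_le] at h2
      have h5 : ((i.2 - c i.1 : ℤ) : ℝ) ≤ q := by
        push_cast
        change (i.2 : ℝ) - (⌊(e x 0 - a) / δ⌋ : ℤ) ≤ q
        linarith [h2.1]
      have h6 : (-(q : ℝ)) ≤ ((i.2 - c i.1 : ℤ) : ℝ) := by
        push_cast
        change -(q : ℝ) ≤ (i.2 : ℝ) - (⌊(e x 0 - a) / δ⌋ : ℤ)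
        linarith [h2.2]
      exact ⟨by exact_mod_cast h6, by exact_mod_cast h5⟩
  · intro i hi j hj hij
    have hi' := hmin i hi
    have hj' := hmin j hj
    simp only [Prod.mk.injEq] at hij
    have h1 : i.1 = j.1 := by omega
    have h2 : i.2 = j.2 := by
      have := hij.2
      rw [h1] at this
      linarith
    exact Prod.ext h1 h2

/-- The points with abscissa close to `a` between the graph and its vertical translate by `h`. -/
def patch (e : Plane ≃ₗᵢ[ℝ] Plane) (γ : ℝ → ℝ) (L : ℝ≥0) (a h : ℝ) : Set Plane :=
  {y | |e y 0 - a| < whitneyWidth L * h ∧ 0 < height e γ y ∧ height e γ y < h}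

/-- The ratio of consecutive layers equals the dilation factor 1 + σ. If `y` lies between the layers
k + 1 and k, its image lies at most the fraction σ above layer k, and both fit into one ball centred
on layer k. -/
lemma exists_whitneyBall (hγ : LipschitzWith L γ) {a h : ℝ} (hh : 0 < h) {y : Plane}
    (hy : y ∈ patch e γ L a h) : ∃ i : ℕ × ℤ, |i.2 * (whitneyWidth L * layer L h i.1)| ≤ h ∧
      y ∈ Metric.ball (whitneyCenter e γ L a h i) (whitneyRadius L h i) ∧
      stretch e γ (whitneyWidth L) y ∈
        Metric.ball (whitneyCenter e γ L a h i) (whitneyRadius L h i) := by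
  obtain ⟨h0, h1, h2⟩ := hy
  have hσ := whitneyWidth_pos (L := L)
  have hσ' := whitneyWidth_le (L := L)
  have hlam : (1 + whitneyWidth L)⁻¹ < 1 := inv_lt_one_of_one_lt₀ (by linarith)
  obtain ⟨k, hk1, hk2⟩ := exists_nat_pow_near_of_lt_one (x := height e γ y / h)
    (by positivity) (by rw [div_le_one hh]; exact h2.le) (by positivity) hlam
  have hk1' : layer L h (k + 1) < height e γ y := by
    rw [lt_div_iff₀ hh] at hk1
    unfold layer; linarith
  have hk2' : height e γ y ≤ layer L h k := by
    rw [div_le_iff₀ hh] at hk2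
    unfold layer; linarith
  have hpos : 0 < whitneyWidth L * layer L h k := mul_pos hσ (layer_pos hh _)
  set δ := whitneyWidth L * layer L h k with hδ
  have hs := layer_succ (L := L) h k
  have hlk := layer_le (L := L) hh k
  have hlk0 := layer_pos (L := L) hh k
  have hlk1 := layer_pos (L := L) hh (k + 1)
  let j : ℤ := ⌊(e y 0 - a) / δ⌋
  have hj1 : (j : ℝ) * δ ≤ e y 0 - a := by
    rw [← le_div_iff₀ hpos]; exact Int.floor_le _
  have hj2 : e y 0 - a < j * δ + δ := by
    have := Int.lt_floor_add_one ((e y 0 - a) / δ)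
    rw [div_lt_iff₀ hpos] at this
    change _ < ((j : ℝ) + 1) * δ at this
    linarith
  have hδh : δ ≤ whitneyWidth L * h := mul_le_mul_of_nonneg_left hlk hσ.le
  have hσh : whitneyWidth L * h ≤ h / 72 := by nlinarith
  rw [abs_lt] at h0
  have hX : |e y 0 - (a + j * δ)| ≤ δ := by
    rw [abs_le]; constructor <;> linarith
  refine ⟨(k, j), ?_, ?_, ?_⟩
  · change |(j : ℝ) * δ| ≤ h
    rw [abs_le]
    constructor <;> linarith [h0.1, h0.2]
  · refine mem_whitneyBall hγ hh _ hX ?_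
    rw [abs_le]
    constructor
    · change -δ ≤ height e γ y - layer L h k
      nlinarith
    · change height e γ y - layer L h k ≤ δ
      linarith
  · refine mem_whitneyBall hγ hh _ (by rw [stretch_fst]; exact hX) ?_
    rw [height_stretch, abs_le]
    constructor
    · change -δ ≤ (1 + whitneyWidth L) * height e γ y - layer L h k
      nlinarith
    · change (1 + whitneyWidth L) * height e γ y - layer L h k ≤ δ
      nlinarith

end Patch

/-! ### Oscillation up to the boundary -/

section Patch

variable {e : Plane ≃ₗᵢ[ℝ] Plane} {γ : ℝ → ℝ} {L : ℝ≥0}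

/-- The centre is within (2 + L)h of `x₀` and the fourfold radius is at most h/2, so the ball stays
where `Ω` is the region above the graph; its heights are positive by `height_of_mem`. -/
lemma whitneyBall_subset (hγ : LipschitzWith L γ) {Ω : Set Plane} {x₀ : Plane} {ρ h : ℝ}
    (hh : 0 < h) (hx₀ : height e γ x₀ = 0) (hρ : (4 + L) * h ≤ ρ)
    (hΩ : ∀ y ∈ Metric.ball x₀ ρ, (y ∈ Ω ↔ 0 < height e γ y)) {i : ℕ × ℤ}
    (hi : |i.2 * (whitneyWidth L * layer L h i.1)| ≤ h) :
    Metric.ball (whitneyCenter e γ L (e x₀ 0) h i) (4 * whitneyRadius L h i) ⊆ Ω := by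
  intro y hy
  have hl0 := layer_pos (L := L) hh i.1
  have hl := layer_le (L := L) hh i.1
  have hr := whitneyRadius_pos (L := L) hh i
  have hr2 := whitneyRadius_mul_le (L := L) hh i
  have hL : (0 : ℝ) ≤ L := L.2
  rw [hΩ]
  · linarith [(height_of_mem hγ hh i hy).1]
  · rw [Metric.mem_ball] at hy ⊢
    have h1 := dist_graphPoint_le (e := e) hγ x₀ (e x₀ 0 + i.2 * (whitneyWidth L * layer L h i.1))
      (layer L h i.1)
    rw [hx₀, sub_add_cancel_left, abs_neg, zero_sub, abs_neg, abs_of_pos hl0] at h1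
    have h2 : (1 + (L : ℝ)) * |i.2 * (whitneyWidth L * layer L h i.1)| ≤ (1 + L) * h := by gcongr
    have h3 := dist_triangle_right y x₀ (whitneyCenter e γ L (e x₀ 0) h i)
    have h4 : dist x₀ (whitneyCenter e γ L (e x₀ 0) h i) ≤ (1 + L) * h + h :=
      h1.trans (by linarith)
    have h5 : 4 * whitneyRadius L h i ≤ (1 + (L : ℝ)) * (4 * whitneyRadius L h i) := by
      nlinarith [mul_nonneg hL hr.le]
    nlinarith

lemma ofReal_setIntegral {Ω U : Set Plane} (hb : Bornology.IsBounded Ω) (hU : U ⊆ Ω)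
    {p : Plane → ℝ} (hp : MemLp p 2 (volume.restrict Ω)) (c : ℝ) :
    ∫⁻ x in U, ENNReal.ofReal ((p x - c) ^ 2) = ENNReal.ofReal (∫ x in U, (p x - c) ^ 2) :=
  (ofReal_integral_eq_lintegral_ofReal (integrableOn_sub_const_sq hb hU hp c)
    (Eventually.of_forall fun _ => sq_nonneg _)).symm

/-- Both `y` and its image lie in `B`, so each value is compared with `c`, and the change of
variables has a factor at most 1. -/
lemma lintegral_stretch_sub_le (hγ : LipschitzWith L γ) {Ω B : Set Plane}
    (hb : Bornology.IsBounded Ω) (hB : B ⊆ Ω) {p : Plane → ℝ} (hpm : Measurable p)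
    (hp : MemLp p 2 (volume.restrict Ω)) (c : ℝ) {σ : ℝ} (hσ : 0 < σ) :
    ∫⁻ y in B ∩ stretch e γ σ ⁻¹' B, ENNReal.ofReal ((p y - p (stretch e γ σ y)) ^ 2) ≤
      ENNReal.ofReal (4 * ∫ x in B, (p x - c) ^ 2) := by
  have hm1 : Measurable fun y => ENNReal.ofReal ((p y - c) ^ 2) := by fun_prop
  have hle1 : ENNReal.ofReal (1 + σ)⁻¹ ≤ 1 := by
    rw [ENNReal.ofReal_le_one]
    exact inv_le_one_of_one_le₀ (by linarith)
  calc ∫⁻ y in B ∩ stretch e γ σ ⁻¹' B, ENNReal.ofReal ((p y - p (stretch e γ σ y)) ^ 2)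
      ≤ ∫⁻ y in B ∩ stretch e γ σ ⁻¹' B, (2 * ENNReal.ofReal ((p y - c) ^ 2) +
          2 * ENNReal.ofReal ((p (stretch e γ σ y) - c) ^ 2)) := by
        refine lintegral_mono fun y => ?_
        have h2 : (2 : ENNReal) = ENNReal.ofReal 2 := by simp
        rw [h2, ← ENNReal.ofReal_mul (by norm_num), ← ENNReal.ofReal_mul (by norm_num),
          ← ENNReal.ofReal_add (by positivity) (by positivity)]
        refine ENNReal.ofReal_le_ofReal ?_
        nlinarith [sq_nonneg ((p y - c) + (p (stretch e γ σ y) - c))]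
    _ = 2 * (∫⁻ y in B ∩ stretch e γ σ ⁻¹' B, ENNReal.ofReal ((p y - c) ^ 2)) +
          2 * ∫⁻ y in B ∩ stretch e γ σ ⁻¹' B,
            ENNReal.ofReal ((p (stretch e γ σ y) - c) ^ 2) := by
        rw [lintegral_add_left (hm1.const_mul 2), lintegral_const_mul' _ _ (by simp),
          lintegral_const_mul' _ _ (by simp)]
    _ ≤ 2 * (∫⁻ y in B, ENNReal.ofReal ((p y - c) ^ 2)) +
          2 * ∫⁻ y in stretch e γ σ ⁻¹' B, ENNReal.ofReal ((p (stretch e γ σ y) - c) ^ 2) := by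
        gcongr
        · exact Set.inter_subset_left
        · exact Set.inter_subset_right
    _ ≤ 2 * (∫⁻ y in B, ENNReal.ofReal ((p y - c) ^ 2)) +
          2 * (1 * ∫⁻ y in B, ENNReal.ofReal ((p y - c) ^ 2)) := by
        rw [setLIntegral_stretch hγ hσ (fun y => ENNReal.ofReal ((p y - c) ^ 2))]
        gcongr
    _ = _ := by
        rw [one_mul, ofReal_setIntegral hb hB hp, ENNReal.ofReal_mul (by norm_num)]
        have h4 : ENNReal.ofReal 4 = 4 := by simp
        rw [h4, ← add_mul]
        norm_num

/-- Comparing `p` with p∘Ψ replaces chains of balls running down to the boundary. The difference is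
estimated ball by ball. The integral of (p∘Ψ - c)² is, by change of variables, at most (1 + σ)⁻¹
times that of (p - c)² over the patch and the top ball, and the patch part is absorbed; it is finite
because `p` is in L². -/
lemma oscControlled_patch (hγ : LipschitzWith L γ) {Ω : Set Plane} (hb : Bornology.IsBounded Ω)
    {x₀ : Plane} {ρ h : ℝ} (hh : 0 < h) (hx₀ : height e γ x₀ = 0) (hρ : (4 + L) * h ≤ ρ)
    (hΩ : ∀ y ∈ Metric.ball x₀ ρ, (y ∈ Ω ↔ 0 < height e γ y)) :
    patch e γ L (e x₀ 0) h ⊆ Ω ∧ OscControlled Ω (patch e γ L (e x₀ 0) h) := by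
  obtain ⟨C, hC, H⟩ := exists_sum_oscillation_le
  obtain ⟨N, hN⟩ := exists_overlap L
  set σ := whitneyWidth L with hσdef
  have hσ : 0 < σ := whitneyWidth_pos
  set a := e x₀ 0
  let P := patch e γ L a h
  let Ψ := stretch e γ σ
  let J : Set (ℕ × ℤ) := {i | |i.2 * (σ * layer L h i.1)| ≤ h}
  let B : ℕ × ℤ → Set Plane := fun i =>
    Metric.ball (whitneyCenter e γ L a h i) (whitneyRadius L h i)
  have hB4 : ∀ i ∈ J, Metric.ball (whitneyCenter e γ L a h i) (4 * whitneyRadius L h i) ⊆ Ω :=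
    fun i hi => whitneyBall_subset hγ hh hx₀ hρ hΩ hi
  have hBΩ : ∀ i ∈ J, B i ⊆ Ω := fun i hi => (Metric.ball_subset_ball (by
    linarith [whitneyRadius_pos (L := L) hh i])).trans (hB4 i hi)
  have hcov : ∀ y ∈ P, ∃ i ∈ J, y ∈ B i ∧ Ψ y ∈ B i := fun y hy => by
    obtain ⟨i, h1, h2, h3⟩ := exists_whitneyBall hγ hh hy
    exact ⟨i, h1, h2, h3⟩
  have hPΩ : P ⊆ Ω := fun y hy => by
    obtain ⟨i, hi, h1, -⟩ := hcov y hy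
    exact hBΩ i hi h1
  have h00 : ((0, 0) : ℕ × ℤ) ∈ J := by simp [J, hh.le]
  have hl0 : layer L h 0 = h := by simp [layer]
  -- Points pushed above the height `h` land in the ball (0, 0) of the top layer, whose mean will be
  -- the constant `c`.
  have hΨP : P ⊆ Ψ ⁻¹' (P ∪ B (0, 0)) := by
    rintro y ⟨h1, h2, h3⟩
    by_cases hlt : (1 + σ) * height e γ y < h
    · left
      refine ⟨by simpa [Ψ] using h1, ?_, ?_⟩
      · simp only [Ψ, height_stretch]; positivity
      · simpa only [Ψ, height_stretch] using hlt
    · right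
      push Not at hlt
      refine mem_whitneyBall hγ hh _ ?_ ?_
      · simp only [Ψ, stretch_fst, hl0, Int.cast_zero, zero_mul, add_zero]
        exact h1.le
      · simp only [Ψ, height_stretch, hl0]
        rw [abs_le]
        constructor <;> nlinarith
  refine ⟨hPΩ, ?_⟩
  set K := C * N with hK
  have hK0 : 0 ≤ K := by positivity
  have hσ2 : 0 < σ / 2 := by positivity
  -- The Young weights 1 + 2/σ and 1 + σ/2 keep (1 + σ/2)/(1 + σ) below 1; the last factor is the
  -- inverse of the gap.
  refine ⟨((1 + 2 / σ) * (4 * K) + (1 + σ / 2) * (1 + σ)⁻¹ * K) * (2 * (1 + σ) / σ),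
    by positivity, fun p M hpm hp hM => ?_⟩
  let I : ℕ × ℤ → ℝ := fun i => ∫ x in B i, (p x - ⨍ y in B i, p y) ^ 2
  have hI0 : ∀ i, 0 ≤ I i := fun i => integral_nonneg fun _ => sq_nonneg _
  have hfin : ∀ s : Finset (ℕ × ℤ), (∀ i ∈ s, i ∈ J) → ∑ i ∈ s, I i ≤ K * M ^ 2 := fun s hs =>
    H Ω p M hp hM s (whitneyCenter e γ L a h) (whitneyRadius L h) N
      (fun i _ => whitneyRadius_pos hh i) (fun i hi => hB4 i (hs i hi))
      (fun x t _ htx => hN e γ hγ a h hh x t htx)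
  have hD : ∫⁻ y in P, ENNReal.ofReal ((p y - p (Ψ y)) ^ 2) ≤ ENNReal.ofReal (4 * (K * M ^ 2)) := by
    calc ∫⁻ y in P, ENNReal.ofReal ((p y - p (Ψ y)) ^ 2)
        ≤ ∫⁻ y in ⋃ i : J, B i ∩ Ψ ⁻¹' B i, ENNReal.ofReal ((p y - p (Ψ y)) ^ 2) := by
          refine lintegral_mono_set fun y hy => ?_
          obtain ⟨i, hi, h1, h2⟩ := hcov y hy
          exact Set.mem_iUnion.2 ⟨⟨i, hi⟩, h1, h2⟩
      _ ≤ ∑' i : J, ∫⁻ y in B i ∩ Ψ ⁻¹' B i, ENNReal.ofReal ((p y - p (Ψ y)) ^ 2) :=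
          lintegral_iUnion_le _ _
      _ ≤ ∑' i : J, ENNReal.ofReal (4 * I i) := ENNReal.tsum_le_tsum fun i =>
          lintegral_stretch_sub_le hγ hb (hBΩ i i.2) hpm hp _ hσ
      _ ≤ ENNReal.ofReal (4 * (K * M ^ 2)) := by
          -- The infinite family of balls is handled through finite subfamilies, whose bound is
          -- uniform.
          rw [ENNReal.tsum_eq_iSup_sum]
          refine iSup_le fun s => ?_
          rw [← ENNReal.ofReal_sum_of_nonneg (f := fun i : J => 4 * I i)
            fun i _ => mul_nonneg (by norm_num) (hI0 i), ← Finset.mul_sum]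
          refine ENNReal.ofReal_le_ofReal (mul_le_mul_of_nonneg_left ?_ (by norm_num))
          have := hfin (s.map (Function.Embedding.subtype _)) (by
            intro i hi
            obtain ⟨j, -, rfl⟩ := Finset.mem_map.1 hi
            exact j.2)
          rwa [Finset.sum_map] at this
  let c := ⨍ y in B (0, 0), p y
  have hIB : ∫ x in B (0, 0), (p x - c) ^ 2 ≤ K * M ^ 2 := by
    have := hfin {(0, 0)} (by simpa using h00)
    simpa using this
  refine ⟨c, ?_⟩
  have hA0 : 0 ≤ ∫ x in P, (p x - c) ^ 2 := integral_nonneg fun _ => sq_nonneg _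
  have hst : ∫⁻ y in P, ENNReal.ofReal ((p (Ψ y) - c) ^ 2) ≤
      ENNReal.ofReal ((1 + σ)⁻¹ * ((∫ x in P, (p x - c) ^ 2) + K * M ^ 2)) := by
    calc ∫⁻ y in P, ENNReal.ofReal ((p (Ψ y) - c) ^ 2)
        ≤ ∫⁻ y in Ψ ⁻¹' (P ∪ B (0, 0)), ENNReal.ofReal ((p (Ψ y) - c) ^ 2) :=
          lintegral_mono_set hΨP
      _ = ENNReal.ofReal (1 + σ)⁻¹ * ∫⁻ y in P ∪ B (0, 0), ENNReal.ofReal ((p y - c) ^ 2) :=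
          setLIntegral_stretch hγ hσ (fun y => ENNReal.ofReal ((p y - c) ^ 2)) _
      _ ≤ ENNReal.ofReal (1 + σ)⁻¹ * ((∫⁻ y in P, ENNReal.ofReal ((p y - c) ^ 2)) +
            ∫⁻ y in B (0, 0), ENNReal.ofReal ((p y - c) ^ 2)) := by
          gcongr
          exact lintegral_union_le _ _ _
      _ = ENNReal.ofReal ((1 + σ)⁻¹ * ((∫ x in P, (p x - c) ^ 2) +
            ∫ x in B (0, 0), (p x - c) ^ 2)) := by
          rw [ofReal_setIntegral hb hPΩ hp, ofReal_setIntegral hb (hBΩ _ h00) hp,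
            ← ENNReal.ofReal_add hA0 (integral_nonneg fun _ => sq_nonneg _),
            ← ENNReal.ofReal_mul (by positivity)]
      _ ≤ _ := by
          refine ENNReal.ofReal_le_ofReal ?_
          gcongr
  have hmain : ENNReal.ofReal (∫ x in P, (p x - c) ^ 2) ≤
      ENNReal.ofReal ((1 + 2 / σ) * (4 * (K * M ^ 2)) +
        (1 + σ / 2) * ((1 + σ)⁻¹ * ((∫ x in P, (p x - c) ^ 2) + K * M ^ 2))) := by
    have hms : Measurable Ψ := (measurePreserving_stretch (e := e) hγ hσ).2.measurable
    -- Measurability of `p` itself, demanded in `OscControlled`, makes p∘Ψ measurable.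
    have hm1 : Measurable fun y => ENNReal.ofReal ((p y - p (Ψ y)) ^ 2) := by fun_prop
    rw [ENNReal.ofReal_add (by positivity) (by positivity),
      ENNReal.ofReal_mul (by positivity : (0 : ℝ) ≤ 1 + 2 / σ),
      ENNReal.ofReal_mul (by positivity : (0 : ℝ) ≤ 1 + σ / 2), ← ofReal_setIntegral hb hPΩ hp]
    calc ∫⁻ y in P, ENNReal.ofReal ((p y - c) ^ 2)
        ≤ ∫⁻ y in P, (ENNReal.ofReal (1 + 2 / σ) * ENNReal.ofReal ((p y - p (Ψ y)) ^ 2) +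
            ENNReal.ofReal (1 + σ / 2) * ENNReal.ofReal ((p (Ψ y) - c) ^ 2)) := by
          refine lintegral_mono fun y => ?_
          rw [← ENNReal.ofReal_mul (by positivity), ← ENNReal.ofReal_mul (by positivity),
            ← ENNReal.ofReal_add (by positivity) (by positivity)]
          refine ENNReal.ofReal_le_ofReal ?_
          have key : ∀ A D : ℝ, (A + D) ^ 2 ≤ (1 + 2 / σ) * A ^ 2 + (1 + σ / 2) * D ^ 2 := by
            intro A D
            have h1 : (1 + 2 / σ) * A ^ 2 + (1 + σ / 2) * D ^ 2 - (A + D) ^ 2 =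
                2 / σ * (A - σ / 2 * D) ^ 2 := by
              field_simp
              ring
            have h2 : 0 ≤ 2 / σ * (A - σ / 2 * D) ^ 2 := by positivity
            linarith
          have := key (p y - p (Ψ y)) (p (Ψ y) - c)
          rwa [sub_add_sub_cancel] at this
      _ = ENNReal.ofReal (1 + 2 / σ) * (∫⁻ y in P, ENNReal.ofReal ((p y - p (Ψ y)) ^ 2)) +
            ENNReal.ofReal (1 + σ / 2) * ∫⁻ y in P, ENNReal.ofReal ((p (Ψ y) - c) ^ 2) := by
          rw [lintegral_add_left (hm1.const_mul _), lintegral_const_mul' _ _ (by simp),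
            lintegral_const_mul' _ _ (by simp)]
      _ ≤ _ := by gcongr
  rw [ENNReal.ofReal_le_ofReal_iff (by positivity)] at hmain
  change ∫ x in P, (p x - c) ^ 2 ≤ _
  set A := ∫ x in P, (p x - c) ^ 2
  have hθ : 1 - (1 + σ / 2) * (1 + σ)⁻¹ = (2 * (1 + σ) / σ)⁻¹ := by
    field_simp
    ring
  have hpos : 0 < 2 * (1 + σ) / σ := by positivity
  have h1 : A * (2 * (1 + σ) / σ)⁻¹ ≤
      ((1 + 2 / σ) * (4 * K) + (1 + σ / 2) * (1 + σ)⁻¹ * K) * M ^ 2 := by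
    rw [← hθ]; nlinarith
  rw [← div_eq_mul_inv, div_le_iff₀ hpos] at h1
  linarith

/-- The local hypothesis of `OscControlled.of_local` at the boundary of a Lipschitz domain. -/
lemma exists_nhds_oscControlled {Ω : Set Plane} (hΩ : IsBoundedLipschitzDomain Ω) {x : Plane}
    (hx : x ∈ closure Ω) : ∃ O, IsOpen O ∧ x ∈ O ∧ OscControlled Ω (O ∩ Ω) := by
  have hb := hΩ.isBounded
  by_cases hxΩ : x ∈ Ω
  · obtain ⟨ρ, hρ, hsub⟩ := Metric.isOpen_iff.1 hΩ.isOpen x hxΩ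
    have hsub4 : Metric.ball x (4 * (ρ / 4)) ⊆ Ω := by
      rwa [show 4 * (ρ / 4) = ρ by ring]
    refine ⟨Metric.ball x (ρ / 4), Metric.isOpen_ball, Metric.mem_ball_self (by positivity), ?_⟩
    refine (oscControlled_ball (by positivity) hsub4).mono hb ?_ Set.inter_subset_left
    exact (Metric.ball_subset_ball (by linarith)).trans hsub
  · have hfr : x ∈ frontier Ω := by
      rw [hΩ.isOpen.frontier_eq]; exact ⟨hx, hxΩ⟩
    obtain ⟨e, γ, L, hγ, hev⟩ := hΩ.lipschitzBoundary x hfr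
    have hev' : ∀ᶠ y in 𝓝 x, (y ∈ Ω ↔ 0 < height e γ y) := by
      filter_upwards [hev] with y hy
      rw [hy, height, sub_pos]
    obtain ⟨ρ, hρ, hball⟩ := Metric.eventually_nhds_iff_ball.1 hev'
    have hcont := continuous_height (e := e) hγ
    -- Positive height would put `x` in `Ω`; negative height would persist nearby and keep `x` out
    -- of the closure.
    have hx0 : height e γ x = 0 := by
      refine le_antisymm ?_ ?_
      · have := hball x (Metric.mem_ball_self hρ)
        exact not_lt.1 fun h => hxΩ (this.2 h)
      · by_contra! hneg
        have h1 : ∀ᶠ y in 𝓝 x, height e γ y < 0 := hcont.continuousAt.eventually_lt_const hneg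
        obtain ⟨y, hyΩ, hy1, hy2⟩ := ((mem_closure_iff_frequently.1 hx).and_eventually
          (h1.and hev')).exists
        exact absurd (hy2.1 hyΩ) (not_lt.2 hy1.le)
    have hL : (0 : ℝ) < 4 + L := by positivity
    have hh : 0 < ρ / (4 + L) := by positivity
    obtain ⟨hPΩ, hP⟩ := oscControlled_patch hγ hb hh hx0
      (by rw [mul_div_cancel₀ _ hL.ne']) hball
    refine ⟨{y | |e y 0 - e x 0| < whitneyWidth L * (ρ / (4 + L))} ∩
      {y | height e γ y < ρ / (4 + L)} ∩ Metric.ball x ρ, ?_, ?_, ?_⟩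
    · refine (IsOpen.inter ?_ ?_).inter Metric.isOpen_ball
      · exact isOpen_lt (by fun_prop) continuous_const
      · exact isOpen_lt hcont continuous_const
    · refine ⟨⟨?_, ?_⟩, Metric.mem_ball_self hρ⟩
      · have := whitneyWidth_pos (L := L)
        simp only [Set.mem_ofPred_eq, sub_self, abs_zero]
        positivity
      · simpa [hx0] using hh
    · refine hP.mono hb hPΩ ?_
      rintro y ⟨⟨⟨h1, h2⟩, h3⟩, hyΩ⟩
      exact ⟨h1, (hball y h3).1 hyΩ, h2⟩

end Patch

/-- The distance in `L²` to the constants is controlled by the gradient in `H⁻¹`. -/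
theorem oscControlled_of_lipschitz {Ω : Set Plane} (hΩ : IsBoundedLipschitzDomain Ω) :
    OscControlled Ω Ω :=
  OscControlled.of_local hΩ.isBounded hΩ.isOpen hΩ.isConnected fun _ hx =>
    exists_nhds_oscControlled hΩ hx

variable {Ω : Set Plane}

/-! ### Test functions as elements of the Sobolev spaces -/

lemma IsTest.memLp_restrict {U : Set Plane} {φ : Plane → ℝ} (hφ : IsTest U φ) :
    MemLp φ 2 (volume.restrict Ω) :=
  hφ.memLp.mono_measure Measure.restrict_le_self

/-- The pair `(φ, ∇φ)`. -/
def IsTest.jet {φ : Plane → ℝ} (hφ : IsTest Ω φ) : Jet Ω :=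
  (hφ.memLp_restrict.toLp φ, fun i => (hφ.pd i).memLp_restrict.toLp (StokesLPS.pd i φ))

lemma IsTest.jet_mem_H10 {φ : Plane → ℝ} (hφ : IsTest Ω φ) : hφ.jet ∈ H10 Ω := by
  refine Submodule.le_topologicalClosure _ (Submodule.subset_span ?_)
  exact ⟨φ, hφ.contDiff, hφ.compact, hφ.subset, hφ.memLp_restrict.coeFn_toLp,
    fun i => (hφ.pd i).memLp_restrict.coeFn_toLp⟩

/-- The element of `H¹₀(Ω)²` given by a pair of test functions. -/
def testVelocity {w : Fin 2 → Plane → ℝ} (hw : ∀ i, IsTest Ω (w i)) : Velocity Ω :=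
  fun i => ⟨(hw i).jet, (hw i).jet_mem_H10⟩

lemma aForm_testVelocity {w : Fin 2 → Plane → ℝ} (hw : ∀ i, IsTest Ω (w i)) :
    aForm (testVelocity hw) (testVelocity hw) = energy w := by
  refine Finset.sum_congr rfl fun i _ => Finset.sum_congr rfl fun j _ => ?_
  rw [inner_eq_integral]
  have h1 : ∫ x in Ω, pd j (w i) x * pd j (w i) x = ∫ x, pd j (w i) x ^ 2 := by
    rw [setIntegral_test ((hw i).pd j)]
    simp only [pow_two]
  rw [← h1]
  refine integral_congr_ae ?_
  filter_upwards [((hw i).pd j).memLp_restrict (Ω := Ω) |>.coeFn_toLp] with x hx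
  change ((hw i).pd j).memLp_restrict.toLp _ x * ((hw i).pd j).memLp_restrict.toLp _ x = _
  rw [hx]

lemma bForm_testVelocity {w : Fin 2 → Plane → ℝ} (hw : ∀ i, IsTest Ω (w i)) (p : L2 Ω) :
    bForm (testVelocity hw) p = ∫ x in Ω, p x * ∑ i, pd i (w i) x := by
  have h1 : ∀ i, inner ℝ ((testVelocity hw).grad i i) p = ∫ x in Ω, p x * pd i (w i) x := by
    intro i
    rw [inner_eq_integral]
    refine integral_congr_ae ?_
    filter_upwards [((hw i).pd i).memLp_restrict (Ω := Ω) |>.coeFn_toLp] with x hx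
    change ((hw i).pd i).memLp_restrict.toLp _ x * p x = _
    rw [hx, mul_comm]
  simp only [Finset.mul_sum]
  rw [bForm, Velocity.div, sum_inner, integral_finsetSum]
  · exact Finset.sum_congr rfl fun i _ => h1 i
  · exact fun i _ => (Lp.memLp p).integrable_mul ((hw i).pd i).memLp_restrict

/-- The inf-sup condition. -/
theorem exists_infSup (hΩ : IsBoundedLipschitzDomain Ω) : ∃ C : ℝ, 0 ≤ C ∧ ∀ (p : L2 Ω) (M : ℝ),
    MeanZero p → 0 ≤ M → (∀ v : Velocity Ω, |bForm v p| ≤ M * √(aForm v v)) → ‖p‖ ≤ C * M := by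
  obtain ⟨C, hC, H⟩ := oscControlled_of_lipschitz hΩ
  refine ⟨√C, Real.sqrt_nonneg _, fun p M hp hM hb => ?_⟩
  have : IsFiniteMeasure (volume.restrict Ω) := ⟨by simpa using hΩ.isBounded.measure_lt_top⟩
  obtain ⟨c, hc⟩ := H p M (Lp.stronglyMeasurable p).measurable (Lp.memLp p) fun w hw => by
    have := hb (testVelocity hw)
    rwa [aForm_testVelocity, bForm_testVelocity] at this
  have h2 : Integrable (fun x => p x ^ 2) (volume.restrict Ω) := (Lp.memLp p).integrable_sq
  have h1 : Integrable p (volume.restrict Ω) := (Lp.memLp p).integrable (by norm_num)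
  -- As `p` has mean zero, subtracting a constant can only increase the norm, so the unknown `c` may
  -- be dropped.
  have hexp : ∫ x in Ω, (p x - c) ^ 2 = ‖p‖ ^ 2 + volume.real Ω * c ^ 2 := by
    have e1 : ∀ x, (p x - c) ^ 2 = p x ^ 2 - 2 * c * p x + c ^ 2 := fun x => by ring
    have h3 : Integrable (fun x => p x ^ 2 - 2 * c * p x) (volume.restrict Ω) :=
      h2.sub (h1.const_mul _)
    simp only [e1]
    rw [integral_add h3 (integrable_const _), integral_sub h2 (h1.const_mul _),
      integral_const_mul, show ∫ x in Ω, p x = 0 from hp, ← real_inner_self_eq_norm_sq,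
      inner_eq_integral]
    simp [pow_two]
  have h3 : ‖p‖ ^ 2 ≤ (√C * M) ^ 2 := by
    rw [mul_pow, Real.sq_sqrt hC]
    have : 0 ≤ volume.real Ω * c ^ 2 := by positivity
    linarith
  exact le_of_sq_le_sq h3 (by positivity)

/-! ### The Poincaré inequality -/

/-- The integral of ∂₀(x₀φ²) = φ² + 2x₀φ ∂₀φ vanishes, and by Young's inequality the integrand is at
least φ²/2 - 2R²(∂₀φ)². -/
lemma poincare_test {φ : Plane → ℝ} (hφ : IsTest Ω φ) {R : ℝ} (hR : ∀ x ∈ Ω, |x 0| ≤ R) :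
    ∫ x, φ x ^ 2 ≤ (2 * R) ^ 2 * ∫ x, pd 0 φ x ^ 2 := by
  have hX : ContDiff ℝ ∞ (fun x : Plane => x 0) := by fun_prop
  have hpX : ∀ x : Plane, pd 0 (fun x : Plane => x 0) x = 1 := by
    intro x
    have h1 : HasFDerivAt (fun z : Plane => z 0)
        (EuclideanSpace.proj (0 : Fin 2) : Plane →L[ℝ] ℝ) x :=
      (EuclideanSpace.proj (0 : Fin 2) : Plane →L[ℝ] ℝ).hasFDerivAt
    rw [pd, h1.fderiv]
    simp
  have hφ2 : IsTest Ω (fun x => φ x * φ x) := hφ.mul_right hφ.contDiff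
  have h0 := (hφ2.mul_left hX).integral_pd_eq_zero 0
  have hp : ∀ x, pd 0 (fun x : Plane => x 0 * (φ x * φ x)) x =
      2 * (x 0 * (φ x * pd 0 φ x)) + φ x ^ 2 := by
    intro x
    rw [pd_mul hX hφ2.contDiff, pd_mul hφ.contDiff hφ.contDiff, hpX]
    ring
  have hi1 := hφ.memLp.integrable_sq
  have hi2 := (hφ.pd 0).memLp.integrable_sq
  have hle : ∫ x, (1 / 2 * φ x ^ 2 - 2 * R ^ 2 * pd 0 φ x ^ 2) ≤
      ∫ x, pd 0 (fun x : Plane => x 0 * (φ x * φ x)) x := by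
    refine integral_mono ((hi1.const_mul _).sub (hi2.const_mul _))
      ((hφ2.mul_left hX).pd 0).integrable fun x => ?_
    simp only [hp]
    by_cases hx : x ∈ Ω
    · have h1 : x 0 ^ 2 ≤ R ^ 2 := sq_le_sq' (abs_le.1 (hR x hx)).1 (abs_le.1 (hR x hx)).2
      nlinarith [sq_nonneg (φ x + 2 * x 0 * pd 0 φ x),
        mul_le_mul_of_nonneg_right h1 (sq_nonneg (pd 0 φ x))]
    · rw [hφ.eq_zero hx, (hφ.pd 0).eq_zero hx]
      simp
  rw [h0, integral_sub (hi1.const_mul _) (hi2.const_mul _), integral_const_mul,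
    integral_const_mul] at hle
  linarith

lemma norm_sq_eq_integral (u : L2 Ω) : ‖u‖ ^ 2 = ∫ x in Ω, u x * u x := by
  rw [← real_inner_self_eq_norm_sq, inner_eq_integral]

lemma norm_sq_of_ae_eq {u : L2 Ω} {φ : Plane → ℝ} (hφ : IsTest Ω φ)
    (h : u =ᵐ[volume.restrict Ω] φ) : ‖u‖ ^ 2 = ∫ x, φ x ^ 2 := by
  rw [norm_sq_eq_integral]
  have h1 : ∫ x in Ω, φ x * φ x = ∫ x, φ x ^ 2 := by
    rw [setIntegral_test hφ]; simp only [pow_two]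
  rw [← h1]
  refine integral_congr_ae ?_
  filter_upwards [h] with x hx
  rw [hx]

/-- Test functions already form a linear space, so the span in `H10` adds nothing and closed
conditions need checking on test functions only. -/
lemma span_testJets_subset {j : Jet Ω} (hj : j ∈ Submodule.span ℝ (testJets Ω)) :
    j ∈ testJets Ω := by
  induction hj using Submodule.span_induction with
  | mem x h => exact h
  | zero =>
    have ht : IsTest Ω (fun _ => (0 : ℝ)) := IsTest.zero
    refine ⟨fun _ => 0, ht.contDiff, ht.compact, ht.subset,
      Lp.coeFn_zero _ _ _, fun i => ?_⟩
    filter_upwards [Lp.coeFn_zero ℝ 2 (volume.restrict Ω)] with x hx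
    simpa using hx
  | add x y _ _ hx hy =>
    obtain ⟨φ, h1, h2, h3, h4, h5⟩ := hx
    obtain ⟨ψ, k1, k2, k3, k4, k5⟩ := hy
    have ht := IsTest.add ⟨h1, h2, h3⟩ ⟨k1, k2, k3⟩
    refine ⟨_, ht.contDiff, ht.compact, ht.subset, ?_, fun i => ?_⟩
    · filter_upwards [Lp.coeFn_add x.1 y.1, h4, k4] with z e1 e2 e3
      rw [Prod.fst_add, e1, Pi.add_apply, e2, e3]
    · filter_upwards [Lp.coeFn_add (x.2 i) (y.2 i), h5 i, k5 i] with z e1 e2 e3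
      rw [Prod.snd_add, Pi.add_apply, e1, Pi.add_apply, e2, e3]
      exact (pd_add h1 k1 i z).symm
  | smul c x _ hx =>
    obtain ⟨φ, h1, h2, h3, h4, h5⟩ := hx
    have ht := IsTest.const_mul ⟨h1, h2, h3⟩ c
    refine ⟨_, ht.contDiff, ht.compact, ht.subset, ?_, fun i => ?_⟩
    · filter_upwards [Lp.coeFn_smul c x.1, h4] with z e1 e2
      rw [Prod.smul_fst, e1, Pi.smul_apply, e2, smul_eq_mul]
    · filter_upwards [Lp.coeFn_smul c (x.2 i), h5 i] with z e1 e2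
      rw [Prod.smul_snd, Pi.smul_apply, e1, Pi.smul_apply, e2]
      exact (pd_const_mul h1 c i z).symm

lemma exists_poincare (hb : Bornology.IsBounded Ω) :
    ∃ C : ℝ, 0 ≤ C ∧ ∀ v : H10 Ω, ‖v.1.1‖ ≤ C * ‖v.1.2 0‖ := by
  obtain ⟨R, hR0, hR⟩ := hb.subset_ball_lt 0 (0 : Plane)
  refine ⟨2 * R, by positivity, fun v => ?_⟩
  have hcl : IsClosed {j : Jet Ω | ‖j.1‖ ≤ 2 * R * ‖j.2 0‖} :=
    isClosed_le (by fun_prop) (by fun_prop)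
  have hsub : closure (Submodule.span ℝ (testJets Ω) : Set (Jet Ω)) ⊆
      {j : Jet Ω | ‖j.1‖ ≤ 2 * R * ‖j.2 0‖} := by
    refine closure_minimal (fun j hj => ?_) hcl
    obtain ⟨φ, h1, h2, h3, h4, h5⟩ := span_testJets_subset hj
    have ht : IsTest Ω φ := ⟨h1, h2, h3⟩
    have := poincare_test ht (R := R) fun x hx =>
      (PiLp.norm_apply_le x 0).trans (mem_ball_zero_iff.1 (hR hx)).le
    rw [← norm_sq_of_ae_eq ht h4, ← norm_sq_of_ae_eq (ht.pd 0) (h5 0), ← mul_pow] at this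
    exact le_of_sq_le_sq this (by positivity)
  exact hsub v.2

/-! ### The forms -/

lemma abs_sum_inner_le {ι : Type*} [Fintype ι] (x y : ι → L2 Ω) :
    |∑ k, inner ℝ (x k) (y k)| ≤
      √(∑ k, inner ℝ (x k) (x k)) * √(∑ k, inner ℝ (y k) (y k)) := by
  simp only [real_inner_self_eq_norm_sq]
  refine (Finset.abs_sum_le_sum_abs _ _).trans ?_
  refine (Finset.sum_le_sum fun k _ => abs_real_inner_le_norm (x k) (y k)).trans ?_
  exact Real.sum_mul_le_sqrt_mul_sqrt _ _ _

lemma abs_rForm_le (f g : Fin 2 → L2 Ω) : |rForm f g| ≤ √(rForm f f) * √(rForm g g) :=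
  abs_sum_inner_le f g

lemma aForm_eq_sum (u v : Velocity Ω) :
    aForm u v = ∑ k : Fin 2 × Fin 2, inner ℝ (u.grad k.1 k.2) (v.grad k.1 k.2) := by
  rw [Fintype.sum_prod_type]; rfl

lemma abs_aForm_le (u v : Velocity Ω) : |aForm u v| ≤ √(aForm u u) * √(aForm v v) := by
  simp only [aForm_eq_sum]
  exact abs_sum_inner_le (fun k : Fin 2 × Fin 2 => u.grad k.1 k.2) fun k => v.grad k.1 k.2

lemma rForm_self_nonneg (f : Fin 2 → L2 Ω) : 0 ≤ rForm f f :=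
  Finset.sum_nonneg fun _ _ => real_inner_self_nonneg

lemma aForm_self_nonneg (u : Velocity Ω) : 0 ≤ aForm u u :=
  Finset.sum_nonneg fun _ _ => Finset.sum_nonneg fun _ _ => real_inner_self_nonneg

lemma norm1_nonneg (v : Velocity Ω) : 0 ≤ norm1 v := Real.sqrt_nonneg _

lemma norm1_sq (v : Velocity Ω) : norm1 v ^ 2 = rForm v.val v.val + aForm v v :=
  Real.sq_sqrt (add_nonneg (rForm_self_nonneg _) (aForm_self_nonneg _))

lemma sqrt_rForm_le_norm1 (v : Velocity Ω) : √(rForm v.val v.val) ≤ norm1 v :=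
  Real.sqrt_le_sqrt (by linarith [aForm_self_nonneg v])

lemma sqrt_aForm_le_norm1 (v : Velocity Ω) : √(aForm v v) ≤ norm1 v :=
  Real.sqrt_le_sqrt (by linarith [rForm_self_nonneg v.val])

lemma rForm_comm (f g : Fin 2 → L2 Ω) : rForm f g = rForm g f :=
  Finset.sum_congr rfl fun _ _ => real_inner_comm _ _

lemma rForm_sub_left (f g k : Fin 2 → L2 Ω) : rForm (f - g) k = rForm f k - rForm g k := by
  simp only [rForm, Pi.sub_apply, inner_sub_left, Finset.sum_sub_distrib]

lemma rForm_smul_left (c : ℝ) (f k : Fin 2 → L2 Ω) : rForm (c • f) k = c * rForm f k := by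
  simp only [rForm, Pi.smul_apply, real_inner_smul_left, Finset.mul_sum]

lemma rForm_sub_right (f g k : Fin 2 → L2 Ω) : rForm k (f - g) = rForm k f - rForm k g := by
  rw [rForm_comm, rForm_sub_left, rForm_comm f, rForm_comm g]

lemma rForm_smul_right (c : ℝ) (f k : Fin 2 → L2 Ω) : rForm k (c • f) = c * rForm k f := by
  rw [rForm_comm, rForm_smul_left, rForm_comm]

lemma val_sub (u v : Velocity Ω) : (u - v).val = u.val - v.val := rfl

lemma val_smul (c : ℝ) (v : Velocity Ω) : (c • v).val = c • v.val := rfl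

lemma aForm_comm (u v : Velocity Ω) : aForm u v = aForm v u :=
  Finset.sum_congr rfl fun _ _ => Finset.sum_congr rfl fun _ _ => real_inner_comm _ _

lemma aForm_sub_left (u v w : Velocity Ω) : aForm (u - v) w = aForm u w - aForm v w := by
  have : ∀ i j, (u - v).grad i j = u.grad i j - v.grad i j := fun _ _ => rfl
  simp only [aForm, this, inner_sub_left, Finset.sum_sub_distrib]

lemma aForm_smul_left (c : ℝ) (u w : Velocity Ω) : aForm (c • u) w = c * aForm u w := by
  have : ∀ i j, (c • u).grad i j = c • u.grad i j := fun _ _ => rfl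
  simp only [aForm, this, real_inner_smul_left, Finset.mul_sum]

lemma aForm_sub_right (u v w : Velocity Ω) : aForm w (u - v) = aForm w u - aForm w v := by
  rw [aForm_comm, aForm_sub_left, aForm_comm u, aForm_comm v]

lemma aForm_smul_right (c : ℝ) (u w : Velocity Ω) : aForm w (c • u) = c * aForm w u := by
  rw [aForm_comm, aForm_smul_left, aForm_comm]

lemma bForm_sub_left (u v : Velocity Ω) (p : L2 Ω) : bForm (u - v) p = bForm u p - bForm v p := by
  have : (u - v).div = u.div - v.div := by
    have : ∀ i j, (u - v).grad i j = u.grad i j - v.grad i j := fun _ _ => rfl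
    simp only [Velocity.div, this, Finset.sum_sub_distrib]
  rw [bForm, this, inner_sub_left]; rfl

lemma bForm_sub_right (u : Velocity Ω) (p q : L2 Ω) : bForm u (p - q) = bForm u p - bForm u q :=
  inner_sub_right _ _ _

lemma abs_bForm_le (v : Velocity Ω) (p : L2 Ω) : |bForm v p| ≤ 2 * √(aForm v v) * ‖p‖ := by
  have hg : ∀ i, ‖v.grad i i‖ ≤ √(aForm v v) := by
    intro i
    refine Real.le_sqrt_of_sq_le ?_
    rw [← real_inner_self_eq_norm_sq]
    refine (Finset.single_le_sum (f := fun j => inner ℝ (v.grad i j) (v.grad i j))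
      (fun _ _ => real_inner_self_nonneg) (Finset.mem_univ i)).trans ?_
    exact Finset.single_le_sum (f := fun i => ∑ j, inner ℝ (v.grad i j) (v.grad i j))
      (fun _ _ => Finset.sum_nonneg fun _ _ => real_inner_self_nonneg) (Finset.mem_univ i)
  refine (abs_real_inner_le_norm _ _).trans ?_
  gcongr
  refine (norm_sum_le _ _).trans ?_
  rw [Fin.sum_univ_two]
  linarith [hg 0, hg 1]

lemma norm1_smul (c : ℝ) (v : Velocity Ω) : norm1 (c • v) = |c| * norm1 v := by
  rw [norm1, val_smul, rForm_smul_left, rForm_smul_right, aForm_smul_left, aForm_smul_right, norm1,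
    ← Real.sqrt_sq_eq_abs, ← Real.sqrt_mul (sq_nonneg c)]
  congr 1
  ring

lemma norm1_sub_rev (u v : Velocity Ω) : norm1 (u - v) = norm1 (v - u) := by
  simp only [norm1, val_sub, rForm_sub_left, rForm_sub_right, aForm_sub_left, aForm_sub_right]
  congr 1
  ring

lemma norm1_sub_le (u v w : Velocity Ω) : norm1 (u - w) ≤ norm1 (u - v) + norm1 (v - w) := by
  have hx := norm1_nonneg (u - v)
  have hy := norm1_nonneg (w - v)
  rw [norm1_sub_rev v w]
  refine le_of_sq_le_sq ?_ (by positivity)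
  set x := u - v
  set y := w - v
  have hxy : u - w = x - y := by simp only [x, y]; abel
  clear_value x y
  have hcs : -(rForm x.val y.val + aForm x y) ≤ norm1 x * norm1 y := by
    -- Values and derivatives are joined into one family, so this is Cauchy–Schwarz for the H¹ inner
    -- product.
    have h := abs_sum_inner_le (Sum.elim x.val fun k : Fin 2 × Fin 2 => x.grad k.1 k.2)
      (Sum.elim y.val fun k : Fin 2 × Fin 2 => y.grad k.1 k.2)
    simp only [Fintype.sum_sum_type, Sum.elim_inl, Sum.elim_inr] at h
    simp only [norm1, aForm_eq_sum]
    exact (neg_le_abs _).trans h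
  rw [hxy, norm1_sq, add_sq, norm1_sq, norm1_sq, val_sub, rForm_sub_left, rForm_sub_right,
    rForm_sub_right, aForm_sub_left, aForm_sub_right, aForm_sub_right, rForm_comm y.val x.val,
    aForm_comm y x]
  linarith

lemma exists_norm1_le (hb : Bornology.IsBounded Ω) :
    ∃ K : ℝ, 1 ≤ K ∧ ∀ v : Velocity Ω, norm1 v ≤ K * √(aForm v v) := by
  obtain ⟨C, hC, H⟩ := exists_poincare hb
  refine ⟨√(1 + C ^ 2), Real.one_le_sqrt.2 (by nlinarith [sq_nonneg C]), fun v => ?_⟩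
  rw [← Real.sqrt_mul (by positivity)]
  refine Real.sqrt_le_sqrt ?_
  have h1 : rForm v.val v.val ≤ C ^ 2 * aForm v v := by
    rw [rForm, aForm, Finset.mul_sum]
    refine Finset.sum_le_sum fun i _ => ?_
    have h2 : inner ℝ (v.grad i 0) (v.grad i 0) ≤ ∑ j, inner ℝ (v.grad i j) (v.grad i j) :=
      Finset.single_le_sum (f := fun j => inner ℝ (v.grad i j) (v.grad i j))
        (fun _ _ => real_inner_self_nonneg) (Finset.mem_univ 0)
    refine le_trans ?_ (mul_le_mul_of_nonneg_left h2 (sq_nonneg C))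
    rw [real_inner_self_eq_norm_sq, real_inner_self_eq_norm_sq, ← mul_pow]
    have := H (v i)
    exact pow_le_pow_left₀ (norm_nonneg _) this 2
  linarith

/-- A real supremum is an upper bound only for a set that is bounded above; this justifies every use
of `normNeg1`. -/
lemma bddAbove_normNeg1 (f : Fin 2 → L2 Ω) :
    BddAbove {t | ∃ v : Velocity Ω, norm1 v ≤ 1 ∧ t = rForm f v.val} := by
  refine ⟨√(rForm f f), ?_⟩
  rintro _ ⟨v, hv, rfl⟩
  refine (le_abs_self _).trans ((abs_rForm_le f v.val).trans ?_)
  exact mul_le_of_le_one_right (Real.sqrt_nonneg _) ((sqrt_rForm_le_norm1 v).trans hv)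

lemma normNeg1_nonneg (f : Fin 2 → L2 Ω) : 0 ≤ normNeg1 f := by
  refine le_csSup (bddAbove_normNeg1 f) ⟨(0 : ℝ) • (0 : Velocity Ω), ?_, ?_⟩
  · rw [norm1_smul]; simp
  · rw [val_smul, rForm_smul_right, zero_mul]

lemma abs_rForm_le_normNeg1 (f : Fin 2 → L2 Ω) (v : Velocity Ω) :
    |rForm f v.val| ≤ normNeg1 f * norm1 v := by
  rcases (norm1_nonneg v).eq_or_lt with h0 | hpos
  · have h1 : √(rForm v.val v.val) ≤ 0 := h0 ▸ sqrt_rForm_le_norm1 v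
    have h2 := abs_rForm_le f v.val
    rw [le_antisymm h1 (Real.sqrt_nonneg _), mul_zero] at h2
    rw [← h0, mul_zero]
    exact h2
  -- The supremum is taken without absolute values, so both `v` and -v are tested.
  · have key : ∀ s : ℝ, |s| = 1 → s * rForm f v.val ≤ normNeg1 f * norm1 v := by
      intro s hs
      have : s * (norm1 v)⁻¹ * rForm f v.val ≤ normNeg1 f := by
        refine le_csSup (bddAbove_normNeg1 f) ⟨(s * (norm1 v)⁻¹) • v, ?_, ?_⟩
        · rw [norm1_smul, abs_mul, hs, one_mul, abs_of_pos (inv_pos.2 hpos),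
            inv_mul_cancel₀ hpos.ne']
        · rw [val_smul, rForm_smul_right]
      calc s * rForm f v.val = s * (norm1 v)⁻¹ * rForm f v.val * norm1 v := by field_simp
        _ ≤ _ := by gcongr
    rw [abs_le']
    exact ⟨by simpa using key 1 (by simp), by simpa using key (-1) (by simp)⟩

lemma MeanZero.sub (hb : Bornology.IsBounded Ω) {p q : L2 Ω} (hp : MeanZero p) (hq : MeanZero q) :
    MeanZero (p - q) := by
  have : IsFiniteMeasure (volume.restrict Ω) := ⟨by simpa using hb.measure_lt_top⟩
  have hi : ∀ p : L2 Ω, Integrable p (volume.restrict Ω) := fun p =>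
    (Lp.memLp p).integrable (by norm_num)
  rw [MeanZero, integral_congr_ae (Lp.coeFn_sub p q)]
  simp only [Pi.sub_apply]
  rw [integral_sub (hi p) (hi q), show ∫ x in Ω, p x = 0 from hp, show ∫ x in Ω, q x = 0 from hq,
    sub_zero]

lemma Stabilization.form_self_nonneg (S : Stabilization Ω) (p : H1 Ω) : 0 ≤ S.form p p :=
  Finset.sum_nonneg fun K _ => mul_nonneg (S.α_nonneg K)
    (Finset.sum_nonneg fun _ _ => real_inner_self_nonneg)

/-! ### Stability of the Stokes problem and the Rayleigh quotient -/

variable {Ω : Set Plane}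

/-- Stability of the Stokes problem: the difference of an eigenpair and of the solution of a source
problem. -/
lemma exists_stokes_stability (hΩ : IsBoundedLipschitzDomain Ω) (lam : ℝ) : ∃ C : ℝ, 0 ≤ C ∧
    ∀ (u : Velocity Ω) (p : L2 Ω), IsStokesEigen u p lam →
    ∀ (uh : Velocity Ω) (lamh : ℝ), rForm uh.val uh.val = 1 →
    ∀ (ut : Velocity Ω) (pt : L2 Ω), IsStokesSource (lamh • uh.val) ut pt →
      norm1 (ut - u) + ‖pt - p‖ ≤ C * (normNeg1 (u.val - uh.val) + |lam - lamh|) := by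
  obtain ⟨K, hK1, hK⟩ := exists_norm1_le hΩ.isBounded
  obtain ⟨B, hB, hinf⟩ := exists_infSup hΩ
  have hK0 : 0 ≤ K := zero_le_one.trans hK1
  refine ⟨(K ^ 2 + 2 * B * K) * (|lam| + 1), by positivity,
    fun u p hu uh lamh huh ut pt hut => ?_⟩
  set n := normNeg1 (u.val - uh.val)
  have hn : 0 ≤ n := normNeg1_nonneg _
  set F := |lam| * n + |lam - lamh| with hF
  have hF0 : 0 ≤ F := by positivity
  have hπ : MeanZero (pt - p) := hut.meanZero.sub hΩ.isBounded hu.meanZero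
  -- The load λ_h u_h - λu is split as -λ(u - u_h) - (λ - λ_h)u_h: the first part is measured in
  -- H⁻¹, the second through r(u_h, u_h) = 1.
  have hres : ∀ v : Velocity Ω, |aForm (ut - u) v - bForm v (pt - p)| ≤ F * norm1 v := by
    intro v
    have e1 : aForm (ut - u) v - bForm v (pt - p) =
        -(lam * rForm (u.val - uh.val) v.val) - (lam - lamh) * rForm uh.val v.val := by
      have h1 := hut.momentum v
      have h2 := hu.momentum v
      rw [rForm_smul_left] at h1
      rw [aForm_sub_left, bForm_sub_right, rForm_sub_left]
      linarith
    have h3 : |rForm uh.val v.val| ≤ norm1 v := by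
      have := abs_rForm_le uh.val v.val
      rw [huh, Real.sqrt_one, one_mul] at this
      exact this.trans (sqrt_rForm_le_norm1 v)
    rw [e1]
    refine (abs_sub _ _).trans ?_
    rw [abs_neg, abs_mul, abs_mul]
    calc |lam| * |rForm (u.val - uh.val) v.val| + |lam - lamh| * |rForm uh.val v.val|
        ≤ |lam| * (n * norm1 v) + |lam - lamh| * norm1 v := by
          gcongr
          exact abs_rForm_le_normNeg1 _ _
      _ = _ := by rw [hF]; ring
  -- Both velocities are divergence free, so the pressure drops out of the energy estimate.
  have hb0 : bForm (ut - u) (pt - p) = 0 := by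
    rw [bForm_sub_left, hut.incompressible _ hπ, hu.incompressible _ hπ, sub_zero]
  set s := √(aForm (ut - u) (ut - u)) with hs
  have hs0 : 0 ≤ s := Real.sqrt_nonneg _
  have hsF : s ≤ F * K := by
    have h1 := (le_abs_self _).trans (hres (ut - u))
    rw [hb0, sub_zero, ← Real.sq_sqrt (aForm_self_nonneg (ut - u)), ← hs] at h1
    have h2 : F * norm1 (ut - u) ≤ F * (K * s) := by gcongr; exact hK _
    rcases hs0.eq_or_lt with h0 | h0
    · rw [← h0]; positivity
    · refine le_of_mul_le_mul_right ?_ h0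
      nlinarith
  have hvel : norm1 (ut - u) ≤ K ^ 2 * F := by
    calc norm1 (ut - u) ≤ K * s := hK _
      _ ≤ K * (F * K) := by gcongr
      _ = _ := by ring
  -- The residual identity bounds b(v, p̃ - p) by a(ũ - u, v) plus the load, each at most FK times
  -- the gradient norm of `v`; the inf-sup condition does the rest.
  have hpre : ‖pt - p‖ ≤ B * (2 * (F * K)) := by
    refine hinf _ _ hπ (by positivity) fun v => ?_
    have h1 := hres v
    have h2 := abs_aForm_le (ut - u) v
    have h3 : F * norm1 v ≤ F * (K * √(aForm v v)) := by gcongr; exact hK v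
    have h4 : s * √(aForm v v) ≤ F * K * √(aForm v v) := by gcongr
    have h5 : |bForm v (pt - p)| ≤ |aForm (ut - u) v| +
        |aForm (ut - u) v - bForm v (pt - p)| := by
      have := abs_sub (aForm (ut - u) v) (aForm (ut - u) v - bForm v (pt - p))
      rwa [sub_sub_cancel] at this
    linarith
  have hFle : F ≤ (|lam| + 1) * (n + |lam - lamh|) := by
    rw [hF]
    nlinarith [abs_nonneg lam, abs_nonneg (lam - lamh), mul_nonneg (abs_nonneg lam)
      (abs_nonneg (lam - lamh))]
  calc norm1 (ut - u) + ‖pt - p‖ ≤ (K ^ 2 + 2 * B * K) * F := by linarith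
    _ ≤ (K ^ 2 + 2 * B * K) * ((|lam| + 1) * (n + |lam - lamh|)) := by gcongr
    _ = _ := by ring

/-- The defect of the Rayleigh quotient at `w` of an exact eigenvalue. -/
lemma rayleigh_defect_le (hb : Bornology.IsBounded Ω) {lam : ℝ} {u : Velocity Ω} {p : L2 Ω}
    (hu : IsStokesEigen u p lam) {w : Velocity Ω} {q : L2 Ω} {s : ℝ} (hq : MeanZero q)
    (hs : bForm w q = -s) (hs0 : 0 ≤ s) {D : ℝ} (hD : norm1 (w - u) + ‖q - p‖ ≤ D) :
    |aForm w w - lam * rForm w.val w.val| ≤ (5 + |lam|) * D ^ 2 + 2 * s := by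
  set d := w - u with hd
  have hn := norm1_nonneg d
  have hqn := norm_nonneg (q - p)
  have hsq := norm1_sq d
  have hr := rForm_self_nonneg d.val
  have ha := aForm_self_nonneg d
  have hb0 : bForm u p = 0 := hu.incompressible p hu.meanZero
  have hbq : bForm u (q - p) = 0 := hu.incompressible _ (hq.sub hb hu.meanZero)
  have hmom := hu.momentum w
  have huu := hu.momentum u
  -- Expanding about `u` leaves the cross term a(u, w) - λ r(u, w) = b(w, p), which is rewritten
  -- through b(d, q - p) and `s`. Below, a(d, d) contributes 1 and the b-term 4 to the factor 5 +
  -- |λ|.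
  have key : aForm w w - lam * rForm w.val w.val =
      aForm d d - lam * rForm d.val d.val - 2 * bForm d (q - p) - 2 * s := by
    have e1 : bForm d (q - p) = -s - bForm w p := by
      rw [hd, bForm_sub_left, hbq, sub_zero, bForm_sub_right, hs]
    rw [e1, hd, val_sub, aForm_sub_left, aForm_sub_right, aForm_sub_right, rForm_sub_left,
      rForm_sub_right, rForm_sub_right, aForm_comm w u, rForm_comm w.val u.val]
    rw [hb0] at huu
    linarith
  have hbd := abs_bForm_le d (q - p)
  have h1 : |bForm d (q - p)| ≤ 2 * D ^ 2 := by
    calc |bForm d (q - p)| ≤ 2 * √(aForm d d) * ‖q - p‖ := hbd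
      _ ≤ 2 * norm1 d * ‖q - p‖ := by gcongr; exact sqrt_aForm_le_norm1 d
      _ ≤ 2 * D * D := by gcongr <;> linarith
      _ = _ := by ring
  have hnD : norm1 d ^ 2 ≤ D ^ 2 := by gcongr; linarith
  have h2 : |lam * rForm d.val d.val| ≤ |lam| * D ^ 2 := by
    rw [abs_mul, abs_of_nonneg hr]
    gcongr
    linarith
  rw [abs_le] at h1 h2
  rw [key, abs_le]
  constructor <;> linarith [h1.1, h1.2, h2.1, h2.2]

/-- Reverse triangle inequality in L²: the norm of `w` is at least 1 - 1/2. -/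
lemma quarter_le_rForm {u w : Velocity Ω} (hu : rForm u.val u.val = 1)
    (h : norm1 (w - u) ≤ 1 / 2) : 1 / 4 ≤ rForm w.val w.val := by
  have h1 := (sqrt_rForm_le_norm1 (w - u)).trans h
  have h2 := abs_rForm_le u.val (w - u).val
  rw [hu, Real.sqrt_one, one_mul] at h2
  have h3 := Real.sq_sqrt (rForm_self_nonneg (w - u).val)
  have h4 := Real.sqrt_nonneg (rForm (w - u).val (w - u).val)
  have h5 : rForm w.val w.val = 1 + 2 * rForm u.val (w - u).val +
      rForm (w - u).val (w - u).val := by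
    rw [val_sub, rForm_sub_left, rForm_sub_right, rForm_sub_right, rForm_comm w.val u.val, hu]
    ring
  rw [abs_le] at h2
  nlinarith [h2.1]

/-- The summand `C` is added to the constant so that the same one also serves the error bound for
velocity and pressure. -/
lemma abs_div_sub_le {A R lam m k C ε s : ℝ} (hm : 0 < m) (hR : m ≤ R) (hk : 0 ≤ k) (hC : 0 ≤ C)
    (hs : 0 ≤ s) (h : |A - lam * R| ≤ k * (C * ε) ^ 2 + 2 * s) :
    |A / R - lam| ≤ (C + (k * C ^ 2 + 2) / m) * ε ^ 2 + (C + (k * C ^ 2 + 2) / m) * s := by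
  have hR0 : 0 < R := hm.trans_le hR
  have hdiv : A / R - lam = (A - lam * R) / R := by field_simp
  have hnum : |A - lam * R| ≤ (k * C ^ 2 + 2) * (ε ^ 2 + s) := by
    have : 0 ≤ k * C ^ 2 * s := by positivity
    nlinarith [sq_nonneg ε]
  rw [hdiv, abs_div, abs_of_pos hR0]
  calc |A - lam * R| / R ≤ (k * C ^ 2 + 2) * (ε ^ 2 + s) / m := by gcongr
    _ = (k * C ^ 2 + 2) / m * (ε ^ 2 + s) := by ring
    _ ≤ (C + (k * C ^ 2 + 2) / m) * (ε ^ 2 + s) := by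
        gcongr
        linarith
    _ = _ := by ring

end StokesLPS
end

/-! ### The main theorem -/

theorem theorem5p1 (Ω : Set Plane) (hΩ : IsBoundedLipschitzDomain Ω) (lam : ℝ) :
    ∃ δ : ℝ, 0 < δ ∧ ∀ c₀ : ℝ, 0 < c₀ → ∃ C : ℝ, 0 < C ∧
      -- the exact eigenpair
      ∀ (u : Velocity Ω) (p : L2 Ω), IsStokesEigen u p lam →
      -- the discrete eigenpair
      ∀ (S : Stabilization Ω) (W : ScalarFE S.mesh)
        (uh : Velocity Ω) (ph : H1 Ω) (lamh : ℝ),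
        IsDiscreteEigen W.velocities W.pressures S uh ph lamh →
      -- the exact solution of the auxiliary source problem
      ∀ (ut : Velocity Ω) (pt : L2 Ω), IsStokesSource (lamh • uh.val) ut pt →
      -- the enriched spaces, with their stabilization, and the discrete source problem
      ∀ (Vt : Submodule ℝ (Velocity Ω)) (Qt : Submodule ℝ (H1 Ω)) (St : Stabilization Ω),
        (∀ q ∈ Qt, MeanZero q.1.1) →
        W.velocities ⊆ (Vt : Set (Velocity Ω)) → W.pressures ⊆ (Qt : Set (H1 Ω)) →
      ∀ (uth : Velocity Ω) (pth : H1 Ω),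
        IsDiscreteSource (Vt : Set (Velocity Ω)) (Qt : Set (H1 Ω)) St (lamh • uh.val) uth pth →
      ∀ ε : ℝ,
        ε = normNeg1 (u.val - uh.val) + |lam - lamh| + norm1 (ut - uth) + ‖pt - pth.1.1‖ →
        ((ε ≤ δ ∨ c₀ ≤ rForm uth.val uth.val) →
          |rayleigh uth - lam| ≤ C * ε ^ 2 + C * St.form pth pth) ∧
        norm1 (uth - u) + ‖pth.1.1 - p‖ ≤ C * ε := by
  obtain ⟨C₀, hC₀, hstab⟩ := exists_stokes_stability hΩ lam
  -- The 1 accounts for the distance from (ũ, p̃) to (ũ_h, p̃_h), which is part of ε.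
  set C₁ := C₀ + 1 with hC₁
  have hC₁0 : 0 < C₁ := by positivity
  -- With this δ the velocity error is at most 1/2, so that r(ũ_h, ũ_h) ≥ 1/4 whatever c₀ is.
  refine ⟨1 / (2 * C₁), by positivity, fun c₀ hc₀ => ?_⟩
  set m := min c₀ (1 / 4) with hm
  have hm0 : 0 < m := lt_min hc₀ (by norm_num)
  refine ⟨C₁ + ((5 + |lam|) * C₁ ^ 2 + 2) / m, by positivity, ?_⟩
  intro u p hu S W uh ph lamh huh ut pt hut Vt Qt St hQt _ _ uth pth huth ε hε
  have hst := hstab u p hu uh lamh huh.normalized ut pt hut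
  have hn := normNeg1_nonneg (u.val - uh.val)
  have hl := abs_nonneg (lam - lamh)
  have h1 := norm1_nonneg (ut - uth)
  have h2 := norm_nonneg (pt - pth.1.1)
  have hε0 : 0 ≤ ε := by rw [hε]; positivity
  have herr : norm1 (uth - u) + ‖pth.1.1 - p‖ ≤ C₁ * ε := by
    have t1 := norm1_sub_le uth ut u
    rw [norm1_sub_rev uth ut] at t1
    have t2 := norm_sub_le_norm_sub_add_norm_sub pth.1.1 pt p
    rw [norm_sub_rev pth.1.1 pt] at t2
    have t3 : C₀ * (normNeg1 (u.val - uh.val) + |lam - lamh|) ≤ C₀ * ε := by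
      gcongr; linarith
    rw [hC₁]
    linarith
  have hs0 := St.form_self_nonneg pth
  have hq : 0 ≤ ((5 + |lam|) * C₁ ^ 2 + 2) / m := by positivity
  refine ⟨fun hcase => ?_, herr.trans ?_⟩
  · have hR : m ≤ rForm uth.val uth.val := by
      rcases hcase with h | h
      · refine (min_le_right _ _).trans (quarter_le_rForm hu.normalized ?_)
        have : C₁ * ε ≤ C₁ * (1 / (2 * C₁)) := by gcongr
        have e1 : C₁ * (1 / (2 * C₁)) = 1 / 2 := by field_simp
        linarith [norm_nonneg (pth.1.1 - p)]
      · exact (min_le_left _ _).trans h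
    have hR0 : 0 < rForm uth.val uth.val := hm0.trans_le hR
    -- The discrete continuity equation tested with p̃_h itself identifies b(ũ_h, p̃_h) with
    -- -S̃_h(p̃_h, p̃_h).
    have hdef := rayleigh_defect_le hΩ.isBounded hu (hQt pth huth.mem_pressure)
      (s := St.form pth pth) (by linarith [huth.stabilized pth huth.mem_pressure]) hs0 herr
    rw [rayleigh]
    generalize St.form pth pth = s at hdef hs0 ⊢
    exact abs_div_sub_le hm0 hR (by positivity) hC₁0.le hs0 hdef
  · gcongr
    linarith
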